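/- For a nonempty finite simple graph $G=(V,E)$ with weight function $w\colon V\to\mathbb{Z}^{+}$, write $w(X)=\sum_{v\in X}w(v)$ for $X\subseteq V$ and let \[ \mathrm{wvi}(G)=\min_{S\subseteq V}\Big\{w(S)+\max_{C\in\mathrm{cc}(G-S)}w(V(C))\Big\}, \] where $\mathrm{cc}(G-S)$ is the set of connected components of $G-S$ and the maximum over the empty set is $0$. \textsc{Unary Weighted Vertex Integrity} is the following problem: given such a weighted graph $G$, with the weights encoded in unary, and an integer $k$, decide whether $\mathrm{wvi}(G)\le k$. For a graph $H$ with vertices $v_1,\dots,v_c$, $c\ge 2$, and disjoint graphs $H_1,\dots,H_c$, the substitution $H(H_1,\dots,H_c)$ is the disjoint union of $H_1,\dots,H_c$ together with all edges between $V(H_i)$ and $V(H_j)$ for every edge $\{v_i,v_j\}$ of $H$. A modular decomposition of $G$ is a rooted ordered tree whose inner nodes have at least two children, each inner node with $c$ children being labelled with a graph on $c$ vertices; a leaf represents the one-vertex graph, an inner node with label $H$ represents $H(H_1,\dots,H_c)$, where $H_i$ is the graph represented by its $i$-th child, and the root represents a graph isomorphic to $G$. Its width is the maximum number of children of an inner node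 ($0$ if there is no inner node), and the modular-width $\mathrm{mw}(G)$ is the minimum width of a modular decomposition of $G$. \textbf{Theorem.} \textsc{Unary Weighted Vertex Integrity} is fixed-parameter tractable parameterized by modular-width. That is, there are an algorithm (a random access machine with addition, truncated subtraction and halving, every instruction costing one step), a computable function $f\colon\mathbb{N}\to\mathbb{N}$ and a constant $c$ such that the algorithm decides every instance $(G,w,k)$ in at most $f(\mathrm{mw}(G))\cdot |x|^{c}$ steps, where $|x|$ is the length of the binary string $x$ encoding the instance (with the weights in unary, and $k$ in binary). -/

import Mathlib

/-! ### Weighted vertex integrity -/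

open Classical in
/-- The largest weight of a connected component of `G - S`
(`0` if `G - S` has no vertices, hence no components). -/
noncomputable def maxComponentWeight {V : Type*} [Fintype V] (G : SimpleGraph V) (w : V → ℕ+)
    (S : Finset V) : ℕ :=
  (Finset.univ : Finset (G.induce {v | v ∉ S}).ConnectedComponent).sup fun C =>
    ∑ v ∈ C.supp.toFinset, (w v : ℕ)

/-- The weighted vertex integrity: the minimum over all `S ⊆ V` of
`w(S) + max_{C ∈ cc(G - S)} w(V(C))`. -/
noncomputable def weightedVertexIntegrity {V : Type*} [Fintype V] (G : SimpleGraph V)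
    (w : V → ℕ+) : ℕ :=
  (Finset.univ : Finset (Finset V)).inf' Finset.univ_nonempty fun S =>
    (∑ v ∈ S, (w v : ℕ)) + maxComponentWeight G w S

/-! ### Modular decompositions and modular-width -/

/-- The substitution `H(F₁, …, F_c)`: the disjoint union of the graphs `F i`, together with all
edges between `V(F i)` and `V(F j)` for every edge `{i, j}` of `H`. -/
def substitution {ι : Type*} {V : ι → Type*} (H : SimpleGraph ι) (F : ∀ i, SimpleGraph (V i)) :
    SimpleGraph (Σ i, V i) where
  Adj x y := H.Adj x.1 y.1 ∨ ∃ i u v, (F i).Adj u v ∧ x = ⟨i, u⟩ ∧ y = ⟨i, v⟩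
  symm := by
    constructor
    rintro x y (h | ⟨i, u, v, h, hx, hy⟩)
    · exact Or.inl h.symm
    · exact Or.inr ⟨i, v, u, h.symm, hy, hx⟩
  loopless := by
    constructor
    rintro x (h | ⟨i, u, v, h, hx, hy⟩)
    · exact H.irrefl h
    · rw [hx] at hy
      obtain rfl : u = v := by simpa using hy
      exact (F i).irrefl h

/-- A modular decomposition: a rooted ordered tree in which every inner node with `c` children
(`c ≥ 2`) is labelled with a graph on `c` vertices. -/
inductive ModularDecomposition : Type
  | leaf : ModularDecomposition
  | node (c : ℕ) (hc : 2 ≤ c) (H : SimpleGraph (Fin c))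
      (child : Fin c → ModularDecomposition) : ModularDecomposition

namespace ModularDecomposition

/-- The vertices of the represented graph (the leaves of the tree). -/
def Vert : ModularDecomposition → Type
  | leaf => Unit
  | node _ _ _ child => Σ i, (child i).Vert

/-- The represented graph. -/
def graph : (T : ModularDecomposition) → SimpleGraph T.Vert
  | leaf => (⊥ : SimpleGraph Unit)
  | node _ _ H child => substitution H fun i => (child i).graph

/-- The width: the maximum number of children of an inner node (`0` if there is none). -/
def width : ModularDecomposition → ℕ
  | leaf => 0
  | node c _ _ child => max c (Finset.univ.sup fun i => (child i).width)

end ModularDecomposition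

/-- The modular-width: the minimum width of a modular decomposition whose root represents a graph
isomorphic to `G`. (Every finite graph with at least one vertex has one.) -/
noncomputable def modularWidth {V : Type*} (G : SimpleGraph V) : ℕ :=
  sInf {k | ∃ T : ModularDecomposition, Nonempty (T.graph ≃g G) ∧ T.width = k}

/-! ### Random access machines

RAM programs with the uniform cost measure. The arithmetic instructions are addition,
truncated subtraction and halving; there is no multiplication, so that the model is
polynomially equivalent to Turing machines. -/

/-- A machine state: registers, which are addressed directly, and arrays, whose cells are
addressed through the contents of a register. A program mentions only finitely many registers and
arrays. -/
structure RAMState where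
  reg : ℕ → ℕ
  arr : ℕ → ℕ → ℕ

/-- The instructions. The arguments are numbers of registers, except for the constant `c` in
`const r c` and the number `a` of an array in `load` and `store`. -/
inductive RAMInstr : Type
  | const (r c : ℕ) : RAMInstr
  | copy (r s : ℕ) : RAMInstr
  | add (r s t : ℕ) : RAMInstr
  | sub (r s t : ℕ) : RAMInstr
  | half (r s : ℕ) : RAMInstr
  | load (r a i : ℕ) : RAMInstr
  | store (a i r : ℕ) : RAMInstr

/-- The effect of an instruction. -/
def RAMInstr.apply (σ : RAMState) : RAMInstr → RAMState
  | const r c => { σ with reg := Function.update σ.reg r c }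
  | copy r s => { σ with reg := Function.update σ.reg r (σ.reg s) }
  | add r s t => { σ with reg := Function.update σ.reg r (σ.reg s + σ.reg t) }
  | sub r s t => { σ with reg := Function.update σ.reg r (σ.reg s - σ.reg t) }
  | half r s => { σ with reg := Function.update σ.reg r (σ.reg s / 2) }
  | load r a i => { σ with reg := Function.update σ.reg r (σ.arr a (σ.reg i)) }
  | store a i r =>
      { σ with arr := Function.update σ.arr a (Function.update (σ.arr a) (σ.reg i) (σ.reg r)) }

/-- Programs: instructions combined by sequencing, branching on whether register `r` is nonzero,
and looping while register `r` is nonzero. -/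
inductive RAMProg : Type
  | instr (c : RAMInstr) : RAMProg
  | seq (p q : RAMProg) : RAMProg
  | cond (r : ℕ) (p q : RAMProg) : RAMProg
  | loop (r : ℕ) (p : RAMProg) : RAMProg

/-- `RAMExec p σ t τ`: started in `σ`, the program `p` halts in `τ` after exactly `t` steps. Every
executed instruction and every evaluated test is one step. -/
inductive RAMExec : RAMProg → RAMState → ℕ → RAMState → Prop
  | instr (c : RAMInstr) (σ : RAMState) : RAMExec (.instr c) σ 1 (c.apply σ)
  | seq {p q : RAMProg} {σ τ υ : RAMState} {s t : ℕ} :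
      RAMExec p σ s τ → RAMExec q τ t υ → RAMExec (.seq p q) σ (s + t) υ
  | cond_pos {r : ℕ} {p q : RAMProg} {σ τ : RAMState} {t : ℕ} :
      σ.reg r ≠ 0 → RAMExec p σ t τ → RAMExec (.cond r p q) σ (t + 1) τ
  | cond_zero {r : ℕ} {p q : RAMProg} {σ τ : RAMState} {t : ℕ} :
      σ.reg r = 0 → RAMExec q σ t τ → RAMExec (.cond r p q) σ (t + 1) τ
  | loop_pos {r : ℕ} {p : RAMProg} {σ τ υ : RAMState} {s t : ℕ} :
      σ.reg r ≠ 0 → RAMExec p σ s τ → RAMExec (.loop r p) τ t υ →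
        RAMExec (.loop r p) σ (s + t + 1) υ
  | loop_zero {r : ℕ} {p : RAMProg} {σ : RAMState} :
      σ.reg r = 0 → RAMExec (.loop r p) σ 1 σ

/-- The start state on input `x`: register `0` holds the length of `x`, cell `i` of array `0` holds
the `i`-th symbol of `x` as `0` or `1`, and everything else is `0`. -/
def RAMState.start (x : List Bool) : RAMState where
  reg r := if r = 0 then x.length else 0
  arr a i := if a = 0 then (x.getD i false).toNat else 0

/-- On input `x`, the program `p` halts after at most `T` steps, with `1` in register `0` if
`answer` holds, and with `0` in register `0` otherwise. -/
def RAMProg.DecidesWithin (p : RAMProg) (x : List Bool) (answer : Prop) (T : ℕ) : Prop :=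
  ∃ t ≤ T, ∃ τ, RAMExec p (RAMState.start x) t τ ∧
    (answer → τ.reg 0 = 1) ∧ (¬ answer → τ.reg 0 = 0)

/-! ### Parameterized problems -/

/-- A parameterized decision problem: instances, their encodings as binary strings, the
parameter of an instance, and the set of yes-instances. -/
structure ParameterizedProblem where
  Inst : Type
  encode : Inst → List Bool
  param : Inst → ℕ
  yes : Set Inst

/-- Fixed-parameter tractability: one algorithm decides every instance `I` in at most
`f(k) · |x| ^ c` steps, where `x` is the encoding of `I`, `k` its parameter, `f` a computable
function and `c` a constant. The algorithm is given `x` only. -/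
def ParameterizedProblem.IsFPT (P : ParameterizedProblem) : Prop :=
  ∃ (p : RAMProg) (f : ℕ → ℕ) (c : ℕ), Computable f ∧
    ∀ I : P.Inst, p.DecidesWithin (P.encode I) (I ∈ P.yes)
      (f (P.param I) * (P.encode I).length ^ c)

/-! ### The problem -/

/-- An instance: a nonempty finite vertex-weighted graph and an integer `k`. -/
structure WVIInstance where
  n : ℕ
  n_pos : 0 < n
  G : SimpleGraph (Fin n)
  w : Fin n → ℕ+
  k : ℤ

/-- The number `m` in unary: `m` ones followed by a zero. -/
def unaryCode (m : ℕ) : List Bool := List.replicate m true ++ [false]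

open Classical in
/-- The encoding: the number of vertices, the rows of the adjacency matrix, the weights in unary,
the sign of `k`, and finally `|k|` in binary (least significant bit first). -/
noncomputable def WVIInstance.encodeUnary (I : WVIInstance) : List Bool :=
  unaryCode I.n ++
  ((List.finRange I.n).flatMap fun u => (List.finRange I.n).map fun v => decide (I.G.Adj u v)) ++
  ((List.finRange I.n).flatMap fun v => unaryCode (I.w v)) ++
  [decide (I.k < 0)] ++ I.k.natAbs.bits

/-- Unary Weighted Vertex Integrity, parameterized by the modular-width. -/
noncomputable def unaryWVIByModularWidth : ParameterizedProblem where
  Inst := WVIInstance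
  encode := WVIInstance.encodeUnary
  param I := modularWidth I.G
  yes := {I | (weightedVertexIntegrity I.G I.w : ℤ) ≤ I.k}

/-!
For a bound `l`, call a set `T` of vertices feasible if no component of the graph induced by `T`
weighs more than `l`. If `T` is the set of vertices that are not deleted, then `wvi(G) ≤ k` says
that for some `l`, at most the total weight `W`, there is a feasible set of weight at least
`W + l - k` (`weightedVertexIntegrity_le_iff`). As the weights are in unary, all `l ≤ W` can be
tried, and for each of them it suffices to compute the weight of a heaviest feasible set. Feasibility
is expressed by colourings that are constant along edges and whose colour classes weigh at most `l`;
this avoids connectivity.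

For a fixed `l`, the algorithm keeps a partition of the vertices into modules, each with a
representative and with the weight of a heaviest feasible subset (`Contraction`). It starts with
singletons. As long as there are at least two representatives, the graph on them has a module `X`
with at least two and at most `mw(G)` vertices: restrict a modular decomposition of `G` to the
representatives and take a lowest inner node that still has two vertices below it
(`exists_small_module`). So a smallest module with at least two vertices is small; it is found by
closing every pair of vertices under the addition of vertices that distinguish two vertices of the
set (`find_spec`). Its classes are united to a single one (`Contraction.merge`).

The weight of a heaviest feasible subset of the union of the classes of `X` is the maximum over all
valid labellings of `X`, of which there are at most `2 ^ (m * m)` where `m` is the size of `X`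
(`enumerate_spec`). A label says that a class is deleted, or that no adjacent class keeps a vertex,
in which case it contributes the weight of its heaviest feasible subset, or that the vertices kept
have one particular colour. In the last case the edges within the class are of no importance: all
vertices of the classes with this colour form a pool from which any set of weight at most `l` may be
kept, and the best choice is a knapsack problem, solved by dynamic programming. Every valid labelling
is realized by a feasible set (`Contraction.exists_feasible`). Conversely, if two adjacent classes
of a feasible set both keep vertices, then these vertices all have the same colour, because every
vertex of one class is adjacent to every vertex of the other (`Contraction.exists_labels`).

The algorithm is written in a structured language with bounded loops, for which running times are
computed from the bounds of the loops (`Cmd.cost_le`, `Cmd.cost_for_le`); its programs are translated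
to the random access machine with their exact running time (`Cmd.compile_exec`). Outside the
enumeration of labellings all loops have bounds at most the length of the input, so
`2 ^ (mw(G) * mw(G))` is the only factor that depends on the parameter (`step_cost`, `main_spec`).
-/

/-! ### A structured language with bounded loops -/

namespace Imp

variable {ν α : Type}

/-- Expressions over scalar variables `ν` and arrays `α`. A condition is an expression; it holds if
its value is nonzero. -/
inductive Exp (ν α : Type) : Type
  | lit (c : ℕ) : Exp ν α
  | var (r : ν) : Exp ν α
  | add (e f : Exp ν α) : Exp ν α
  | sub (e f : Exp ν α) : Exp ν α
  | half (e : Exp ν α) : Exp ν α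
  | get (a : α) (e : Exp ν α) : Exp ν α

/-- Commands. The loop `for_ i b c` executes `c` as many times as the value of `b` at its start
says, with `i` set to `0, 1, 2, …` before each pass; so every command terminates. -/
inductive Cmd (ν α : Type) : Type
  | skip : Cmd ν α
  | set (r : ν) (e : Exp ν α) : Cmd ν α
  | put (a : α) (i e : Exp ν α) : Cmd ν α
  | seq (c d : Cmd ν α) : Cmd ν α
  | ite (e : Exp ν α) (c d : Cmd ν α) : Cmd ν α
  | for_ (i b : ν) (c : Cmd ν α) : Cmd ν α

/-- A state: the values of the variables and the contents of the arrays. -/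
structure St (ν α : Type) where
  reg : ν → ℕ
  arr : α → ℕ → ℕ

/-- Assignment to a variable. -/
def St.set [DecidableEq ν] (s : St ν α) (r : ν) (v : ℕ) : St ν α :=
  { s with reg := Function.update s.reg r v }

/-- Assignment to an array cell. -/
def St.put [DecidableEq α] (s : St ν α) (a : α) (i v : ℕ) : St ν α :=
  { s with arr := Function.update s.arr a (Function.update (s.arr a) i v) }

section St
variable (s : St ν α)

@[simp] theorem St.set_reg [DecidableEq ν] (r : ν) (v : ℕ) (q : ν) :
    (s.set r v).reg q = if q = r then v else s.reg q := by
  simp [St.set, Function.update_apply]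

@[simp] theorem St.set_arr [DecidableEq ν] (r : ν) (v : ℕ) : (s.set r v).arr = s.arr := rfl

@[simp] theorem St.put_reg [DecidableEq α] (a : α) (i v : ℕ) : (s.put a i v).reg = s.reg := rfl

theorem St.put_arr [DecidableEq α] (a : α) (i v : ℕ) (b : α) :
    (s.put a i v).arr b = if b = a then Function.update (s.arr a) i v else s.arr b := by
  simp [St.put, Function.update_apply]

@[simp] theorem St.put_arr_apply [DecidableEq α] (a : α) (i v : ℕ) (b : α) (j : ℕ) :
    (s.put a i v).arr b j = if b = a ∧ j = i then v else s.arr b j := by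
  rw [St.put_arr]
  by_cases h : b = a
  · subst h; simp [Function.update_apply]
  · simp [h]

end St

namespace Exp

instance : Add (Exp ν α) := ⟨Exp.add⟩
instance : Sub (Exp ν α) := ⟨Exp.sub⟩
instance (k : ℕ) : OfNat (Exp ν α) k := ⟨Exp.lit k⟩

/-- Negation. -/
def not (e : Exp ν α) : Exp ν α := 1 - e
/-- Conjunction. -/
def and (e f : Exp ν α) : Exp ν α := (e.not + f.not).not
/-- The condition `e < f`. -/
def lt (e f : Exp ν α) : Exp ν α := f - e
/-- The condition `e ≤ f`. -/
def le (e f : Exp ν α) : Exp ν α := (e - f).not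
/-- The condition `e = f`. -/
def eq (e f : Exp ν α) : Exp ν α := ((e - f) + (f - e)).not

/-- The value of an expression. -/
def eval (s : St ν α) : Exp ν α → ℕ
  | lit c => c
  | var r => s.reg r
  | add e f => e.eval s + f.eval s
  | sub e f => e.eval s - f.eval s
  | half e => e.eval s / 2
  | get a e => s.arr a (e.eval s)

/-- The number of steps the machine takes to evaluate an expression. -/
def cost : Exp ν α → ℕ
  | lit _ => 1
  | var _ => 1
  | add e f => e.cost + (f.cost + 1)
  | sub e f => e.cost + (f.cost + 1)
  | half e => e.cost + 1
  | get _ e => e.cost + 1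

variable (s : St ν α) (e f : Exp ν α)

@[simp] theorem eval_var (r : ν) : (var r : Exp ν α).eval s = s.reg r := rfl
@[simp] theorem eval_zero : (0 : Exp ν α).eval s = 0 := rfl
@[simp] theorem eval_one : (1 : Exp ν α).eval s = 1 := rfl
@[simp] theorem eval_two : (2 : Exp ν α).eval s = 2 := rfl
@[simp] theorem eval_add : (e + f).eval s = e.eval s + f.eval s := rfl
@[simp] theorem eval_sub : (e - f).eval s = e.eval s - f.eval s := rfl
@[simp] theorem eval_half : (half e).eval s = e.eval s / 2 := rfl
@[simp] theorem eval_get (a : α) : (get a e).eval s = s.arr a (e.eval s) := rfl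

@[simp] theorem eval_not : e.not.eval s = 0 ↔ ¬e.eval s = 0 := by
  simp only [not, eval_sub, eval_one]; omega

@[simp] theorem eval_and : (e.and f).eval s = 0 ↔ ¬(¬e.eval s = 0 ∧ ¬f.eval s = 0) := by
  simp only [and, eval_not, eval_add, Nat.add_eq_zero_iff]

@[simp] theorem eval_lt : (e.lt f).eval s = 0 ↔ ¬e.eval s < f.eval s := by
  simp only [lt, eval_sub]; omega

@[simp] theorem eval_le : (e.le f).eval s = 0 ↔ ¬e.eval s ≤ f.eval s := by
  simp only [le, eval_not, eval_sub]; omega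

theorem eval_eq_eq_ite : (e.eq f).eval s = if e.eval s = f.eval s then 1 else 0 := by
  simp only [eq, not, eval_sub, eval_add, eval_one]; split <;> omega

@[simp] theorem eval_eq : (e.eq f).eval s = 0 ↔ ¬e.eval s = f.eval s := by
  simp [eval_eq_eq_ite]

end Exp

/-- `f (t - 1)` after … after `f 1` after `f 0`. -/
def iter {σ : Type} (f : ℕ → σ → σ) : ℕ → σ → σ
  | 0, s => s
  | t + 1, s => f t (iter f t s)

namespace Cmd

/-- A conditional without alternative. -/
def when (e : Exp ν α) (c : Cmd ν α) : Cmd ν α := ite e c skip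

/-- The variables that a command assigns. -/
def writes : Cmd ν α → List ν
  | skip => []
  | set r _ => [r]
  | put _ _ _ => []
  | seq c d => c.writes ++ d.writes
  | ite _ c d => c.writes ++ d.writes
  | for_ i _ c => i :: c.writes

/-- The arrays that a command writes to. -/
def arrays : Cmd ν α → List α
  | skip => []
  | set _ _ => []
  | put a _ _ => [a]
  | seq c d => c.arrays ++ d.arrays
  | ite _ c d => c.arrays ++ d.arrays
  | for_ _ _ c => c.arrays

/-- The variables that bound the loops of a command. -/
def bounds : Cmd ν α → List ν
  | skip => []
  | set _ _ => []
  | put _ _ _ => []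
  | seq c d => c.bounds ++ d.bounds
  | ite _ c d => c.bounds ++ d.bounds
  | for_ _ b c => b :: c.bounds

/-- The nesting depth of the loops of a command. -/
def depth : Cmd ν α → ℕ
  | skip => 0
  | set _ _ => 0
  | put _ _ _ => 0
  | seq c d => max c.depth d.depth
  | ite _ c d => max c.depth d.depth
  | for_ _ _ c => c.depth + 1

/-- The length of a command, up to a factor: if each of its loops made a single pass, and if both
branches of every conditional were taken, this would be the number of steps. -/
def size : Cmd ν α → ℕ
  | skip => 1
  | set _ e => e.cost + 1
  | put _ i e => i.cost + (e.cost + 1)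
  | seq c d => c.size + d.size
  | ite e c d => e.cost + (c.size + d.size + 1)
  | for_ _ _ c => c.size + 8

variable [DecidableEq ν] [DecidableEq α]

/-- The effect of a command. -/
def run : Cmd ν α → St ν α → St ν α
  | skip, s => s
  | set r e, s => s.set r (e.eval s)
  | put a i e, s => s.put a (i.eval s) (e.eval s)
  | seq c d, s => d.run (c.run s)
  | ite e c d, s => if e.eval s ≠ 0 then c.run s else d.run s
  | for_ i b c, s => iter (fun t s' => c.run (s'.set i t)) (s.reg b) s

/-- The number of steps the machine takes to execute a command. -/
def cost : Cmd ν α → St ν α → ℕ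
  | skip, _ => 1
  | set _ e, _ => e.cost + 1
  | put _ i e, _ => i.cost + (e.cost + 1)
  | seq c d, s => c.cost s + d.cost (c.run s)
  | ite e c d, s => e.cost + ((if e.eval s ≠ 0 then c.cost s else d.cost s) + 1)
  | for_ i b c, s =>
      3 + ∑ t ∈ Finset.range (s.reg b),
        (c.cost ((iter (fun t s' => c.run (s'.set i t)) t s).set i t) + 5)

@[simp] theorem run_skip (s : St ν α) : (skip : Cmd ν α).run s = s := rfl
@[simp] theorem run_set (r : ν) (e : Exp ν α) (s : St ν α) :
    (set r e).run s = s.set r (e.eval s) := rfl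
@[simp] theorem run_put (a : α) (i e : Exp ν α) (s : St ν α) :
    (put a i e).run s = s.put a (i.eval s) (e.eval s) := rfl
@[simp] theorem run_seq (c d : Cmd ν α) (s : St ν α) : (seq c d).run s = d.run (c.run s) := rfl
theorem run_ite (e : Exp ν α) (c d : Cmd ν α) (s : St ν α) :
    (ite e c d).run s = if e.eval s ≠ 0 then c.run s else d.run s := rfl
theorem run_when (e : Exp ν α) (c : Cmd ν α) (s : St ν α) :
    (when e c).run s = if e.eval s ≠ 0 then c.run s else s := rfl

theorem cost_seq (c d : Cmd ν α) (s : St ν α) :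
    (seq c d).cost s = c.cost s + d.cost (c.run s) := rfl
theorem cost_when (e : Exp ν α) (c : Cmd ν α) (s : St ν α) :
    (when e c).cost s = e.cost + ((if e.eval s ≠ 0 then c.cost s else 1) + 1) := rfl

theorem run_reg (c : Cmd ν α) : ∀ (s : St ν α) (r : ν), r ∉ c.writes → (c.run s).reg r = s.reg r := by
  induction c with
  | skip => intros; rfl
  | set r e => intro s q h; simp only [writes, List.mem_singleton] at h; simp [h]
  | put a i e => intros; rfl
  | seq c d hc hd =>
    intro s q h
    simp only [writes, List.mem_append, not_or] at h
    rw [run_seq, hd _ _ h.2, hc _ _ h.1]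
  | ite e c d hc hd =>
    intro s q h
    simp only [writes, List.mem_append, not_or] at h
    rw [run_ite]
    split
    · exact hc _ _ h.1
    · exact hd _ _ h.2
  | for_ i b c hc =>
    intro s q h
    simp only [writes, List.mem_cons, not_or] at h
    have : ∀ t, (iter (fun t s' => c.run (s'.set i t)) t s).reg q = s.reg q := by
      intro t
      induction t with
      | zero => rfl
      | succ t ih => simp only [iter]; rw [hc _ _ h.2]; simp [h.1, ih]
    exact this _

theorem run_arr (c : Cmd ν α) : ∀ (s : St ν α) (a : α), a ∉ c.arrays → (c.run s).arr a = s.arr a := by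
  induction c with
  | skip => intros; rfl
  | set r e => intros; rfl
  | put b i e =>
    intro s a h; simp only [arrays, List.mem_singleton] at h; simp [St.put_arr, h]
  | seq c d hc hd =>
    intro s q h
    simp only [arrays, List.mem_append, not_or] at h
    rw [run_seq, hd _ _ h.2, hc _ _ h.1]
  | ite e c d hc hd =>
    intro s q h
    simp only [arrays, List.mem_append, not_or] at h
    rw [run_ite]
    split
    · exact hc _ _ h.1
    · exact hd _ _ h.2
  | for_ i b c hc =>
    intro s q h
    have : ∀ t, (iter (fun t s' => c.run (s'.set i t)) t s).arr q = s.arr q := by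
      intro t
      induction t with
      | zero => rfl
      | succ t ih => simp only [iter]; rw [hc _ _ h]; simp [ih]
    exact this _

/-- `s` and `s'` agree on the variables outside `W` and the arrays outside `A`. -/
structure Frame (W : List ν) (A : List α) (s s' : St ν α) : Prop where
  reg : ∀ r, r ∉ W → s'.reg r = s.reg r
  arr : ∀ a, a ∉ A → s'.arr a = s.arr a

theorem frame_run (c : Cmd ν α) (s : St ν α) : Frame c.writes c.arrays s (c.run s) :=
  ⟨fun r h => run_reg c s r h, fun a h => run_arr c s a h⟩

/-- The rule for loops: an invariant, indexed by the number of passes made. A pass may use that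
whatever the body does not assign has its value from before the loop. -/
theorem run_for {i b : ν} {c : Cmd ν α} {s : St ν α} (Inv : ℕ → St ν α → Prop) (h0 : Inv 0 s)
    (hstep : ∀ t < s.reg b, ∀ s', Frame (i :: c.writes) c.arrays s s' → Inv t s' →
      Inv (t + 1) (c.run (s'.set i t))) :
    Inv (s.reg b) ((for_ i b c).run s) := by
  have : ∀ t ≤ s.reg b, Inv t (iter (fun t s' => c.run (s'.set i t)) t s) ∧
      Frame (i :: c.writes) c.arrays s (iter (fun t s' => c.run (s'.set i t)) t s) := by
    intro t
    induction t with
    | zero => exact fun _ => ⟨h0, fun _ _ => rfl, fun _ _ => rfl⟩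
    | succ t ih =>
      intro ht
      obtain ⟨h1, h2⟩ := ih (by omega)
      refine ⟨hstep t (by omega) _ h2 h1, fun r hr => ?_, fun a ha => ?_⟩
      · have hr' := hr
        simp only [List.mem_cons, not_or] at hr
        simp only [iter]
        rw [run_reg _ _ _ hr.2]
        simp [hr.1, h2.reg r hr']
      · simp only [iter]
        rw [run_arr _ _ _ ha]
        simp [h2.arr a ha]
  exact (this _ le_rfl).1

/-- The running time of a loop whose passes preserve an invariant under which they take at most
`T` steps each. -/
theorem cost_for_le {i b : ν} {c : Cmd ν α} {s : St ν α} (Inv : ℕ → St ν α → Prop) (T : ℕ)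
    (h0 : Inv 0 s)
    (hstep : ∀ t < s.reg b, ∀ s', Frame (i :: c.writes) c.arrays s s' → Inv t s' →
      Inv (t + 1) (c.run (s'.set i t)) ∧ c.cost (s'.set i t) ≤ T) :
    (for_ i b c).cost s ≤ 3 + s.reg b * (T + 5) := by
  have : ∀ t ≤ s.reg b, Inv t (iter (fun t s' => c.run (s'.set i t)) t s) ∧
      Frame (i :: c.writes) c.arrays s (iter (fun t s' => c.run (s'.set i t)) t s) := by
    intro t
    induction t with
    | zero => exact fun _ => ⟨h0, fun _ _ => rfl, fun _ _ => rfl⟩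
    | succ t ih =>
      intro ht
      obtain ⟨h1, h2⟩ := ih (by omega)
      refine ⟨(hstep t (by omega) _ h2 h1).1, fun r hr => ?_, fun a ha => ?_⟩
      · have hr' := hr
        simp only [List.mem_cons, not_or] at hr
        simp only [iter]
        rw [run_reg _ _ _ hr.2]
        simp [hr.1, h2.reg r hr']
      · simp only [iter]
        rw [run_arr _ _ _ ha]
        simp [h2.arr a ha]
  simp only [cost]
  gcongr
  calc _ ≤ ∑ _t ∈ Finset.range (s.reg b), (T + 5) := by
        refine Finset.sum_le_sum fun t ht => ?_
        have ht := Finset.mem_range.1 ht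
        have := (hstep t ht _ (this t ht.le).2 (this t ht.le).1).2
        omega
    _ = _ := by simp

/-- No loop bound is ever assigned. -/
def Stable (c : Cmd ν α) : Prop := ∀ b ∈ c.bounds, b ∉ c.writes

instance (c : Cmd ν α) : Decidable c.Stable := inferInstanceAs (Decidable (∀ b ∈ c.bounds, _))

theorem cost_le_aux (W : List ν) (B : ℕ) (hB : 1 ≤ B) (c : Cmd ν α) :
    c.writes ⊆ W → (∀ b ∈ c.bounds, b ∉ W) →
    ∀ s : St ν α, (∀ b ∈ c.bounds, s.reg b ≤ B) → c.cost s ≤ c.size * B ^ c.depth := by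
  induction c with
  | skip => intros; simp [cost, size, depth]
  | set r e => intros; simp [cost, size, depth]
  | put a i e => intros; simp [cost, size, depth]
  | seq c d hc hd =>
    intro hW hb s hs
    simp only [writes, bounds, List.append_subset, List.mem_append, or_imp, forall_and] at hW hb hs
    have h1 := hc hW.1 hb.1 s hs.1
    have h2 := hd hW.2 hb.2 (c.run s) fun b h => by
      rw [run_reg _ _ _ fun h' => hb.2 b h (hW.1 h')]; exact hs.2 b h
    have h3 : B ^ c.depth ≤ B ^ max c.depth d.depth := Nat.pow_le_pow_right hB (le_max_left _ _)
    have h4 : B ^ d.depth ≤ B ^ max c.depth d.depth := Nat.pow_le_pow_right hB (le_max_right _ _)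
    simp only [cost, size, depth, add_mul]
    exact add_le_add (h1.trans (Nat.mul_le_mul_left _ h3)) (h2.trans (Nat.mul_le_mul_left _ h4))
  | ite e c d hc hd =>
    intro hW hb s hs
    simp only [writes, bounds, List.append_subset, List.mem_append, or_imp, forall_and] at hW hb hs
    have h1 := hc hW.1 hb.1 s hs.1
    have h2 := hd hW.2 hb.2 s hs.2
    have h3 : B ^ c.depth ≤ B ^ max c.depth d.depth := Nat.pow_le_pow_right hB (le_max_left _ _)
    have h4 : B ^ d.depth ≤ B ^ max c.depth d.depth := Nat.pow_le_pow_right hB (le_max_right _ _)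
    have h5 := h1.trans (Nat.mul_le_mul_left _ h3)
    have h6 := h2.trans (Nat.mul_le_mul_left _ h4)
    have h7 : 1 ≤ B ^ max c.depth d.depth := Nat.one_le_pow _ _ hB
    simp only [cost, size, depth, add_mul]
    have h8 := Nat.mul_le_mul_left e.cost h7
    split <;> omega
  | for_ i b c hc =>
    intro hW hb s hs
    simp only [writes, bounds, List.cons_subset, List.mem_cons, forall_eq_or_imp] at hW hb hs
    have := cost_for_le (i := i) (b := b) (c := c) (s := s) (fun _ _ => True)
      (c.size * B ^ c.depth) trivial fun t ht s' hs' _ => ⟨trivial, hc hW.2 hb.2 _ fun b' h => by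
        have h1 : b' ≠ i := fun h' => hb.2 b' h (h' ▸ hW.1)
        have h2 : b' ∉ i :: c.writes := fun h' => by
          rcases List.mem_cons.1 h' with h' | h'
          · exact h1 h'
          · exact hb.2 b' h (hW.2 h')
        simpa [h1, hs'.reg b' h2] using hs.2 b' h⟩
    refine this.trans ?_
    have h7 : 1 ≤ B ^ (c.depth + 1) := Nat.one_le_pow _ _ hB
    have h8 : B ≤ B ^ (c.depth + 1) := Nat.le_self_pow (by omega) _
    simp only [size, depth, add_mul]
    calc _ ≤ 3 + B * (c.size * B ^ c.depth + 5) := by gcongr; exact hs.1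
      _ = c.size * B ^ (c.depth + 1) + (3 * 1 + 5 * B) := by ring
      _ ≤ c.size * B ^ (c.depth + 1) + (3 * B ^ (c.depth + 1) + 5 * B ^ (c.depth + 1)) := by gcongr
      _ = _ := by ring

/-- A command with stable loop bounds takes time polynomial in them. -/
theorem cost_le {c : Cmd ν α} (hc : c.Stable) {s : St ν α} {B : ℕ} (hB : 1 ≤ B)
    (hs : ∀ b ∈ c.bounds, s.reg b ≤ B) : c.cost s ≤ c.size * B ^ c.depth :=
  cost_le_aux c.writes B hB c (fun _ h => h) hc s hs

end Cmd

/-! ### Compilation to the random access machine -/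

/-- Variables are kept in the even registers; the odd ones serve for intermediate results. -/
def Agree (ev : ν → ℕ) (ea : α → ℕ) (s : St ν α) (σ : RAMState) : Prop :=
  (∀ r, σ.reg (2 * ev r) = s.reg r) ∧ ∀ a, σ.arr (ea a) = s.arr a

/-- Code that leaves the value of an expression in the odd register `2 * d + 1` and changes no odd
register below it. -/
def Exp.compile (ev : ν → ℕ) (ea : α → ℕ) : Exp ν α → ℕ → RAMProg
  | lit c, d => .instr (.const (2 * d + 1) c)
  | var r, d => .instr (.copy (2 * d + 1) (2 * ev r))
  | add e f, d => .seq (e.compile ev ea d) (.seq (f.compile ev ea (d + 1))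
      (.instr (.add (2 * d + 1) (2 * d + 1) (2 * (d + 1) + 1))))
  | sub e f, d => .seq (e.compile ev ea d) (.seq (f.compile ev ea (d + 1))
      (.instr (.sub (2 * d + 1) (2 * d + 1) (2 * (d + 1) + 1))))
  | half e, d => .seq (e.compile ev ea d) (.instr (.half (2 * d + 1) (2 * d + 1)))
  | get a e, d => .seq (e.compile ev ea d) (.instr (.load (2 * d + 1) (ea a) (2 * d + 1)))

/-- Code for a command that changes no odd register below `2 * d + 1`. A loop keeps the number of
the remaining passes in register `2 * d + 1` and the number of those made in `2 * d + 3`. -/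
def Cmd.compile (ev : ν → ℕ) (ea : α → ℕ) : Cmd ν α → ℕ → RAMProg
  | skip, d => .instr (.copy (2 * d + 1) (2 * d + 1))
  | set r e, d => .seq (e.compile ev ea d) (.instr (.copy (2 * ev r) (2 * d + 1)))
  | put a i e, d => .seq (i.compile ev ea d) (.seq (e.compile ev ea (d + 1))
      (.instr (.store (ea a) (2 * d + 1) (2 * (d + 1) + 1))))
  | seq c c', d => .seq (c.compile ev ea d) (c'.compile ev ea d)
  | ite e c c', d => .seq (e.compile ev ea d)
      (.cond (2 * d + 1) (c.compile ev ea d) (c'.compile ev ea d))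
  | for_ i b c, d => .seq (.instr (.copy (2 * d + 1) (2 * ev b)))
      (.seq (.instr (.const (2 * (d + 1) + 1) 0))
        (.loop (2 * d + 1) (.seq (.instr (.copy (2 * ev i) (2 * (d + 1) + 1)))
          (.seq (c.compile ev ea (d + 2))
            (.seq (.instr (.const (2 * (d + 2) + 1) 1))
              (.seq (.instr (.add (2 * (d + 1) + 1) (2 * (d + 1) + 1) (2 * (d + 2) + 1)))
                (.instr (.sub (2 * d + 1) (2 * d + 1) (2 * (d + 2) + 1)))))))))

section Compile
variable {ev : ν → ℕ} {ea : α → ℕ}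

theorem Agree.update_odd {s : St ν α} {σ : RAMState} (h : Agree ev ea s σ) (d v : ℕ) :
    Agree ev ea s { σ with reg := Function.update σ.reg (2 * d + 1) v } :=
  ⟨fun r => by
    rw [← h.1 r]; exact Function.update_of_ne (by omega) _ _, h.2⟩

theorem Agree.set [DecidableEq ν] (hev : Function.Injective ev) {s : St ν α} {σ : RAMState}
    (h : Agree ev ea s σ) (r : ν) (v : ℕ) :
    Agree ev ea (s.set r v) { σ with reg := Function.update σ.reg (2 * ev r) v } := by
  refine ⟨fun q => ?_, h.2⟩
  rw [St.set_reg, ← h.1 q]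
  simp [Function.update_apply, hev.eq_iff]

theorem Agree.put [DecidableEq α] (hea : Function.Injective ea) {s : St ν α} {σ : RAMState}
    (h : Agree ev ea s σ) (a : α) (i v : ℕ) :
    Agree ev ea (s.put a i v) { σ with
      arr := Function.update σ.arr (ea a) (Function.update (σ.arr (ea a)) i v) } := by
  refine ⟨h.1, fun b => ?_⟩
  rw [St.put_arr, ← h.2 a, ← h.2 b]
  simp [Function.update_apply, hea.eq_iff]

theorem Exp.compile_exec (e : Exp ν α) : ∀ (d : ℕ) {s : St ν α} {σ : RAMState}, Agree ev ea s σ →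
    ∃ τ, RAMExec (e.compile ev ea d) σ e.cost τ ∧ Agree ev ea s τ ∧
      τ.reg (2 * d + 1) = e.eval s ∧ ∀ j < d, τ.reg (2 * j + 1) = σ.reg (2 * j + 1) := by
  induction e with
  | lit c =>
    intro d s σ h
    exact ⟨_, .instr _ _, h.update_odd d _, Function.update_self .., fun j hj =>
      Function.update_of_ne (by omega) _ _⟩
  | var r =>
    intro d s σ h
    exact ⟨_, .instr _ _, h.update_odd d _, (Function.update_self ..).trans (h.1 r), fun j hj =>
      Function.update_of_ne (by omega) _ _⟩
  | add e f he hf =>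
    intro d s σ h
    obtain ⟨τ, x1, h1, v1, k1⟩ := he d h
    obtain ⟨υ, x2, h2, v2, k2⟩ := hf (d + 1) h1
    refine ⟨_, .seq x1 (.seq x2 (.instr _ _)), h2.update_odd d _,
      (Function.update_self ..).trans ?_, fun j hj =>
        (Function.update_of_ne (by omega) _ _).trans ((k2 j (by omega)).trans (k1 j hj))⟩
    rw [k2 d (by omega), v1, v2]; rfl
  | sub e f he hf =>
    intro d s σ h
    obtain ⟨τ, x1, h1, v1, k1⟩ := he d h
    obtain ⟨υ, x2, h2, v2, k2⟩ := hf (d + 1) h1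
    refine ⟨_, .seq x1 (.seq x2 (.instr _ _)), h2.update_odd d _,
      (Function.update_self ..).trans ?_, fun j hj =>
        (Function.update_of_ne (by omega) _ _).trans ((k2 j (by omega)).trans (k1 j hj))⟩
    rw [k2 d (by omega), v1, v2]; rfl
  | half e he =>
    intro d s σ h
    obtain ⟨τ, x1, h1, v1, k1⟩ := he d h
    refine ⟨_, .seq x1 (.instr _ _), h1.update_odd d _,
      (Function.update_self ..).trans ?_, fun j hj =>
        (Function.update_of_ne (by omega) _ _).trans (k1 j hj)⟩
    rw [v1]; rfl
  | get a e he =>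
    intro d s σ h
    obtain ⟨τ, x1, h1, v1, k1⟩ := he d h
    refine ⟨_, .seq x1 (.instr _ _), h1.update_odd d _,
      (Function.update_self ..).trans ?_, fun j hj =>
        (Function.update_of_ne (by omega) _ _).trans (k1 j hj)⟩
    rw [v1, h1.2]; rfl

variable [DecidableEq ν] [DecidableEq α]

/-- The compiled code does what the command does, in as many steps as the cost model says. -/
theorem Cmd.compile_exec (hev : Function.Injective ev) (hea : Function.Injective ea)
    (c : Cmd ν α) : ∀ (d : ℕ) {s : St ν α} {σ : RAMState}, Agree ev ea s σ →
    ∃ τ, RAMExec (c.compile ev ea d) σ (c.cost s) τ ∧ Agree ev ea (c.run s) τ ∧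
      ∀ j < d, τ.reg (2 * j + 1) = σ.reg (2 * j + 1) := by
  induction c with
  | skip =>
    intro d s σ h
    exact ⟨_, .instr _ _, h.update_odd d _, fun j hj => Function.update_of_ne (by omega) _ _⟩
  | set r e =>
    intro d s σ h
    obtain ⟨τ, x1, h1, v1, k1⟩ := e.compile_exec d h
    refine ⟨_, .seq x1 (.instr _ _), ?_, fun j hj =>
      (Function.update_of_ne (by omega) _ _).trans (k1 j hj)⟩
    rw [run_set, ← v1]
    exact h1.set hev r _
  | put a i e =>
    intro d s σ h
    obtain ⟨τ, x1, h1, v1, k1⟩ := i.compile_exec d h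
    obtain ⟨υ, x2, h2, v2, k2⟩ := e.compile_exec (d + 1) h1
    refine ⟨_, .seq x1 (.seq x2 (.instr _ _)), ?_, fun j hj =>
      (k2 j (by omega)).trans (k1 j hj)⟩
    rw [run_put, ← v1, ← v2, ← k2 d (by omega)]
    exact h2.put hea a _ _
  | seq c c' hc hc' =>
    intro d s σ h
    obtain ⟨τ, x1, h1, k1⟩ := hc d h
    obtain ⟨υ, x2, h2, k2⟩ := hc' d h1
    exact ⟨υ, .seq x1 x2, h2, fun j hj => (k2 j hj).trans (k1 j hj)⟩
  | ite e c c' hc hc' =>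
    intro d s σ h
    obtain ⟨τ, x1, h1, v1, k1⟩ := e.compile_exec d h
    by_cases h0 : e.eval s ≠ 0
    · obtain ⟨υ, x2, h2, k2⟩ := hc d h1
      refine ⟨υ, ?_, ?_, fun j hj => (k2 j hj).trans (k1 j hj)⟩
      · simp only [cost, if_pos h0]
        exact .seq x1 (.cond_pos (v1 ▸ h0) x2)
      · simpa only [run_ite, if_pos h0] using h2
    · obtain ⟨υ, x2, h2, k2⟩ := hc' d h1
      refine ⟨υ, ?_, ?_, fun j hj => (k2 j hj).trans (k1 j hj)⟩
      · simp only [cost, if_neg h0]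
        exact .seq x1 (.cond_zero (v1.trans (not_not.1 h0)) x2)
      · simpa only [run_ite, if_neg h0] using h2
  | for_ i b c hc =>
    intro d s σ h
    have h1 := (h.update_odd d (σ.reg (2 * ev b))).update_odd (d + 1) 0
    set N := s.reg b with hN
    set F : ℕ → St ν α → St ν α := fun t s' => c.run (s'.set i t) with hF
    -- the passes from the `t`-th on, by induction on their number
    have key : ∀ m t, t + m = N → ∀ σ', Agree ev ea (iter F t s) σ' → σ'.reg (2 * d + 1) = m →
        σ'.reg (2 * (d + 1) + 1) = t → (∀ j < d, σ'.reg (2 * j + 1) = σ.reg (2 * j + 1)) →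
        ∃ τ, RAMExec (.loop (2 * d + 1) (.seq (.instr (.copy (2 * ev i) (2 * (d + 1) + 1)))
          (.seq (c.compile ev ea (d + 2))
            (.seq (.instr (.const (2 * (d + 2) + 1) 1))
              (.seq (.instr (.add (2 * (d + 1) + 1) (2 * (d + 1) + 1) (2 * (d + 2) + 1)))
                (.instr (.sub (2 * d + 1) (2 * d + 1) (2 * (d + 2) + 1)))))))) σ'
          (1 + ∑ k ∈ Finset.Ico t N, (c.cost ((iter F k s).set i k) + 5)) τ ∧
          Agree ev ea (iter F N s) τ ∧ ∀ j < d, τ.reg (2 * j + 1) = σ.reg (2 * j + 1) := by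
      intro m
      induction m with
      | zero =>
        intro t ht σ' ha hm _ hk
        have : t = N := by omega
        subst this
        exact ⟨σ', by simpa using RAMExec.loop_zero hm, ha, hk⟩
      | succ m ih =>
        intro t ht σ' ha hm htt hk
        have a1 : Agree ev ea ((iter F t s).set i t)
            { σ' with reg := Function.update σ'.reg (2 * ev i) (σ'.reg (2 * (d + 1) + 1)) } := by
          rw [htt]; exact ha.set hev i t
        obtain ⟨τ, x1, a2, k2⟩ := hc (d + 2) a1
        have r0 : τ.reg (2 * d + 1) = m + 1 := by
          rw [k2 d (by omega), ← hm]; exact Function.update_of_ne (by omega) _ _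
        have r1 : τ.reg (2 * (d + 1) + 1) = t := by
          rw [k2 (d + 1) (by omega), ← htt]; exact Function.update_of_ne (by omega) _ _
        obtain ⟨υ, x2, a3, k3⟩ := ih (t + 1) (by omega) _
          (((a2.update_odd (d + 2) 1).update_odd (d + 1) (t + 1)).update_odd d m)
          (Function.update_self ..)
          ((Function.update_of_ne (by omega) _ _).trans (Function.update_self ..))
          fun j hj => by
            rw [← hk j hj]
            refine (Function.update_of_ne (by omega) _ _).trans
              ((Function.update_of_ne (by omega) _ _).trans
              ((Function.update_of_ne (by omega) _ _).trans ((k2 j (by omega)).trans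
              (Function.update_of_ne (by omega) _ _))))
        refine ⟨υ, ?_, a3, k3⟩
        have hbody := RAMExec.seq (.instr (.copy (2 * ev i) (2 * (d + 1) + 1)) σ') (.seq x1
          (.seq (.instr (.const (2 * (d + 2) + 1) 1) τ)
            (.seq (.instr (.add (2 * (d + 1) + 1) (2 * (d + 1) + 1) (2 * (d + 2) + 1)) _)
              (.instr (.sub (2 * d + 1) (2 * d + 1) (2 * (d + 2) + 1)) _))))
        have hend : RAMInstr.apply (RAMInstr.apply (RAMInstr.apply τ
            (.const (2 * (d + 2) + 1) 1)) (.add (2 * (d + 1) + 1) (2 * (d + 1) + 1)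
            (2 * (d + 2) + 1))) (.sub (2 * d + 1) (2 * d + 1) (2 * (d + 2) + 1)) =
            { τ with reg := Function.update (Function.update (Function.update τ.reg
              (2 * (d + 2) + 1) 1) (2 * (d + 1) + 1) (t + 1)) (2 * d + 1) m } := by
          simp [RAMInstr.apply, r0, r1]
        rw [hend] at hbody
        have := RAMExec.loop_pos (by omega) hbody x2
        convert this using 1
        rw [Finset.sum_eq_sum_Ico_succ_bot (by omega)]
        ring
    obtain ⟨τ, x, a, k⟩ := key N 0 (by omega) _ h1
      (by
        refine (Function.update_of_ne (by omega) _ _).trans ((Function.update_self ..).trans ?_)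
        exact h.1 b)
      (Function.update_self ..) fun j hj =>
        (Function.update_of_ne (by omega) _ _).trans (Function.update_of_ne (by omega) _ _)
    refine ⟨τ, ?_, a, k⟩
    have := RAMExec.seq (.instr (.copy (2 * d + 1) (2 * ev b)) σ)
      (.seq (.instr (.const (2 * (d + 1) + 1) 0) _) x)
    have hcost : (for_ i b c).cost s =
        1 + (1 + (1 + ∑ k ∈ Finset.Ico 0 N, (c.cost ((iter F k s).set i k) + 5))) := by
      simp only [cost, ← Finset.range_eq_Ico]
      ring
    rw [hcost]
    exact this

end Compile

end Imp

/-! ### Sets of vertices that may be kept -/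

/-- The set `T` can be kept: no component of the graph induced by `T` weighs more than `l`. Instead
of components, the definition speaks of colourings of `T` in which adjacent vertices have the same
colour. -/
def Feasible {V : Type*} (G : SimpleGraph V) (w : V → ℕ) (l : ℕ) (T : Finset V) : Prop :=
  ∃ c : V → ℕ, (∀ x ∈ T, ∀ y ∈ T, G.Adj x y → c x = c y) ∧
    ∀ C ⊆ T, (∀ x ∈ C, ∀ y ∈ C, c x = c y) → ∑ x ∈ C, w x ≤ l

/-- `v` is the largest weight of a subset of `U` that can be kept. -/
def IsOpt (G : SimpleGraph ℕ) (w : ℕ → ℕ) (l : ℕ) (U : Finset ℕ) (v : ℕ) : Prop :=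
  (∃ T ⊆ U, Feasible G w l T ∧ ∑ x ∈ T, w x = v) ∧
    ∀ T ⊆ U, Feasible G w l T → ∑ x ∈ T, w x ≤ v

/-- `v` is the largest weight, not exceeding `l`, of a subset of `U`. -/
def IsKnap (w : ℕ → ℕ) (l : ℕ) (U : Finset ℕ) (v : ℕ) : Prop :=
  (∃ T ⊆ U, ∑ x ∈ T, w x = v ∧ v ≤ l) ∧ ∀ T ⊆ U, ∑ x ∈ T, w x ≤ l → ∑ x ∈ T, w x ≤ v

theorem isOpt_singleton (G : SimpleGraph ℕ) (w : ℕ → ℕ) (l v : ℕ) :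
    IsOpt G w l {v} (if w v ≤ l then w v else 0) := by
  constructor
  · by_cases h : w v ≤ l
    · refine ⟨{v}, subset_rfl, ⟨fun _ => 0, fun _ _ _ _ _ => rfl, fun C hC _ => ?_⟩, by simp [h]⟩
      exact (Finset.sum_le_sum_of_subset hC).trans (by simpa using h)
    · exact ⟨∅, by simp, ⟨fun _ => 0, by simp, fun C hC _ => by simp [Finset.subset_empty.1 hC]⟩,
        by simp [h]⟩
  · rintro T hT ⟨c, -, hc⟩
    rcases Finset.subset_singleton_iff.1 hT with rfl | rfl
    · simp
    · have : w v ≤ l := by simpa using hc {v} subset_rfl (by simp)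
      simp [this]

/-! ### Modules and contractions -/

/-- `X` is a module of the subgraph of `G` induced by `A`. -/
def IsModule {V : Type*} (G : SimpleGraph V) (A X : Finset V) : Prop :=
  X ⊆ A ∧ ∀ a ∈ A, a ∉ X → ∀ y ∈ X, ∀ z ∈ X, G.Adj a y → G.Adj a z

/-- The vertices represented by an element of `X`. -/
def cls (n : ℕ) (rep : ℕ → ℕ) (X : Finset ℕ) : Finset ℕ := (Finset.range n).filter (rep · ∈ X)

/-- The vertices that represent their class. -/
def alive (n : ℕ) (rep : ℕ → ℕ) : Finset ℕ := (Finset.range n).filter fun v => rep v = v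

theorem mem_cls {n : ℕ} {rep : ℕ → ℕ} {X : Finset ℕ} {x : ℕ} :
    x ∈ cls n rep X ↔ x < n ∧ rep x ∈ X := by simp [cls]

theorem mem_alive {n : ℕ} {rep : ℕ → ℕ} {x : ℕ} : x ∈ alive n rep ↔ x < n ∧ rep x = x := by
  simp [alive]

/-- A partition of the vertices `0, …, n - 1` into modules, given by the representatives `rep`, and
for each of the modules the largest weight that can be kept in it. -/
structure Contraction (G : SimpleGraph ℕ) (w : ℕ → ℕ) (l n : ℕ) (rep g : ℕ → ℕ) : Prop where
  rep_lt : ∀ x < n, rep x < n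
  idem : ∀ x < n, rep (rep x) = rep x
  adj : ∀ x < n, ∀ y < n, rep x ≠ rep y → (G.Adj x y ↔ G.Adj (rep x) (rep y))
  opt : ∀ v ∈ alive n rep, IsOpt G w l (cls n rep {v}) (g v)

/-- A labelling of the vertices of a module of representatives: with label `0` the class is deleted,
with label `1` it is kept apart from all others, and the classes with label `j + 2` are kept in one
pool, whose total weight matters only. Adjacent classes that are not deleted have to be in the same
pool. -/
def ValidLabels (G : SimpleGraph ℕ) (X : Finset ℕ) (D : ℕ → ℕ) : Prop :=
  ∀ u ∈ X, ∀ v ∈ X, G.Adj u v → D u ≠ 0 → D v ≠ 0 → D u = D v ∧ D u ≠ 1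

/-- The vertices in the pool with label `d`. -/
def pool (n : ℕ) (rep : ℕ → ℕ) (X : Finset ℕ) (D : ℕ → ℕ) (d : ℕ) : Finset ℕ :=
  cls n rep (X.filter fun v => D v = d)

theorem mem_pool {n : ℕ} {rep : ℕ → ℕ} {X : Finset ℕ} {D : ℕ → ℕ} {d x : ℕ} :
    x ∈ pool n rep X D d ↔ x < n ∧ rep x ∈ X ∧ D (rep x) = d := by simp [pool, mem_cls]

section Recurrence
variable {G : SimpleGraph ℕ} {w : ℕ → ℕ} {l n : ℕ} {rep g : ℕ → ℕ} {X : Finset ℕ}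

/-- What a valid labelling promises can be kept. -/
theorem Contraction.exists_feasible (H : Contraction G w l n rep g) (hX : X ⊆ alive n rep)
    {D : ℕ → ℕ} (hD : ValidLabels G X D) (m : ℕ) {kn : ℕ → ℕ}
    (hkn : ∀ j < m, IsKnap w l (pool n rep X D (j + 2)) (kn j)) :
    ∃ T ⊆ cls n rep X, Feasible G w l T ∧
      ∑ x ∈ T, w x = ∑ v ∈ X with D v = 1, g v + ∑ j ∈ Finset.range m, kn j := by
  have h1 : ∀ v, ∃ (T : Finset ℕ) (c : ℕ → ℕ), v ∈ X → T ⊆ cls n rep {v} ∧ ((∀ x ∈ T, ∀ y ∈ T, G.Adj x y → c x = c y) ∧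
      ∀ C ⊆ T, (∀ x ∈ C, ∀ y ∈ C, c x = c y) → ∑ x ∈ C, w x ≤ l) ∧ ∑ x ∈ T, w x = g v := by
    intro v
    by_cases hv : v ∈ X
    · obtain ⟨T, hT, ⟨c, hc⟩, hw⟩ := (H.opt v (hX hv)).1
      exact ⟨T, c, fun _ => ⟨hT, hc, hw⟩⟩
    · exact ⟨∅, id, fun h => absurd h hv⟩
  choose T c hTc using h1
  have h2 : ∀ j, ∃ S, j < m → S ⊆ pool n rep X D (j + 2) ∧ ∑ x ∈ S, w x = kn j ∧ kn j ≤ l := by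
    intro j
    by_cases hj : j < m
    · obtain ⟨S, hS, hw, hl⟩ := (hkn j hj).1
      exact ⟨S, fun _ => ⟨hS, hw, hl⟩⟩
    · exact ⟨∅, fun h => absurd h hj⟩
  choose S hS using h2
  set A := (X.filter fun v => D v = 1).biUnion T with hA
  set B := (Finset.range m).biUnion S with hB
  have mA : ∀ x, x ∈ A → x < n ∧ rep x ∈ X ∧ D (rep x) = 1 ∧ x ∈ T (rep x) := by
    intro x hx
    simp only [hA, Finset.mem_biUnion, Finset.mem_filter] at hx
    obtain ⟨v, ⟨hv, hd⟩, hx⟩ := hx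
    have := mem_cls.1 ((hTc v hv).1 hx)
    simp only [Finset.mem_singleton] at this
    obtain ⟨h, rfl⟩ := this
    exact ⟨h, hv, hd, hx⟩
  have mB : ∀ x, x ∈ B → ∃ j < m, x < n ∧ rep x ∈ X ∧ D (rep x) = j + 2 ∧ x ∈ S j := by
    intro x hx
    simp only [hB, Finset.mem_biUnion, Finset.mem_range] at hx
    obtain ⟨j, hj, hx⟩ := hx
    have := mem_pool.1 ((hS j hj).1 hx)
    exact ⟨j, hj, this.1, this.2.1, this.2.2, hx⟩
  have mAB : ∀ x ∈ A ∪ B, x < n ∧ rep x ∈ X ∧ D (rep x) ≠ 0 ∧ (D (rep x) = 1 → x ∈ T (rep x)) ∧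
      (D (rep x) ≠ 1 → ∃ j < m, D (rep x) = j + 2 ∧ x ∈ S j) := by
    intro x hx
    rcases Finset.mem_union.1 hx with hx | hx
    · obtain ⟨h1, h2, h3, h4⟩ := mA x hx
      exact ⟨h1, h2, by omega, fun _ => h4, fun h => absurd h3 h⟩
    · obtain ⟨j, hj, h1, h2, h3, h4⟩ := mB x hx
      exact ⟨h1, h2, by omega, fun h => by omega, fun _ => ⟨j, hj, h3, h4⟩⟩
  refine ⟨A ∪ B, fun x hx => mem_cls.2 ⟨(mAB x hx).1, (mAB x hx).2.1⟩, ⟨fun x =>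
    -- a class that is kept apart retains its colours, a pool gets one colour of its own
    if D (rep x) = 1 then Nat.pair (2 * rep x) (c (rep x) x) else Nat.pair (2 * D (rep x) + 1) 0,
    fun x hx y hy hxy => ?_, fun C hC hmono => ?_⟩, ?_⟩
  · obtain ⟨x1, x2, x3, x4, -⟩ := mAB x hx
    obtain ⟨y1, y2, y3, y4, -⟩ := mAB y hy
    dsimp only
    by_cases hr : rep x = rep y
    · rw [hr]
      split
      · next h1 =>
        rw [hr] at x4
        rw [(hTc _ y2).2.1.1 x (x4 h1) y (y4 h1) hxy]
      · rfl
    · have := hD _ x2 _ y2 ((H.adj x x1 y y1 hr).1 hxy) x3 y3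
      rw [if_neg this.2, if_neg (this.1 ▸ this.2), this.1]
  · rcases C.eq_empty_or_nonempty with rfl | ⟨x, hx⟩
    · simp
    obtain ⟨x1, x2, x3, x4, x5⟩ := mAB x (hC hx)
    by_cases h1 : D (rep x) = 1
    · have key : ∀ y ∈ C, rep y = rep x ∧ c (rep x) y = c (rep x) x := by
        intro y hy
        have := hmono y hy x hx
        dsimp only at this
        rw [if_pos h1] at this
        split at this
        · rw [Nat.pair_eq_pair] at this
          have hr : rep y = rep x := by omega
          exact ⟨hr, hr ▸ this.2⟩
        · rw [Nat.pair_eq_pair] at this; omega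
      refine (hTc _ x2).2.1.2 C (fun y hy => ?_) fun y hy z hz => ?_
      · have := (mAB y (hC hy)).2.2.2.1
        rw [(key y hy).1] at this
        exact this h1
      · rw [(key y hy).2, (key z hz).2]
    · obtain ⟨j, hj, hd, -⟩ := x5 h1
      have hsub : C ⊆ S j := by
        intro y hy
        have := hmono y hy x hx
        dsimp only at this
        rw [if_neg h1] at this
        split at this
        · rw [Nat.pair_eq_pair] at this; omega
        · next h2 =>
          rw [Nat.pair_eq_pair] at this
          obtain ⟨i, -, hi, h⟩ := (mAB y (hC hy)).2.2.2.2 h2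
          have : i = j := by omega
          exact this ▸ h
      obtain ⟨-, h2, h3⟩ := hS j hj
      exact (Finset.sum_le_sum_of_subset hsub).trans (h2.trans_le h3)
  · rw [Finset.sum_union, hA, hB, Finset.sum_biUnion, Finset.sum_biUnion]
    · congr 1
      · exact Finset.sum_congr rfl fun v hv => (hTc v (Finset.mem_filter.1 hv).1).2.2
      · exact Finset.sum_congr rfl fun j hj => (hS j (Finset.mem_range.1 hj)).2.1
    · intro i hi j hj hij
      refine Finset.disjoint_left.2 fun x hx hx' => hij ?_
      have h1 := (mem_pool.1 ((hS i (Finset.mem_range.1 hi)).1 hx)).2.2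
      have h2 := (mem_pool.1 ((hS j (Finset.mem_range.1 hj)).1 hx')).2.2
      omega
    · intro u hu v hv huv
      refine Finset.disjoint_left.2 fun x hx hx' => huv ?_
      have h1 := mem_cls.1 ((hTc u (Finset.mem_filter.1 hu).1).1 hx)
      have h2 := mem_cls.1 ((hTc v (Finset.mem_filter.1 hv).1).1 hx')
      simp only [Finset.mem_singleton] at h1 h2
      rw [← h1.2, h2.2]
    · refine Finset.disjoint_left.2 fun x hx hx' => ?_
      obtain ⟨j, -, -, -, h, -⟩ := mB x hx'
      have := (mA x hx).2.2.1
      omega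

/-- Whatever can be kept in the union of the classes of `X` is promised by a valid labelling with
labels below `|X| + 2`. If no neighbour of a class keeps a vertex, then the class is kept apart from
the others. Otherwise all vertices kept in it are adjacent to a common vertex, so they have the same
colour, which determines the pool. -/
theorem Contraction.exists_labels (H : Contraction G w l n rep g) (hX : X ⊆ alive n rep)
    {T : Finset ℕ} (hT : T ⊆ cls n rep X) (hf : Feasible G w l T) :
    ∃ D : ℕ → ℕ, (∀ v, D v < X.card + 2) ∧ ValidLabels G X D ∧ ∀ kn : ℕ → ℕ,
      (∀ j < X.card, IsKnap w l (pool n rep X D (j + 2)) (kn j)) →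
      ∑ x ∈ T, w x ≤ ∑ v ∈ X with D v = 1, g v + ∑ j ∈ Finset.range X.card, kn j := by
  classical
  obtain ⟨c, hc, hl⟩ := hf
  -- a vertex kept in a given class, if there is one
  have h1 : ∀ v, ∃ x, (∃ y ∈ T, rep y = v) → x ∈ T ∧ rep x = v := by
    intro v
    by_cases h : ∃ y ∈ T, rep y = v
    · obtain ⟨y, hy⟩ := h; exact ⟨y, fun _ => hy⟩
    · exact ⟨0, fun h' => absurd h' h⟩
  choose p hp using h1
  set I := X.image fun v => c (p v) with hI
  have hIc : I.card ≤ X.card := Finset.card_image_le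
  obtain ⟨idx, hidx, hinj⟩ : ∃ idx : ℕ → ℕ, (∀ i ∈ I, idx i < X.card) ∧
      ∀ i ∈ I, ∀ j ∈ I, idx i = idx j → i = j := by
    refine ⟨fun i => if h : i ∈ I then I.equivFin ⟨i, h⟩ else 0, fun i hi => ?_,
      fun i hi j hj hij => ?_⟩
    · simp only [hi, dif_pos]; exact (Fin.is_lt _).trans_le hIc
    · simp only [hi, hj, dif_pos] at hij
      simpa using I.equivFin.injective (Fin.ext hij)
  set D : ℕ → ℕ := fun v => if v ∈ X ∧ ∃ y ∈ T, rep y = v then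
    if ∃ u ∈ X, G.Adj v u ∧ ∃ y ∈ T, rep y = u then idx (c (p v)) + 2 else 1 else 0 with hDdef
  have hTn : ∀ x ∈ T, x < n ∧ rep x ∈ X := fun x hx => mem_cls.1 (hT hx)
  have hadj : ∀ x ∈ T, ∀ y ∈ T, G.Adj (rep x) (rep y) → c x = c y := fun x hx y hy h =>
    hc x hx y hy ((H.adj x (hTn x hx).1 y (hTn y hy).1 h.ne).2 h)
  -- a class in a pool is monochromatic
  have hcol : ∀ x ∈ T, 2 ≤ D (rep x) → c x = c (p (rep x)) ∧ D (rep x) = idx (c x) + 2 := by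
    intro x hx h
    have hx' : rep x ∈ X ∧ ∃ y ∈ T, rep y = rep x := ⟨(hTn x hx).2, x, hx, rfl⟩
    simp only [hDdef, if_pos hx'] at h ⊢
    split at h
    · next h2 =>
      obtain ⟨u, hu, ha, y, hy, rfl⟩ := h2
      obtain ⟨q1, q2⟩ := hp (rep x) hx'.2
      have : c x = c (p (rep x)) := by
        rw [hadj x hx y hy ha, hadj _ q1 y hy (by rw [q2]; exact ha)]
      exact ⟨this, by rw [if_pos ⟨_, hu, ha, y, hy, rfl⟩, ← this]⟩
    · omega
  have hbound : ∀ v, D v < X.card + 2 := by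
    intro v
    simp only [hDdef]
    split
    · next h =>
      split
      · have := hidx (c (p v)) (Finset.mem_image_of_mem _ h.1); omega
      · omega
    · omega
  refine ⟨D, hbound, fun u hu v hv huv hu0 hv0 => ?_, fun kn hkn => ?_⟩
  · have e1 : ∃ y ∈ T, rep y = u := by
      by_contra h; exact hu0 (by simp [hDdef, h])
    have e2 : ∃ y ∈ T, rep y = v := by
      by_contra h; exact hv0 (by simp [hDdef, h])
    have d1 : D u = idx (c (p u)) + 2 := by
      simp only [hDdef]; rw [if_pos ⟨hu, e1⟩, if_pos ⟨v, hv, huv, e2⟩]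
    have d2 : D v = idx (c (p v)) + 2 := by
      simp only [hDdef]; rw [if_pos ⟨hv, e2⟩, if_pos ⟨u, hu, huv.symm, e1⟩]
    have : c (p u) = c (p v) := by
      refine hadj _ (hp u e1).1 _ (hp v e2).1 ?_
      rwa [(hp u e1).2, (hp v e2).2]
    rw [d1, d2, this]
    exact ⟨rfl, by omega⟩
  · have h2 : ∑ x ∈ T, w x = ∑ d ∈ Finset.range (X.card + 2), ∑ x ∈ T with D (rep x) = d, w x :=
      (Finset.sum_fiberwise_of_maps_to (fun x _ => Finset.mem_range.2 (hbound (rep x))) w).symm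
    rw [h2, Finset.sum_range_succ', Finset.sum_range_succ']
    have h0 : ∑ x ∈ T with D (rep x) = 0, w x = 0 := by
      refine Finset.sum_eq_zero fun x hx => ?_
      obtain ⟨hx, h⟩ := Finset.mem_filter.1 hx
      have hx' : rep x ∈ X ∧ ∃ y ∈ T, rep y = rep x := ⟨(hTn x hx).2, x, hx, rfl⟩
      simp only [hDdef, if_pos hx'] at h
      split at h <;> omega
    have h3 : ∑ x ∈ T with D (rep x) = 0 + 1, w x ≤ ∑ v ∈ X with D v = 1, g v := by
      rw [← Finset.sum_fiberwise_of_maps_to (t := X.filter fun v => D v = 1) (g := rep)]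
      · refine Finset.sum_le_sum fun v hv => ?_
        obtain ⟨hv, hv1⟩ := Finset.mem_filter.1 hv
        refine (H.opt v (hX hv)).2 _ (fun x hx => ?_) ⟨c, fun x hx y hy => hc x ?_ y ?_,
          fun C hC => hl C fun x hx => ?_⟩
        · simp only [Finset.mem_filter] at hx
          exact mem_cls.2 ⟨(hTn x hx.1.1).1, by simp [hx.2]⟩
        · exact (Finset.mem_filter.1 (Finset.mem_filter.1 hx).1).1
        · exact (Finset.mem_filter.1 (Finset.mem_filter.1 hy).1).1
        · exact (Finset.mem_filter.1 (Finset.mem_filter.1 (hC hx)).1).1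
      · intro x hx
        obtain ⟨hx, h⟩ := Finset.mem_filter.1 hx
        exact Finset.mem_filter.2 ⟨(hTn x hx).2, h⟩
    have h4 : ∑ j ∈ Finset.range X.card, ∑ x ∈ T with D (rep x) = j + 1 + 1, w x ≤
        ∑ j ∈ Finset.range X.card, kn j := by
      refine Finset.sum_le_sum fun j hj => ?_
      refine (hkn j (Finset.mem_range.1 hj)).2 _ (fun x hx => ?_) (hl _ (Finset.filter_subset _ _)
        fun x hx y hy => ?_)
      · obtain ⟨hx, h⟩ := Finset.mem_filter.1 hx
        exact mem_pool.2 ⟨(hTn x hx).1, (hTn x hx).2, h⟩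
      · obtain ⟨hx, h⟩ := Finset.mem_filter.1 hx
        obtain ⟨hy, h'⟩ := Finset.mem_filter.1 hy
        have e1 := hcol x hx (by omega)
        have e2 := hcol y hy (by omega)
        refine hinj _ ?_ _ ?_ (by omega)
        · rw [e1.1]; exact Finset.mem_image_of_mem (fun v => c (p v)) (hTn x hx).2
        · rw [e2.1]; exact Finset.mem_image_of_mem (fun v => c (p v)) (hTn y hy).2
    omega

theorem Contraction.init (G : SimpleGraph ℕ) (w : ℕ → ℕ) (l n : ℕ) (hrep : ∀ v < n, rep v = v)
    (hg : ∀ v < n, g v = if w v ≤ l then w v else 0) : Contraction G w l n rep g where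
  rep_lt x hx := by rwa [hrep x hx]
  idem x hx := by rw [hrep x hx, hrep x hx]
  adj x hx y hy _ := by rw [hrep x hx, hrep y hy]
  opt v hv := by
    have hv := (mem_alive.1 hv).1
    have : cls n rep {v} = {v} := by
      ext x
      rw [mem_cls, Finset.mem_singleton, Finset.mem_singleton]
      constructor
      · rintro ⟨h, h'⟩; rwa [hrep x h] at h'
      · rintro rfl; exact ⟨hv, hrep x hv⟩
    rw [this, hg v hv]
    exact isOpt_singleton G w l v

/-- Contracting a module of representatives to one of its vertices. -/
theorem Contraction.merge (H : Contraction G w l n rep g) (hX : IsModule G (alive n rep) X)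
    {u : ℕ} (hu : u ∈ X) {opt : ℕ} (hopt : IsOpt G w l (cls n rep X) opt) {rep' g' : ℕ → ℕ}
    (hrep' : ∀ x < n, rep' x = if rep x ∈ X then u else rep x)
    (hg' : ∀ x < n, g' x = if x = u then opt else g x) :
    Contraction G w l n rep' g' ∧ (alive n rep').card + X.card = (alive n rep).card + 1 := by
  obtain ⟨hXA, hmod⟩ := hX
  have hal : ∀ x ∈ X, x < n ∧ rep x = x := fun x hx => mem_alive.1 (hXA hx)
  obtain ⟨hun, hru⟩ := hal u hu
  have hlive : ∀ x, x ∈ alive n rep' ↔ x ∈ alive n rep ∧ (x ∉ X ∨ x = u) := by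
    intro x
    rw [mem_alive, mem_alive]
    constructor
    · rintro ⟨h1, h2⟩
      rw [hrep' x h1] at h2
      split at h2
      · subst h2; exact ⟨⟨h1, hru⟩, Or.inr rfl⟩
      · next h3 => rw [h2] at h3; exact ⟨⟨h1, h2⟩, Or.inl h3⟩
    · rintro ⟨⟨h1, h2⟩, h3⟩
      refine ⟨h1, ?_⟩
      rw [hrep' x h1, h2]
      split
      · next h4 => exact (h3.resolve_left (not_not.2 h4)).symm
      · rfl
  refine ⟨⟨fun x hx => ?_, fun x hx => ?_, fun x hx y hy hxy => ?_, fun v hv => ?_⟩, ?_⟩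
  · rw [hrep' x hx]; split
    · exact hun
    · exact H.rep_lt x hx
  · rw [hrep' x hx]; split
    · rw [hrep' u hun, hru, if_pos hu]
    · next h => rw [hrep' _ (H.rep_lt x hx), H.idem x hx, if_neg h]
  · have hne : rep x ≠ rep y := by
      intro h; rw [hrep' x hx, hrep' y hy, h] at hxy; exact hxy rfl
    rw [H.adj x hx y hy hne]
    rw [hrep' x hx, hrep' y hy] at hxy ⊢
    have ax : rep x ∈ alive n rep := mem_alive.2 ⟨H.rep_lt x hx, H.idem x hx⟩
    have ay : rep y ∈ alive n rep := mem_alive.2 ⟨H.rep_lt y hy, H.idem y hy⟩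
    by_cases h1 : rep x ∈ X <;> by_cases h2 : rep y ∈ X <;>
      simp only [h1, h2, if_true, if_false] at hxy ⊢
    · exact absurd rfl hxy
    · rw [G.adj_comm, G.adj_comm u]
      exact ⟨hmod _ ay h2 _ h1 _ hu, hmod _ ay h2 _ hu _ h1⟩
    · exact ⟨hmod _ ax h1 _ h2 _ hu, hmod _ ax h1 _ hu _ h2⟩
  · obtain ⟨h1, h2⟩ := (hlive v).1 hv
    have hvn := (mem_alive.1 h1).1
    rw [hg' v hvn]
    by_cases hvu : v = u
    · subst hvu
      rw [if_pos rfl]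
      convert hopt using 1
      ext x
      simp only [mem_cls, Finset.mem_singleton]
      refine and_congr_right fun hx => ?_
      rw [hrep' x hx]
      split
      · next h => simp [h]
      · next h => exact ⟨fun h' => absurd (h' ▸ hu) h, fun h' => absurd h' h⟩
    · rw [if_neg hvu]
      convert H.opt v h1 using 1
      ext x
      simp only [mem_cls, Finset.mem_singleton]
      refine and_congr_right fun hx => ?_
      rw [hrep' x hx]
      have hvX : v ∉ X := h2.resolve_right hvu
      split
      · next h => exact ⟨fun h' => absurd h'.symm hvu, fun h' => absurd (h' ▸ h) hvX⟩
      · rfl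
  · have : alive n rep = alive n rep' ∪ X.erase u := by
      ext x
      rw [Finset.mem_union, hlive, Finset.mem_erase]
      by_cases h : x ∈ X
      · have := hXA h; tauto
      · have : x ≠ u := fun h' => h (h' ▸ hu)
        tauto
    rw [this, Finset.card_union_of_disjoint, Finset.card_erase_of_mem hu]
    · have := Finset.card_pos.2 ⟨u, hu⟩; omega
    · refine Finset.disjoint_left.2 fun x hx hx' => ?_
      rw [hlive] at hx
      rw [Finset.mem_erase] at hx'
      tauto

end Recurrence

/-! ### Small modules from modular-width -/

theorem IsModule.map {V V' : Type*} {G : SimpleGraph V} {G' : SimpleGraph V'} (φ : G ↪g G')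
    {A X : Finset V} (h : IsModule G A X) :
    IsModule G' (A.map φ.toEmbedding) (X.map φ.toEmbedding) := by
  refine ⟨Finset.map_subset_map.2 h.1, ?_⟩
  intro a ha haX y hy z hz hadj
  obtain ⟨a, ha', rfl⟩ := Finset.mem_map.1 ha
  obtain ⟨y, hy', rfl⟩ := Finset.mem_map.1 hy
  obtain ⟨z, hz', rfl⟩ := Finset.mem_map.1 hz
  have haX : a ∉ X := fun h' => haX (Finset.mem_map_of_mem _ h')
  exact φ.map_adj_iff.2 (h.2 a ha' haX y hy' z hz' (φ.map_adj_iff.1 hadj))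

theorem substitution_adj_mk_same {ι : Type*} {V : ι → Type*} {H : SimpleGraph ι}
    {F : ∀ i, SimpleGraph (V i)} {i : ι} {u v : V i} :
    (substitution H F).Adj ⟨i, u⟩ ⟨i, v⟩ ↔ (F i).Adj u v := by
  constructor
  · rintro (h | ⟨j, u', v', h, h1, h2⟩)
    · exact absurd h (H.irrefl)
    · obtain ⟨rfl, h1⟩ := Sigma.mk.inj_iff.1 h1
      obtain ⟨-, h2⟩ := Sigma.mk.inj_iff.1 h2
      rw [eq_of_heq h1, eq_of_heq h2]; exact h
  · exact fun h => Or.inr ⟨i, u, v, h, rfl, rfl⟩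

theorem substitution_adj_of_ne {ι : Type*} {V : ι → Type*} {H : SimpleGraph ι}
    {F : ∀ i, SimpleGraph (V i)} {x y : Σ i, V i} (hne : x.1 ≠ y.1) :
    (substitution H F).Adj x y ↔ H.Adj x.1 y.1 := by
  constructor
  · rintro (h | ⟨j, u', v', h, rfl, rfl⟩)
    · exact h
    · exact absurd rfl hne
  · exact Or.inl

/-- If two vertices of `A` lie in the same part, then a module inside this part is a module of the
whole; otherwise `A` itself has at most `c` vertices. -/
theorem exists_module_substitution {c : ℕ} {V : Fin c → Type} (H : SimpleGraph (Fin c))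
    (F : ∀ i, SimpleGraph (V i)) {k : ℕ} (hc : c ≤ k)
    (ih : ∀ i, ∀ A : Finset (V i), 2 ≤ A.card →
      ∃ X, IsModule (F i) A X ∧ 2 ≤ X.card ∧ X.card ≤ k)
    (A : Finset (Σ i, V i)) (hA : 2 ≤ A.card) :
    ∃ X, IsModule (substitution H F) A X ∧ 2 ≤ X.card ∧ X.card ≤ k := by
  classical
  by_cases h : ∃ i, 2 ≤ (A.preimage (Sigma.mk i) sigma_mk_injective.injOn).card
  · obtain ⟨i, hi⟩ := h
    obtain ⟨X, ⟨hXA, hX⟩, h2, hk⟩ := ih i _ hi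
    refine ⟨X.map (Function.Embedding.sigmaMk i), ⟨fun x hx => ?_, fun a ha haX y hy z hz => ?_⟩,
      by simpa using h2, by simpa using hk⟩
    · obtain ⟨x, hx', rfl⟩ := Finset.mem_map.1 hx
      exact Finset.mem_preimage.1 (hXA hx')
    · obtain ⟨y, hy', rfl⟩ := Finset.mem_map.1 hy
      obtain ⟨z, hz', rfl⟩ := Finset.mem_map.1 hz
      obtain ⟨j, a⟩ := a
      by_cases hij : j = i
      · subst hij
        simp only [Function.Embedding.sigmaMk_apply, substitution_adj_mk_same]
        exact hX a (Finset.mem_preimage.2 ha) (fun h' => haX (Finset.mem_map_of_mem _ h')) y hy' z hz'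
      · rw [substitution_adj_of_ne (by exact hij), substitution_adj_of_ne (by exact hij)]
        exact id
  · push Not at h
    refine ⟨A, ⟨subset_rfl, fun a ha ha' => absurd ha ha'⟩, hA, le_trans ?_ hc⟩
    have : A.card ≤ (Finset.univ : Finset (Fin c)).card := by
      refine Finset.card_le_card_of_injOn Sigma.fst (fun _ _ => Finset.mem_coe.2 (Finset.mem_univ _)) ?_
      rintro ⟨i, u⟩ hu ⟨j, v⟩ hv hij
      obtain rfl : i = j := hij
      have := Finset.card_le_one.1 (Nat.le_of_lt_succ (h i)) u (Finset.mem_preimage.2 hu) v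
        (Finset.mem_preimage.2 hv)
      rw [this]
    simpa using this

/-- A lowest inner node of the decomposition, after restriction to `A`, is a small module. -/
theorem ModularDecomposition.exists_module (T : ModularDecomposition) :
    ∀ A : Finset T.Vert, 2 ≤ A.card →
      ∃ X, IsModule T.graph A X ∧ 2 ≤ X.card ∧ X.card ≤ T.width := by
  induction T with
  | leaf =>
    intro A hA
    have : A.card ≤ 1 := Finset.card_le_one.2 fun a _ b _ => Subsingleton.elim (α := Unit) a b
    omega
  | node c hc H child ih =>
    refine exists_module_substitution H (fun i => (child i).graph) (le_max_left _ _) fun i A hA => ?_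
    obtain ⟨X, h1, h2, h3⟩ := ih i A hA
    exact ⟨X, h1, h2, h3.trans ((Finset.le_sup (f := fun i => (child i).width)
      (Finset.mem_univ i)).trans (le_max_right _ _))⟩

/-- A single inner node labelled with the graph itself is a modular decomposition. -/
theorem exists_modularDecomposition {n : ℕ} (hn : 0 < n) (G : SimpleGraph (Fin n)) :
    ∃ T : ModularDecomposition, Nonempty (T.graph ≃g G) := by
  by_cases h : 2 ≤ n
  · refine ⟨.node n h G fun _ => .leaf, ⟨(Equiv.sigmaUnique (Fin n) fun _ => Unit : _ ≃ _), ?_⟩⟩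
    rintro ⟨i, a⟩ ⟨j, b⟩
    show G.Adj i j ↔ (substitution G fun _ => (⊥ : SimpleGraph Unit)).Adj ⟨i, a⟩ ⟨j, b⟩
    constructor
    · exact Or.inl
    · rintro (h | ⟨j, u', v', h, -, -⟩)
      · exact h
      · exact absurd h (by simp)
  · obtain rfl : n = 1 := by omega
    refine ⟨.leaf, ⟨((Equiv.ofUnique Unit (Fin 1)) : Unit ≃ Fin 1), ?_⟩⟩
    intro a b
    constructor
    · intro h; exact absurd (Subsingleton.elim _ _) h.ne
    · intro h; exact (show False from h).elim

/-- Every induced subgraph with at least two vertices has a module that has at least two vertices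
and at most as many as the modular-width. -/
theorem exists_small_module {n : ℕ} (G : SimpleGraph (Fin n)) {A : Finset ℕ}
    (hA : A ⊆ Finset.range n) (hA2 : 2 ≤ A.card) :
    ∃ X, IsModule (G.map Fin.valEmbedding) A X ∧ 2 ≤ X.card ∧ X.card ≤ modularWidth G := by
  have hn : 0 < n := by
    obtain ⟨a, ha⟩ := Finset.card_pos.1 (by omega : 0 < A.card)
    have := Finset.mem_range.1 (hA ha); omega
  obtain ⟨T₀, h₀⟩ := exists_modularDecomposition hn G
  obtain ⟨T, ⟨e⟩, hT⟩ := Nat.sInf_mem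
    (s := {k | ∃ T : ModularDecomposition, Nonempty (T.graph ≃g G) ∧ T.width = k})
    ⟨_, T₀, h₀, rfl⟩
  set φ : T.graph ↪g G.map Fin.valEmbedding :=
    (SimpleGraph.Embedding.map Fin.valEmbedding G).comp e.toEmbedding with hφ
  have hAφ : (A.preimage φ φ.injective.injOn).map φ.toEmbedding = A := by
    ext x
    simp only [Finset.mem_map, Finset.mem_preimage]
    constructor
    · rintro ⟨y, hy, rfl⟩; exact hy
    · intro hx
      refine ⟨e.symm ⟨x, Finset.mem_range.1 (hA hx)⟩, ?_, ?_⟩ <;> simp [hφ, hx]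
  obtain ⟨X, h1, h2, h3⟩ := T.exists_module (A.preimage φ φ.injective.injOn) (by
    rw [← Finset.card_map φ.toEmbedding, hAφ]; exact hA2)
  refine ⟨X.map φ.toEmbedding, hAφ ▸ h1.map φ, by simpa using h2, ?_⟩
  rw [Finset.card_map]
  exact h3.trans hT.le

/-! ### Weighted vertex integrity -/

/-- Vertices of the same component get the same colour; conversely, the components themselves are
the colour classes of a colouring. -/
theorem maxComponentWeight_le_iff {V : Type*} [Fintype V] [DecidableEq V] (G : SimpleGraph V)
    (w : V → ℕ+) (S : Finset V) (l : ℕ) :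
    maxComponentWeight G w S ≤ l ↔ Feasible G (fun v => (w v : ℕ)) l Sᶜ := by
  classical
  have hsum : ∀ (C : (G.induce {v | v ∉ S}).ConnectedComponent) (_ : Fintype C.supp),
      ∑ v ∈ C.supp.toFinset, (w v : ℕ) =
        ∑ v ∈ (Finset.univ.filter (· ∈ C.supp)).map (Function.Embedding.subtype _), (w v : ℕ) := by
    intro C _; rw [Finset.sum_map]; exact Finset.sum_congr (by ext; simp) fun _ _ => rfl
  simp only [maxComponentWeight, Finset.sup_le_iff, Finset.mem_univ, true_imp_iff, hsum]
  constructor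
  · intro h
    set κ : V → ℕ := fun v => if hv : v ∉ S then
      Fintype.equivFin (G.induce {v | v ∉ S}).ConnectedComponent
        ((G.induce {v | v ∉ S}).connectedComponentMk ⟨v, hv⟩) else 0 with hκ
    have hκeq : ∀ x y (hx : x ∉ S) (hy : y ∉ S), κ x = κ y ↔
        (G.induce {v | v ∉ S}).connectedComponentMk ⟨x, hx⟩ =
        (G.induce {v | v ∉ S}).connectedComponentMk ⟨y, hy⟩ := by
      intro x y hx hy
      simp only [hκ, dif_pos hx, dif_pos hy, Fin.val_inj, EmbeddingLike.apply_eq_iff_eq]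
    refine ⟨κ, fun x hx y hy hxy => ?_, fun C hC hmono => ?_⟩
    · rw [Finset.mem_compl] at hx hy
      rw [hκeq x y hx hy]
      exact SimpleGraph.ConnectedComponent.connectedComponentMk_eq_of_adj (by simpa using hxy)
    · rcases C.eq_empty_or_nonempty with rfl | ⟨x, hx⟩
      · simp
      have hxS := Finset.mem_compl.1 (hC hx)
      refine le_trans ?_ (h ((G.induce {v | v ∉ S}).connectedComponentMk ⟨x, hxS⟩))
      refine Finset.sum_le_sum_of_subset fun y hy => ?_
      have hyS := Finset.mem_compl.1 (hC hy)
      refine Finset.mem_map.2 ⟨⟨y, hyS⟩, ?_, rfl⟩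
      simpa using (hκeq y x hyS hxS).1 (hmono y hy x hx)
  · rintro ⟨κ, hκ, hl⟩ C
    refine hl _ (fun x hx => ?_) fun x hx y hy => ?_
    · obtain ⟨x, -, rfl⟩ := Finset.mem_map.1 hx
      exact Finset.mem_compl.2 x.2
    · obtain ⟨x, hx', rfl⟩ := Finset.mem_map.1 hx
      obtain ⟨y, hy', rfl⟩ := Finset.mem_map.1 hy
      simp only [Finset.mem_filter, Finset.mem_univ, true_and, SimpleGraph.ConnectedComponent.mem_supp_iff] at hx' hy'
      obtain ⟨p⟩ := SimpleGraph.ConnectedComponent.exact (hx'.trans hy'.symm)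
      clear hx hy hx' hy'
      induction p with
      | nil => rfl
      | @cons u v _ ha _ ih =>
        exact (hκ u (Finset.mem_compl.2 u.2) v (Finset.mem_compl.2 v.2) (by simpa using ha)).trans ih

/-- The weights as a function on the natural numbers, `0` off the vertices. -/
def extendWeight {n : ℕ} (w : Fin n → ℕ+) (x : ℕ) : ℕ := if h : x < n then w ⟨x, h⟩ else 0

theorem sum_map_extendWeight {n : ℕ} (w : Fin n → ℕ+) (T : Finset (Fin n)) :
    ∑ x ∈ T.map Fin.valEmbedding, extendWeight w x = ∑ v ∈ T, (w v : ℕ) := by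
  simp [extendWeight]

theorem feasible_map_iff {n : ℕ} (G : SimpleGraph (Fin n)) (w : Fin n → ℕ+) (l : ℕ)
    (T : Finset (Fin n)) :
    Feasible (G.map Fin.valEmbedding) (extendWeight w) l (T.map Fin.valEmbedding) ↔
      Feasible G (fun v => (w v : ℕ)) l T := by
  constructor
  · rintro ⟨c, h1, h2⟩
    refine ⟨fun v => c v, fun x hx y hy hxy => h1 x (Finset.mem_map_of_mem Fin.valEmbedding hx) y
      (Finset.mem_map_of_mem Fin.valEmbedding hy) ?_, fun C hC hmono => ?_⟩
    · exact (SimpleGraph.map_adj_apply (f := Fin.valEmbedding)).2 hxy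
    · rw [← sum_map_extendWeight]
      refine h2 _ (Finset.map_subset_map.2 hC) ?_
      simpa using hmono
  · rintro ⟨c, h1, h2⟩
    refine ⟨fun x => if h : x < n then c ⟨x, h⟩ else 0, fun x hx y hy hxy => ?_, fun C hC hmono => ?_⟩
    · obtain ⟨x, hx', rfl⟩ := Finset.mem_map.1 hx
      obtain ⟨y, hy', rfl⟩ := Finset.mem_map.1 hy
      have := h1 x hx' y hy' ((SimpleGraph.map_adj_apply (f := Fin.valEmbedding)).1 hxy)
      simpa using this
    · obtain ⟨C, hC', rfl⟩ := Finset.subset_map_iff.1 hC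
      rw [sum_map_extendWeight]
      refine h2 _ hC' ?_
      simpa using hmono

/-- If all vertices outside `T` are deleted and `l` is the weight of a heaviest component of what
remains, then the sum to be minimized is `w(V) - w(T) + l`. -/
theorem weightedVertexIntegrity_le_iff {n : ℕ} (G : SimpleGraph (Fin n)) (w : Fin n → ℕ+) (K : ℕ) :
    weightedVertexIntegrity G w ≤ K ↔ ∃ l ≤ ∑ x ∈ Finset.range n, extendWeight w x,
      ∃ T ⊆ Finset.range n, Feasible (G.map Fin.valEmbedding) (extendWeight w) l T ∧
        l + ∑ x ∈ Finset.range n, extendWeight w x ≤ K + ∑ x ∈ T, extendWeight w x := by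
  have hU : (Finset.univ : Finset (Fin n)).map Fin.valEmbedding = Finset.range n := by
    ext x; simp only [Finset.mem_map, Finset.mem_univ, true_and, Finset.mem_range]
    exact ⟨fun ⟨a, h⟩ => h ▸ a.2, fun h => ⟨⟨x, h⟩, rfl⟩⟩
  have hW : ∑ x ∈ Finset.range n, extendWeight w x = ∑ v, (w v : ℕ) := by
    rw [← hU, sum_map_extendWeight]
  have hS : ∀ S : Finset (Fin n), ∑ v ∈ S, (w v : ℕ) + ∑ v ∈ Sᶜ, (w v : ℕ) = ∑ v, (w v : ℕ) :=
    fun S => Finset.sum_add_sum_compl S _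
  rw [weightedVertexIntegrity, Finset.inf'_le_iff, hW]
  constructor
  · rintro ⟨S, -, h⟩
    refine ⟨_, ?_, Sᶜ.map Fin.valEmbedding, ?_,
      (feasible_map_iff G w _ _).2 ((maxComponentWeight_le_iff G w S _).1 le_rfl), ?_⟩
    · refine (maxComponentWeight_le_iff G w S _).2 ⟨fun _ => 0, fun _ _ _ _ _ => rfl,
        fun C _ _ => Finset.sum_le_sum_of_subset (Finset.subset_univ _)⟩
    · rw [← hU]; exact Finset.map_subset_map.2 (Finset.subset_univ _)
    · rw [sum_map_extendWeight]; have := hS S; omega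
  · rintro ⟨l, -, T, hT, hf, hl⟩
    rw [← hU] at hT
    obtain ⟨T, -, rfl⟩ := Finset.subset_map_iff.1 hT
    have := (maxComponentWeight_le_iff G w Tᶜ l).2 (by
      rw [compl_compl]; exact (feasible_map_iff G w _ _).1 hf)
    refine ⟨Tᶜ, Finset.mem_univ _, ?_⟩
    rw [sum_map_extendWeight] at hl
    have h2 := hS Tᶜ
    rw [compl_compl] at h2
    omega

/-! ### The algorithm -/

namespace WVI

open Imp

/-- The variables of the algorithm. The length of the input is in `len`; `n` is the number of
vertices, `W` their total weight, `kk` the absolute value of the bound, `sign` whether the bound is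
negative, `l` the current bound on the weight of components and `best` the size of the module to be
contracted next, of which `root` is a vertex. -/
inductive Var : Type
  | len | p | c | go | i | n | u | v | W | w1 | sign | kk | pw | l | l1 | k | x | y | r | best | root
  | size | K | opt | z | q | j | h | d | ok | val | s | t | ans
  deriving DecidableEq

/-- The arrays of the algorithm: the input, the positions `R` of the rows of the adjacency matrix,
the weights, the representatives `rep` of the vertices, the largest weight `g` that can be kept of
the class of a representative, the characteristic functions `X` and `M` of the module under
construction and of the smallest one, the labels `D` and the knapsack table `kn`. -/
inductive Arr : Type
  | inp | R | wt | rep | g | X | M | D | kn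
  deriving DecidableEq

local infixr:60 " ;; " => @Cmd.seq Var Arr
local prefix:max "♯" => @Exp.var Var Arr

/-- Commands over the variables and arrays of the algorithm. -/
abbrev Com := Cmd Var Arr
/-- Their states. -/
abbrev State := St Var Arr

/-- Read a number in unary at position `p` into `c`, and advance `p` beyond it. -/
def scan : Com :=
  .set .c 0 ;; .set .go 1 ;;
  .for_ .i .len (.when ♯.go
    (.ite (.get .inp ♯.p) (.set .c (♯.c + 1)) (.set .go 0) ;; .set .p (♯.p + 1)))

/-- Read the number of vertices. -/
def header : Com := .set .p 0 ;; scan ;; .set .n ♯.c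

/-- Read the rest of the input. The powers of two up to the length of the input are not bounded by
it, but their addition takes one step. -/
def parse : Com :=
  .for_ .u .n (.put .R ♯.u ♯.p ;; .set .p (♯.p + ♯.n)) ;;
  .set .W 0 ;;
  .for_ .v .n (scan ;; .put .wt ♯.v ♯.c ;; .set .W (♯.W + ♯.c)) ;;
  .set .sign (.get .inp ♯.p) ;; .set .p (♯.p + 1) ;; .set .kk 0 ;; .set .pw 1 ;;
  .for_ .i .len (.when (.get .inp ♯.p) (.set .kk (♯.kk + ♯.pw)) ;;
    .set .pw (♯.pw + ♯.pw) ;; .set .p (♯.p + 1))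

/-- Whether the values of `a` and `b` are adjacent vertices. -/
def edge (a b : Var) : Exp Var Arr := .get .inp (.get .R ♯a + ♯b)

/-- Add `x` to `X` if it distinguishes `u` from another vertex of `X`. -/
def split : Com :=
  .for_ .y .n (.when ((Exp.get .X ♯.y).and ((edge .x .y).eq (edge .x .u)).not) (.put .X ♯.x 1))

/-- Add to `X` the representatives that distinguish vertices of `X`, one after the other. -/
def sweep : Com :=
  .for_ .x .n (.when (((Exp.get .rep ♯.x).eq ♯.x).and (Exp.get .X ♯.x).not) split)

/-- Let `X` be the smallest module that contains the representatives `u` and `v`. -/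
def closure : Com :=
  .for_ .x .n (.put .X ♯.x (Exp.eq ♯.x ♯.u + Exp.eq ♯.x ♯.v)) ;; .for_ .r .n sweep

/-- If `X` is smaller than the smallest module so far, then replace the latter. -/
def record : Com :=
  .set .size 0 ;; .for_ .x .n (.set .size (♯.size + .get .X ♯.x)) ;;
  .when (Exp.lt ♯.size ♯.best)
    (.set .best ♯.size ;; .set .root ♯.u ;; .for_ .x .n (.put .M ♯.x (.get .X ♯.x)))

/-- Find a smallest module with at least two vertices in the graph on the representatives. -/
def find : Com :=
  .set .best (♯.n + 1) ;;
  .for_ .u .n (.for_ .v .n (.when (((Exp.get .rep ♯.u).eq ♯.u).and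
    (((Exp.get .rep ♯.v).eq ♯.v).and (Exp.eq ♯.u ♯.v).not)) (closure ;; record)))

/-- Let `K` be `2 ^ (best * best)`. -/
def power : Com := .set .K 1 ;; .for_ .i .best (.for_ .j .best (.set .K (♯.K + ♯.K)))

/-- Move the `best` lowest bits of `q` to `d`. -/
def digit : Com :=
  .set .d 0 ;; .set .pw 1 ;;
  .for_ .j .best (.set .h (.half ♯.q) ;; .when (♯.q - (♯.h + ♯.h)) (.set .d (♯.d + ♯.pw)) ;;
    .set .pw (♯.pw + ♯.pw) ;; .set .q ♯.h)

/-- The labels of the vertices of `M` are the digits of `z` to base `2 ^ best`. -/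
def decode : Com :=
  .set .q ♯.z ;; .for_ .v .n (.when (.get .M ♯.v) (digit ;; .put .D ♯.v ♯.d))

/-- Check whether the labelling is valid. -/
def validate : Com :=
  .set .ok 1 ;;
  .for_ .x .n (.for_ .y .n (.when (((Exp.get .M ♯.x).and (Exp.get .M ♯.y)).and ((edge .x .y).and
    ((Exp.get .D ♯.x).and ((Exp.get .D ♯.y).and (((Exp.get .D ♯.x).eq (Exp.get .D ♯.y)).and
      ((Exp.get .D ♯.x).eq 1).not).not)))) (.set .ok 0)))

/-- Admit the vertex `x` to the knapsack. -/
def relax : Com :=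
  .for_ .t .l1 (.set .s (♯.l - ♯.t) ;; .when (Exp.le (.get .wt ♯.x) ♯.s)
    (.set .h (.get .wt ♯.x + .get .kn (♯.s - .get .wt ♯.x)) ;;
      .when (Exp.lt (.get .kn ♯.s) ♯.h) (.put .kn ♯.s ♯.h)))

/-- Solve the knapsack problem for the pool with label `j + 2`. -/
def knapsack : Com :=
  .for_ .s .l1 (.put .kn ♯.s 0) ;;
  .for_ .x .n (.when ((Exp.get .M (.get .rep ♯.x)).and
    ((Exp.get .D (.get .rep ♯.x)).eq (♯.j + 2))) relax)

/-- The weight that the labelling allows to keep. -/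
def value : Com :=
  .set .val 0 ;;
  .for_ .x .n (.when ((Exp.get .M ♯.x).and ((Exp.get .D ♯.x).eq 1))
    (.set .val (♯.val + .get .g ♯.x))) ;;
  .for_ .j .best (knapsack ;; .set .val (♯.val + .get .kn ♯.l))

/-- Try one labelling. -/
def try_ : Com :=
  decode ;; validate ;; value ;; .when (Exp.and ♯.ok (Exp.lt ♯.opt ♯.val)) (.set .opt ♯.val)

/-- Try all labellings. -/
def enumerate : Com := .set .opt 0 ;; .for_ .z .K try_

/-- Contract the module `M` to `root`. -/
def merge : Com :=
  .put .g ♯.root ♯.opt ;;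
  .for_ .x .n (.when (.get .M (.get .rep ♯.x)) (.put .rep ♯.x ♯.root))

/-- Contract one module. -/
def step : Com := find ;; .when (Exp.le ♯.best ♯.n) (power ;; enumerate ;; merge)

/-- The partition into singletons. -/
def init : Com :=
  .set .l1 (♯.l + 1) ;;
  .for_ .v .n (.put .rep ♯.v ♯.v ;;
    .ite (Exp.le (.get .wt ♯.v) ♯.l) (.put .g ♯.v (.get .wt ♯.v)) (.put .g ♯.v 0))

/-- Treat one bound `l` on the weight of components. -/
def round : Com :=
  init ;; .for_ .k .n step ;;
  .when (Exp.le (♯.l + ♯.W) (♯.kk + .get .g (.get .rep 0))) (.set .ans 1)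

/-- The whole algorithm. -/
def main : Com :=
  header ;; parse ;; .set .ans 0 ;; .set .w1 (♯.W + 1) ;; .for_ .l .w1 round ;;
  .when ♯.sign (.set .ans 0) ;; .set .len ♯.ans

end WVI

/-! ### Correctness of the search for a smallest module -/

namespace WVI

open Imp

/-- Where an array is nonzero. -/
def supp (n : ℕ) (f : ℕ → ℕ) : Finset ℕ := (Finset.range n).filter fun x => f x ≠ 0

theorem mem_supp {n : ℕ} {f : ℕ → ℕ} {x : ℕ} : x ∈ supp n f ↔ x < n ∧ f x ≠ 0 := by simp [supp]

open Classical in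
/-- The state holds the graph `G` with weights `w`. -/
structure Holds (G : SimpleGraph ℕ) (w : ℕ → ℕ) (n : ℕ) (s : State) : Prop where
  reg_n : s.reg .n = n
  edge : ∀ x < n, ∀ y < n, s.arr .inp (s.arr .R x + y) = if G.Adj x y then 1 else 0
  wt : ∀ x < n, s.arr .wt x = w x

variable {G : SimpleGraph ℕ} {w : ℕ → ℕ} {n : ℕ}

theorem Holds.frame {s s' : State} (h : Holds G w n s) {W : List Var} {A : List Arr}
    (hf : Cmd.Frame W A s s') (hn : .n ∉ W) (hi : .inp ∉ A) (hR : .R ∉ A) (hw : .wt ∉ A) :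
    Holds G w n s' :=
  ⟨(hf.reg _ hn).trans h.reg_n, by rw [hf.arr _ hi, hf.arr _ hR]; exact h.edge,
    by rw [hf.arr _ hw]; exact h.wt⟩

theorem Holds.set {s : State} (h : Holds G w n s) {a : Var} (ha : a ≠ .n) (m : ℕ) :
    Holds G w n (s.set a m) :=
  ⟨by simpa [ha.symm] using h.reg_n, h.edge, h.wt⟩

/-- `split` decides whether `x` distinguishes two vertices of `X`. Since `u` is in `X`, comparison
with `u` suffices. -/
theorem split_spec {s : State} (h : Holds G w n s) {x u : ℕ} (hx : s.reg .x = x)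
    (hu : s.reg .u = u) (hxn : x < n) (hun : u < n) (h0 : s.arr .X x = 0) :
    (∀ a ≠ x, (split.run s).arr .X a = s.arr .X a) ∧
    (((split.run s).arr .X x = 0 ∧ ∀ y < n, s.arr .X y ≠ 0 → (G.Adj x y ↔ G.Adj x u)) ∨
      ((split.run s).arr .X x = 1 ∧ ∃ y < n, s.arr .X y ≠ 0 ∧ ¬(G.Adj x y ↔ G.Adj x u))) := by
  classical
  set Inv : ℕ → State → Prop := fun t s' =>
      (∀ a ≠ x, s'.arr .X a = s.arr .X a) ∧
      ((s'.arr .X x = 0 ∧ ∀ y < t, s.arr .X y ≠ 0 → (G.Adj x y ↔ G.Adj x u)) ∨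
      (s'.arr .X x = 1 ∧ ∃ y < n, s.arr .X y ≠ 0 ∧ ¬(G.Adj x y ↔ G.Adj x u)))
  suffices H : Inv (s.reg .n) (split.run s) by rw [h.reg_n] at H; exact H
  refine Cmd.run_for Inv ⟨fun _ _ => rfl, Or.inl ⟨h0, by simp⟩⟩ ?_
  rintro t ht s' hf ⟨h1, h2⟩
  rw [h.reg_n] at ht
  have h' := h.frame hf (by decide) (by decide) (by decide) (by decide)
  have e3 := hf.reg .x (by decide)
  have e4 := hf.reg .u (by decide)
  have hc : (((Exp.get .X (.var .y)).and ((edge .x .y).eq (edge .x .u)).not).eval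
      (s'.set .y t) ≠ 0) ↔ s'.arr .X t ≠ 0 ∧ ¬(G.Adj x t ↔ G.Adj x u) := by
    have a1 := h'.edge x hxn t ht
    have a2 := h'.edge x hxn u hun
    simp [edge, e3, e4, hx, hu, a1, a2]
    by_cases b1 : G.Adj x t <;> by_cases b2 : G.Adj x u <;> simp [b1, b2]
  rw [Cmd.run_when]
  by_cases hc' : s'.arr .X t ≠ 0 ∧ ¬(G.Adj x t ↔ G.Adj x u)
  · rw [if_pos (hc.2 hc')]
    refine ⟨fun a ha => ?_, Or.inr ⟨by simp [e3, hx], ?_⟩⟩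
    · simp [e3, hx, ha, h1 a ha]
    · rcases h2 with h2 | h2
      · have : t ≠ x := fun h => hc'.1 (h ▸ h2.1)
        exact ⟨t, ht, h1 t this ▸ hc'.1, hc'.2⟩
      · exact h2.2
  · rw [if_neg (fun h => hc' (hc.1 h))]
    refine ⟨fun a ha => h1 a ha, h2.imp (fun h2 => ⟨h2.1, fun y hy hy0 => ?_⟩) id⟩
    rcases Nat.lt_succ_iff_lt_or_eq.1 hy with hy | rfl
    · exact h2.2 y hy hy0
    · by_contra hne
      have : y ≠ x := fun h => hy0 (h ▸ h0)
      exact hc' ⟨(h1 y this).symm ▸ hy0, hne⟩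

/-- The content of `X` while the smallest module containing `u` is computed: representatives,
marked with ones, that belong to all modules in `P`. -/
structure Marks (n : ℕ) (rep : ℕ → ℕ) (u : ℕ) (P : Finset ℕ → Prop) (f : ℕ → ℕ) : Prop where
  le_one : ∀ a < n, f a ≤ 1
  alive : supp n f ⊆ alive n rep
  mem : u ∈ supp n f
  sub : ∀ Y, P Y → supp n f ⊆ Y

/-- A vertex that distinguishes two vertices of a subset of a module belongs to the module, so
`sweep` remains inside all modules in `P`. If it adds nothing, then the set is a module. -/
theorem sweep_spec {s : State} (h : Holds G w n s) {u : ℕ} (hu : s.reg .u = u) {P : Finset ℕ → Prop}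
    (hP : ∀ Y, P Y → IsModule G (alive n (s.arr .rep)) Y)
    (hX : Marks n (s.arr .rep) u P (s.arr .X)) :
    Marks n (s.arr .rep) u P ((sweep.run s).arr .X) ∧
    supp n (s.arr .X) ⊆ supp n ((sweep.run s).arr .X) ∧
    (supp n ((sweep.run s).arr .X) = supp n (s.arr .X) →
      IsModule G (alive n (s.arr .rep)) (supp n (s.arr .X))) := by
  set rep := s.arr .rep
  set X := s.arr .X with hXdef
  have hun := (mem_supp.1 hX.mem).1
  set Inv : ℕ → State → Prop := fun t s' =>
    Marks n rep u P (s'.arr .X) ∧ supp n X ⊆ supp n (s'.arr .X) ∧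
    (supp n (s'.arr .X) = supp n X → ∀ x < t, x ∈ alive n rep → x ∉ supp n X → ∀ y ∈ supp n X,
      (G.Adj x y ↔ G.Adj x u))
  suffices H : Inv (s.reg .n) (sweep.run s) by
    rw [h.reg_n] at H
    refine ⟨H.1, H.2.1, fun he => ⟨hX.alive, fun a ha haX y hy z hz hay => ?_⟩⟩
    have := H.2.2 he a (mem_alive.1 ha).1 ha haX
    rw [this z hz, ← this y hy]; exact hay
  refine Cmd.run_for Inv ⟨hX, subset_rfl, by simp⟩ ?_
  rintro t ht s' hf ⟨h1, h2, h3⟩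
  rw [h.reg_n] at ht
  have h' := h.frame hf (by decide) (by decide) (by decide) (by decide)
  have e2 := hf.arr .rep (by decide)
  have e4 := hf.reg .u (by decide)
  have hc : (((Exp.get .rep (.var .x)).eq (.var .x)).and (Exp.get .X (.var .x)).not :
      Exp Var Arr).eval (s'.set .x t) ≠ 0 ↔ rep t = t ∧ s'.arr .X t = 0 := by
    simp [e2, rep]
  rw [Cmd.run_when]
  by_cases hc' : rep t = t ∧ s'.arr .X t = 0
  · rw [if_pos (hc.2 hc')]
    have hs : Holds G w n (s'.set .x t) := h'.set (by decide) t
    obtain ⟨k1, k2⟩ := split_spec hs (x := t) (u := u) (by simp) (by simp [e4, hu]) ht hun hc'.2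
    set f := (split.run (s'.set .x t)).arr .X
    have k1 : ∀ a ≠ t, f a = s'.arr .X a := k1
    have hsub : supp n (s'.arr .X) ⊆ supp n f := by
      intro a ha
      rw [mem_supp] at ha ⊢
      have : a ≠ t := fun h => ha.2 (h ▸ hc'.2)
      rw [k1 a this]; exact ha
    have hle : ∀ a < n, f a ≤ 1 := by
      intro a ha
      by_cases hat : a = t
      · subst hat; rcases k2 with k2 | k2 <;> omega
      · rw [k1 a hat]; exact h1.le_one a ha
    have hmem : ∀ a ∈ supp n f, a ∈ supp n (s'.arr .X) ∨ a = t := by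
      intro a ha
      rw [mem_supp] at ha
      by_cases hat : a = t
      · exact Or.inr hat
      · rw [k1 a hat] at ha; exact Or.inl (mem_supp.2 ha)
    have htal : t ∈ alive n rep := mem_alive.2 ⟨ht, hc'.1⟩
    refine ⟨⟨hle, fun a ha => ?_, hsub h1.mem, fun Y hY a ha => ?_⟩, h2.trans hsub,
      fun he x hx hxa hxX y hy => ?_⟩
    · rcases hmem a ha with ha | rfl
      · exact h1.alive ha
      · exact htal
    · rcases hmem a ha with ha' | rfl
      · exact h1.sub Y hY ha'
      · -- a module without this vertex could not contain both of the vertices it distinguishes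
        rcases k2 with ⟨k2, -⟩ | ⟨-, y, hyn, hy, hne⟩
        · exact absurd k2 (mem_supp.1 ha).2
        · by_contra haY
          have hyY := h1.sub Y hY (mem_supp.2 ⟨hyn, hy⟩)
          have huY := h1.sub Y hY h1.mem
          exact hne ⟨(hP Y hY).2 a htal haY y hyY u huY, (hP Y hY).2 a htal haY u huY y hyY⟩
    · have he' : supp n (s'.arr .X) = supp n X :=
        Finset.Subset.antisymm (he ▸ hsub) h2
      rcases Nat.lt_succ_iff_lt_or_eq.1 hx with hx | rfl
      · exact h3 he' x hx hxa hxX y hy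
      · rcases k2 with ⟨-, k2⟩ | ⟨k2, -⟩
        · have := mem_supp.1 (h2 hy)
          exact k2 y this.1 this.2
        · refine absurd (he ▸ mem_supp.2 ⟨ht, ?_⟩) hxX
          show f x ≠ 0
          rw [k2]; omega
  · rw [if_neg (fun h => hc' (hc.1 h))]
    refine ⟨h1, h2, fun he x hx hxa hxX y hy => ?_⟩
    rcases Nat.lt_succ_iff_lt_or_eq.1 hx with hx | rfl
    · exact h3 he x hx hxa hxX y hy
    · refine absurd ⟨(mem_alive.1 hxa).2, ?_⟩ hc'
      by_contra h0
      exact hxX (he ▸ mem_supp.2 ⟨ht, h0⟩)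

/-- `closure` computes the smallest module that contains `u` and `v`. -/
theorem closure_spec {s : State} (h : Holds G w n s) {u v : ℕ} (hu : s.reg .u = u)
    (hv : s.reg .v = v) (hua : u ∈ alive n (s.arr .rep)) (hva : v ∈ alive n (s.arr .rep))
    (huv : u ≠ v) :
    (∀ a < n, (closure.run s).arr .X a ≤ 1) ∧
    IsModule G (alive n (s.arr .rep)) (supp n ((closure.run s).arr .X)) ∧
    u ∈ supp n ((closure.run s).arr .X) ∧ v ∈ supp n ((closure.run s).arr .X) ∧
    ∀ Y, IsModule G (alive n (s.arr .rep)) Y → u ∈ Y → v ∈ Y →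
      supp n ((closure.run s).arr .X) ⊆ Y := by
  set rep := s.arr .rep
  set P : Finset ℕ → Prop := fun Y => IsModule G (alive n rep) Y ∧ u ∈ Y ∧ v ∈ Y
  have hun := (mem_alive.1 hua).1
  have hvn := (mem_alive.1 hva).1
  rw [closure, Cmd.run_seq]
  set c₁ : Com := .for_ .x .n (.put .X (.var .x) (Exp.eq (.var .x) (.var .u) +
    Exp.eq (.var .x) (.var .v))) with hc₁
  set s₁ := c₁.run s with hs₁
  have hf₁ : Cmd.Frame c₁.writes c₁.arrays s s₁ := Cmd.frame_run _ _
  have hX₁ : ∀ a < n, s₁.arr .X a = if a = u ∨ a = v then 1 else 0 := by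
    set Inv : ℕ → State → Prop := fun t s' => ∀ a < t, s'.arr .X a = if a = u ∨ a = v then 1 else 0
    suffices H : Inv (s.reg .n) s₁ by rw [h.reg_n] at H; exact H
    refine Cmd.run_for Inv (by intro a ha; omega) ?_
    intro t ht s' hf hI a ha
    have e1 := hf.reg .u (by decide)
    have e2 := hf.reg .v (by decide)
    rcases Nat.lt_succ_iff_lt_or_eq.1 ha with ha | rfl
    · simpa [ha.ne] using hI a ha
    · simp [e1, e2, hu, hv, Exp.eval_eq_eq_ite]
      split <;> split <;> split <;> simp_all
  have hsupp₁ : ∀ a, a ∈ supp n (s₁.arr .X) ↔ a = u ∨ a = v := by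
    intro a
    rw [mem_supp]
    constructor
    · rintro ⟨h1, h2⟩; rw [hX₁ a h1] at h2; by_contra h3; simp [h3] at h2
    · intro h1
      have : a < n := by rcases h1 with rfl | rfl <;> assumption
      exact ⟨this, by rw [hX₁ a this, if_pos h1]; omega⟩
  have h₁ : Holds G w n s₁ := h.frame hf₁ (by decide) (by decide) (by decide) (by decide)
  have er : s₁.arr .rep = rep := hf₁.arr .rep (by decide)
  set Inv : ℕ → State → Prop := fun t s' => Marks n rep u P (s'.arr .X) ∧ v ∈ supp n (s'.arr .X) ∧
    (IsModule G (alive n rep) (supp n (s'.arr .X)) ∨ t ≤ (supp n (s'.arr .X)).card)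
  have H : Inv n ((Cmd.for_ .r .n sweep).run s₁) := by
    rw [← h₁.reg_n]
    refine Cmd.run_for Inv ⟨⟨fun a ha => ?_, fun a ha => ?_, (hsupp₁ u).2 (Or.inl rfl),
      fun Y hY a ha => ?_⟩, (hsupp₁ v).2 (Or.inr rfl), Or.inr (Nat.zero_le _)⟩ ?_
    · rw [hX₁ a ha]; split <;> omega
    · rcases (hsupp₁ a).1 ha with rfl | rfl <;> assumption
    · rcases (hsupp₁ a).1 ha with rfl | rfl
      · exact hY.2.1
      · exact hY.2.2
    · rintro t ht s' hf ⟨i1, i2, i3⟩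
      have h' := h₁.frame hf (by decide) (by decide) (by decide) (by decide)
      have e2 : s'.arr .rep = rep := (hf.arr .rep (by decide)).trans er
      have hs : Holds G w n (s'.set .r t) := h'.set (by decide) t
      have e4 : s'.reg .u = u := (hf.reg .u (by decide)).trans ((hf₁.reg .u (by decide)).trans hu)
      obtain ⟨k1, k2, k3⟩ := sweep_spec hs (u := u) (P := P) (by simp [e4])
        (fun Y hY => by rw [St.set_arr, e2]; exact hY.1) (by rw [St.set_arr, e2]; exact i1)
      rw [St.set_arr, e2] at k1 k3
      rw [St.set_arr] at k2
      refine ⟨k1, k2 i2, ?_⟩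
      by_cases he : supp n ((sweep.run (s'.set .r t)).arr .X) = supp n (s'.arr .X)
      · rw [he]; exact Or.inl (k3 he)
      · rcases i3 with i3 | i3
        · exact absurd (Finset.Subset.antisymm (k1.sub _ ⟨i3, i1.mem, i2⟩) k2) he
        · have := Finset.card_lt_card (Finset.ssubset_iff_subset_ne.2 ⟨k2, Ne.symm he⟩)
          exact Or.inr (by omega)
  obtain ⟨H1, H2, H3⟩ := H
  refine ⟨H1.le_one, ?_, H1.mem, H2, fun Y h1 h2 h3 => H1.sub Y ⟨h1, h2, h3⟩⟩
  rcases H3 with H3 | H3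
  · exact H3
  · -- all `n` vertices are marked
    refine ⟨H1.alive, fun a ha haX => absurd ?_ haX⟩
    have : supp n (((Cmd.for_ .r .n sweep).run s₁).arr .X) = Finset.range n :=
      Finset.eq_of_subset_of_card_le (Finset.filter_subset _ _) (by simpa using H3)
    rw [this]
    exact Finset.mem_range.2 (mem_alive.1 ha).1

theorem record_spec {s : State} (h : Holds G w n s) (hX : ∀ a < n, s.arr .X a ≤ 1) :
    ((supp n (s.arr .X)).card < s.reg .best ∧
      (record.run s).reg .best = (supp n (s.arr .X)).card ∧
      (record.run s).reg .root = s.reg .u ∧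
      supp n ((record.run s).arr .M) = supp n (s.arr .X)) ∨
    (s.reg .best ≤ (supp n (s.arr .X)).card ∧ (record.run s).reg .best = s.reg .best ∧
      (record.run s).reg .root = s.reg .root ∧ (record.run s).arr .M = s.arr .M) := by
  set s₀ := s.set .size 0
  have h₀ : Holds G w n s₀ := h.set (by decide) 0
  set c₁ : Com := .for_ .x .n (.set .size (.var .size + .get .X (.var .x))) with hc₁
  set s₁ := c₁.run s₀ with hs₁
  have hf₁ : Cmd.Frame c₁.writes c₁.arrays s₀ s₁ := Cmd.frame_run _ _
  have hsize : s₁.reg .size = (supp n (s.arr .X)).card := by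
    set Inv : ℕ → State → Prop := fun t s' => s'.reg .size = ∑ a ∈ Finset.range t, s.arr .X a
    have H : Inv (s₀.reg .n) s₁ := by
      refine Cmd.run_for Inv (by simp [Inv, s₀]) ?_
      intro t ht s' hf hI
      have e1 := hf.arr .X (by decide)
      have hI : s'.reg .size = ∑ a ∈ Finset.range t, s.arr .X a := hI
      simp [Inv, hI, e1, s₀, Finset.sum_range_succ]
    rw [h₀.reg_n] at H
    refine Eq.trans H ?_
    rw [supp, Finset.card_filter]
    refine Finset.sum_congr rfl fun a ha => ?_
    have := hX a (Finset.mem_range.1 ha)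
    split <;> omega
  have hb : s₁.reg .best = s.reg .best := hf₁.reg .best (by decide)
  have hr : record.run s = if s₁.reg .best - s₁.reg .size ≠ 0 then
      (Cmd.for_ .x .n (.put .M (.var .x) (.get .X (.var .x)))).run
        ((s₁.set .best (s₁.reg .size)).set .root (s₁.reg .u)) else s₁ := rfl
  rw [hr]
  by_cases hlt : (supp n (s.arr .X)).card < s.reg .best
  · rw [if_pos (by omega)]
    set s₂ := (s₁.set .best (s₁.reg .size)).set .root (s₁.reg .u)
    set c₃ : Com := .for_ .x .n (.put .M (.var .x) (.get .X (.var .x))) with hc₃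
    have hf₃ : Cmd.Frame c₃.writes c₃.arrays s₂ (c₃.run s₂) := Cmd.frame_run _ _
    refine Or.inl ⟨hlt, (hf₃.reg .best (by decide)).trans (by simp [s₂, hsize]),
      (hf₃.reg .root (by decide)).trans ?_, ?_⟩
    · simp only [s₂, St.set_reg, if_true]
      exact hf₁.reg .u (by decide)
    · set Inv : ℕ → State → Prop := fun t s' => ∀ a < t, s'.arr .M a = s.arr .X a
      have H : Inv (s₂.reg .n) (c₃.run s₂) := by
        refine Cmd.run_for Inv (by intro a ha; omega) ?_
        intro t ht s' hf hI a ha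
        have e1 : s'.arr .X = s.arr .X := (hf.arr .X (by decide)).trans (hf₁.arr .X (by decide))
        rcases Nat.lt_succ_iff_lt_or_eq.1 ha with ha | rfl
        · simpa [ha.ne] using hI a ha
        · simp [e1]
      have hn : s₂.reg .n = n := by
        simp only [s₂, St.set_reg, reduceCtorEq, if_false]
        rw [hf₁.reg .n (by decide), h₀.reg_n]
      rw [hn] at H
      ext a
      rw [mem_supp, mem_supp]
      exact and_congr_right fun ha => by rw [H a ha]
  · rw [if_neg (by omega)]
    exact Or.inr ⟨by omega, hb, hf₁.reg .root (by decide), hf₁.arr .M (by decide)⟩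

/-- `M` is a module of the graph on the representatives, with `best` vertices, one of them
`root`. -/
structure Found (G : SimpleGraph ℕ) (n : ℕ) (rep : ℕ → ℕ) (s : State) : Prop where
  isModule : IsModule G (alive n rep) (supp n (s.arr .M))
  root : s.reg .root ∈ supp n (s.arr .M)
  card : (supp n (s.arr .M)).card = s.reg .best
  two_le : 2 ≤ s.reg .best

/-- After `find`, either there is a single representative, or `M` is a smallest module. -/
theorem find_spec {s : State} (h : Holds G w n s) :
    ((find.run s).reg .best = n + 1 ∧ (alive n (s.arr .rep)).card ≤ 1) ∨
    (Found G n (s.arr .rep) (find.run s) ∧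
      ∀ Y, IsModule G (alive n (s.arr .rep)) Y → 2 ≤ Y.card → (find.run s).reg .best ≤ Y.card) := by
  set rep := s.arr .rep
  set Q : ℕ → ℕ → State → Prop := fun t₁ t₂ s' =>
    (s'.reg .best = n + 1 ∨ Found G n rep s') ∧
    ∀ u ∈ alive n rep, ∀ v ∈ alive n rep, u ≠ v → u < t₁ ∨ u = t₁ ∧ v < t₂ →
      ∀ Y, IsModule G (alive n rep) Y → u ∈ Y → v ∈ Y → s'.reg .best ≤ Y.card with hQ
  set s₀ := s.set .best (s.reg .n + 1)
  have h₀ : Holds G w n s₀ := h.set (by decide) _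
  have H : Q (s₀.reg .n) 0 (find.run s) := by
    refine Cmd.run_for (fun t => Q t 0) ?_ ?_
    · refine ⟨Or.inl ?_, fun u _ v _ _ h => by omega⟩
      simp [h.reg_n]
    · rintro t ht s₁ hf₁ hI
      have h₁ : Holds G w n (s₁.set .u t) :=
        (h₀.frame hf₁ (by decide) (by decide) (by decide) (by decide)).set (by decide) _
      have ht : t < n := h₀.reg_n ▸ ht
      have er : s₁.arr .rep = rep := hf₁.arr .rep (by decide)
      have key := Cmd.run_for (i := .v) (b := .n) (c := .when (((Exp.get .rep (.var .u)).eq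
        (.var .u)).and (((Exp.get .rep (.var .v)).eq (.var .v)).and
        (Exp.eq (.var .u) (.var .v)).not)) (closure.seq record)) (s := s₁.set .u t) (Q t)
        ⟨hI.1.imp_right fun hF => ⟨hF.isModule, hF.root, hF.card, hF.two_le⟩, hI.2⟩ ?_
      · rw [h₁.reg_n] at key
        refine ⟨key.1, fun u hu v hv huv hlt => key.2 u hu v hv huv ?_⟩
        have := (mem_alive.1 hv).1
        omega
      · rintro t₂ ht₂ s₂ hf₂ ⟨hI₁, hI₂⟩
        rw [h₁.reg_n] at ht₂
        set s₃ := s₂.set .v t₂ with hs₃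
        have h₃ : Holds G w n s₃ :=
          (h₁.frame hf₂ (by decide) (by decide) (by decide) (by decide)).set (by decide) _
        have er : s₃.arr .rep = rep := (hf₂.arr .rep (by decide)).trans er
        have eu : s₃.reg .u = t := by
          rw [hs₃, St.set_reg, if_neg (by decide), hf₂.reg .u (by decide)]; simp
        have ev : s₃.reg .v = t₂ := by simp [hs₃]
        have hc : (((Exp.get .rep (.var .u)).eq (.var .u)).and (((Exp.get .rep (.var .v)).eq
            (.var .v)).and (Exp.eq (.var .u) (.var .v)).not) : Exp Var Arr).eval s₃ ≠ 0 ↔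
            rep t = t ∧ rep t₂ = t₂ ∧ t ≠ t₂ := by
          simp [er, eu, ev]
        rw [Cmd.run_when]
        by_cases hc' : rep t = t ∧ rep t₂ = t₂ ∧ t ≠ t₂
        · rw [if_pos (hc.2 hc'), Cmd.run_seq]
          have ua : t ∈ alive n rep := mem_alive.2 ⟨ht, hc'.1⟩
          have va : t₂ ∈ alive n rep := mem_alive.2 ⟨ht₂, hc'.2.1⟩
          obtain ⟨c1, c2, c3, c4, c5⟩ := closure_spec h₃ eu ev (er ▸ ua) (er ▸ va) hc'.2.2
          rw [er] at c2 c5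
          have hf₄ := Cmd.frame_run closure s₃
          set s₄ := closure.run s₃
          have h₄ : Holds G w n s₄ :=
            h₃.frame hf₄ (by decide) (by decide) (by decide) (by decide)
          have b₄ : s₄.reg .best = s₂.reg .best := hf₄.reg .best (by decide)
          have hQ₄ : ∀ b ≤ s₂.reg .best, b ≤ (supp n (s₄.arr .X)).card →
              ∀ u ∈ alive n rep, ∀ v ∈ alive n rep, u ≠ v → u < t ∨ u = t ∧ v < t₂ + 1 →
              ∀ Y, IsModule G (alive n rep) Y → u ∈ Y → v ∈ Y → b ≤ Y.card := by
            intro b hb hb' u hu v hv huv hlt Y hY huY hvY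
            rcases (by omega : (u < t ∨ u = t ∧ v < t₂) ∨ (u = t ∧ v = t₂)) with hlt | ⟨rfl, rfl⟩
            · exact hb.trans (hI₂ u hu v hv huv hlt Y hY huY hvY)
            · exact hb'.trans (Finset.card_le_card (c5 Y hY huY hvY))
          rcases record_spec h₄ c1 with ⟨r1, r2, r3, r4⟩ | ⟨r1, r2, r3, r4⟩
          · refine ⟨Or.inr ⟨?_, ?_, ?_, ?_⟩, ?_⟩
            · rw [r4]; exact c2
            · rw [r4, r3, hf₄.reg .u (by decide), eu]; exact c3
            · rw [r4, r2]
            · rw [r2]; exact Finset.one_lt_card.2 ⟨_, c3, _, c4, hc'.2.2⟩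
            · rw [r2]; exact hQ₄ _ (by omega) le_rfl
          · refine ⟨?_, ?_⟩
            · rw [r2, b₄]
              refine hI₁.imp_right fun hF => ⟨?_, ?_, ?_, ?_⟩
              · rw [r4, hf₄.arr .M (by decide)]; exact hF.isModule
              · rw [r4, r3, hf₄.arr .M (by decide), hf₄.reg .root (by decide)]; exact hF.root
              · rw [r4, r2, hf₄.arr .M (by decide), b₄]; exact hF.card
              · rw [r2, b₄]; exact hF.two_le
            · rw [r2, b₄]; exact hQ₄ _ le_rfl (b₄ ▸ r1)
        · rw [if_neg (fun h => hc' (hc.1 h))]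
          refine ⟨hI₁.imp_right fun hF => ⟨hF.isModule, hF.root, hF.card, hF.two_le⟩,
            fun u hu v hv huv hlt Y hY huY hvY => ?_⟩
          rcases (by omega : (u < t ∨ u = t ∧ v < t₂) ∨ (u = t ∧ v = t₂)) with hlt | ⟨rfl, rfl⟩
          · exact hI₂ u hu v hv huv hlt Y hY huY hvY
          · exact absurd ⟨(mem_alive.1 hu).2, (mem_alive.1 hv).2, huv⟩ hc'
  rw [h₀.reg_n] at H
  have hmin : ∀ Y, IsModule G (alive n rep) Y → 2 ≤ Y.card → (find.run s).reg .best ≤ Y.card := by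
    intro Y hY h2
    obtain ⟨u, hu, v, hv, huv⟩ := Finset.one_lt_card.1 h2
    exact H.2 u (hY.1 hu) v (hY.1 hv) huv (Or.inl (mem_alive.1 (hY.1 hu)).1) Y hY hu hv
  rcases H.1 with H1 | H1
  · refine Or.inl ⟨H1, ?_⟩
    by_contra hlt
    have := hmin (alive n rep) ⟨subset_rfl, fun a ha h => absurd ha h⟩ (by omega)
    have h2 : (alive n rep).card ≤ n := by
      exact (Finset.card_le_card (Finset.filter_subset _ _)).trans (Finset.card_range n).le
    omega
  · exact Or.inr ⟨H1, hmin⟩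

end WVI

/-! ### Correctness of the dynamic programming -/

theorem isKnap_empty (w : ℕ → ℕ) (l : ℕ) : IsKnap w l ∅ 0 :=
  ⟨⟨∅, by simp⟩, fun T hT _ => by simp [Finset.subset_empty.1 hT]⟩

/-- The recurrence of the dynamic programme for the knapsack problem. -/
theorem IsKnap.insert {w : ℕ → ℕ} {b x o o' : ℕ} {U : Finset ℕ} (hx : x ∉ U) (h : IsKnap w b U o)
    (h' : w x ≤ b → IsKnap w (b - w x) U o') :
    IsKnap w b (insert x U) (if w x ≤ b then max o (w x + o') else o) := by
  constructor
  · obtain ⟨T, hT, hw, hl⟩ := h.1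
    have h1 : ∃ T ⊆ Insert.insert x U, ∑ x ∈ T, w x = o ∧ o ≤ b :=
      ⟨T, hT.trans (Finset.subset_insert _ _), hw, hl⟩
    split
    · next hb =>
      obtain ⟨T', hT', hw', hl'⟩ := (h' hb).1
      rcases le_total o (w x + o') with hle | hle
      · rw [max_eq_right hle]
        refine ⟨Insert.insert x T', Finset.insert_subset_insert _ hT', ?_, by omega⟩
        rw [Finset.sum_insert fun h => hx (hT' h), hw']
      · rw [max_eq_left hle]; exact h1
    · exact h1
  · intro T hT hl
    by_cases hxT : x ∈ T
    · have hsum := Finset.add_sum_erase T w hxT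
      have hTU : T.erase x ⊆ U := fun y hy => by
        rw [Finset.mem_erase] at hy
        exact (Finset.mem_insert.1 (hT hy.2)).resolve_left hy.1
      have hb : w x ≤ b := by omega
      rw [if_pos hb]
      have := (h' hb).2 _ hTU (by omega)
      omega
    · have := h.2 T (fun y hy => (Finset.mem_insert.1 (hT hy)).resolve_left
        fun h => hxT (h ▸ hy)) hl
      split <;> omega

namespace WVI

open Imp

variable {G : SimpleGraph ℕ} {w : ℕ → ℕ} {n : ℕ}

theorem power_spec (s : State) : (power.run s).reg .K = 2 ^ (s.reg .best * s.reg .best) := by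
  set m := s.reg .best
  set Inv : ℕ → State → Prop := fun t s' => s'.reg .K = 2 ^ (t * m)
  suffices H : Inv ((s.set .K 1).reg .best) (power.run s) from H
  refine Cmd.run_for Inv (by simp [Inv]) ?_
  intro t ht s₁ hf₁ hI
  have eb : s₁.reg .best = m := hf₁.reg .best (by decide)
  have key := Cmd.run_for (i := .j) (b := .best) (c := .set .K (.var .K + .var .K))
    (s := s₁.set .i t) (fun t₂ s' => s'.reg .K = 2 ^ (t * m + t₂)) hI ?_
  · show _ = _
    rw [add_mul, one_mul, ← eb]
    rw [eb]
    have e : (s₁.set .i t).reg .best = m := eb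
    rw [e] at key
    exact key
  · intro t₂ _ s₂ _ h2
    simp [h2]
    ring

theorem digit_spec (s : State) :
    (digit.run s).reg .d = s.reg .q % 2 ^ s.reg .best ∧
      (digit.run s).reg .q = s.reg .q / 2 ^ s.reg .best := by
  set q := s.reg .q
  set Inv : ℕ → State → Prop := fun t s' =>
    s'.reg .d = q % 2 ^ t ∧ s'.reg .q = q / 2 ^ t ∧ s'.reg .pw = 2 ^ t
  suffices H : Inv (((s.set .d 0).set .pw 1).reg .best) (digit.run s) from ⟨H.1, H.2.1⟩
  refine Cmd.run_for Inv ?_ ?_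
  · simp [Inv, q, Nat.mod_one]
  · rintro t ht s₁ hf₁ ⟨h1, h2, h3⟩
    have e1 : q / 2 ^ (t + 1) = q / 2 ^ t / 2 := by rw [pow_succ, Nat.div_div_eq_div_mul]
    have e2 : q % 2 ^ (t + 1) = q % 2 ^ t + 2 ^ t * (q / 2 ^ t % 2) := Nat.mod_pow_succ
    have e3 : q / 2 ^ t % 2 = q / 2 ^ t - (q / 2 ^ t / 2 + q / 2 ^ t / 2) := by omega
    simp only [Inv, Cmd.run_seq, Cmd.run_set, Cmd.run_when]
    rw [e1, e2, pow_succ]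
    rcases Nat.mod_two_eq_zero_or_one (q / 2 ^ t) with h | h
    · rw [if_neg]
      · simp [h1, h2, h3, h, mul_two]
      · simp [h2]; omega
    · rw [if_pos]
      · simp [h1, h2, h3, h, mul_two]
      · simp [h2]; omega

/-- The label of `v` encoded by `z`: its digits to base `2 ^ m` are the labels of the elements of
the set with characteristic function `M`, in increasing order. -/
def label (m : ℕ) (M : ℕ → ℕ) (z v : ℕ) : ℕ := z / 2 ^ (m * (supp v M).card) % 2 ^ m

theorem supp_succ (t : ℕ) (M : ℕ → ℕ) :
    (supp (t + 1) M).card = (supp t M).card + if M t ≠ 0 then 1 else 0 := by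
  rw [supp, Finset.range_add_one, Finset.filter_insert]
  split
  · rw [Finset.card_insert_of_notMem (by simp)]; rfl
  · rfl

theorem decode_spec {s : State} {M : ℕ → ℕ} (hM : s.arr .M = M) :
    ∀ v < s.reg .n, M v ≠ 0 → (decode.run s).arr .D v = label (s.reg .best) M (s.reg .z) v := by
  set m := s.reg .best
  set z := s.reg .z
  set Inv : ℕ → State → Prop := fun t s' => s'.reg .q = z / 2 ^ (m * (supp t M).card) ∧
    ∀ v < t, M v ≠ 0 → s'.arr .D v = label m M z v
  suffices H : Inv ((s.set .q z).reg .n) (decode.run s) from H.2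
  refine Cmd.run_for Inv ?_ ?_
  · simp [Inv, supp, z]
  · rintro t ht s₁ hf₁ ⟨h1, h2⟩
    have eM : s₁.arr .M = M := (hf₁.arr .M (by decide)).trans hM
    have eb : s₁.reg .best = m := hf₁.reg .best (by decide)
    rw [Cmd.run_when]
    by_cases hMt : M t ≠ 0
    · rw [if_pos (by simpa [eM] using hMt), Cmd.run_seq, Cmd.run_put]
      obtain ⟨d1, d2⟩ := digit_spec (s₁.set .v t)
      have hf₂ := Cmd.frame_run digit (s₁.set .v t)
      set s₂ := digit.run (s₁.set .v t)
      have eD : s₂.arr .D = s₁.arr .D := hf₂.arr .D (by decide)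
      have ev : s₂.reg .v = t := (hf₂.reg .v (by decide)).trans (by simp)
      simp only [St.set_reg, reduceCtorEq, if_false, h1, eb] at d1 d2
      refine ⟨?_, fun v hv hMv => ?_⟩
      · rw [St.put_reg, d2, supp_succ, if_pos hMt, Nat.div_div_eq_div_mul, ← pow_add, mul_add,
          mul_one]
      · rcases Nat.lt_succ_iff_lt_or_eq.1 hv with hv | rfl
        · simpa [ev, hv.ne, eD] using h2 v hv hMv
        · simp [ev, d1, label]
    · rw [if_neg (by simpa [eM] using hMt)]
      refine ⟨?_, fun v hv hMv => ?_⟩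
      · rw [supp_succ, if_neg hMt]; exact h1
      · rcases Nat.lt_succ_iff_lt_or_eq.1 hv with hv | rfl
        · exact h2 v hv hMv
        · exact absurd hMv hMt

/-- Every labelling with labels below `2 ^ m` is encoded by a number. -/
theorem exists_label_eq (m : ℕ) (M D : ℕ → ℕ) (hD : ∀ v, D v < 2 ^ m) (t : ℕ) :
    ∃ z < 2 ^ (m * (supp t M).card), ∀ v < t, M v ≠ 0 → label m M z v = D v := by
  induction t with
  | zero => exact ⟨0, by positivity, by simp⟩
  | succ t ih =>
    obtain ⟨z, hz, h⟩ := ih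
    rw [supp_succ]
    split
    · next hM =>
      refine ⟨z + 2 ^ (m * (supp t M).card) * D t, ?_, fun v hv hMv => ?_⟩
      · rw [mul_add, mul_one, pow_add]
        calc _ < 2 ^ (m * (supp t M).card) * (D t + 1) := by rw [mul_add, mul_one]; omega
          _ ≤ _ := Nat.mul_le_mul_left _ (hD t)
      · rcases Nat.lt_succ_iff_lt_or_eq.1 hv with hv | rfl
        · rw [← h v hv hMv, label, label]
          have hlt : (supp v M).card + 1 ≤ (supp t M).card := by
            have h1 : (supp (v + 1) M).card ≤ (supp t M).card := by
              refine Finset.card_le_card fun a ha => ?_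
              rw [mem_supp] at ha ⊢
              exact ⟨by omega, ha.2⟩
            rw [supp_succ, if_pos hMv] at h1
            exact h1
          obtain ⟨e, he⟩ := Nat.exists_eq_add_of_le hlt
          have : 2 ^ (m * (supp t M).card) * D t =
              2 ^ (m * (supp v M).card) * (2 ^ m * (2 ^ (m * e) * D t)) := by
            rw [he]; ring
          rw [this, Nat.add_mul_div_left _ _ (by positivity), Nat.add_mul_mod_self_left]
        · rw [label, Nat.add_mul_div_left _ _ (by positivity), Nat.div_eq_of_lt hz, zero_add,
            Nat.mod_eq_of_lt (hD v)]
    · next hM =>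
      refine ⟨z, by simpa using hz, fun v hv hMv => ?_⟩
      rcases Nat.lt_succ_iff_lt_or_eq.1 hv with hv | rfl
      · exact h v hv hMv
      · exact absurd hMv hM

theorem validate_spec {s : State} (h : Holds G w n s) :
    (validate.run s).reg .ok ≠ 0 ↔ ValidLabels G (supp n (s.arr .M)) (s.arr .D) := by
  set X := supp n (s.arr .M) with hX
  set D := s.arr .D
  set bad : ℕ → ℕ → Prop := fun u v => u ∈ X ∧ v ∈ X ∧ G.Adj u v ∧ D u ≠ 0 ∧ D v ≠ 0 ∧
    ¬(D u = D v ∧ D u ≠ 1) with hbad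
  set Q : ℕ → ℕ → State → Prop := fun t₁ t₂ s' =>
    s'.reg .ok ≠ 0 ↔ ∀ u < n, ∀ v < n, u < t₁ ∨ u = t₁ ∧ v < t₂ → ¬ bad u v with hQ
  have h₀ : Holds G w n (s.set .ok 1) := h.set (by decide) _
  have H : Q ((s.set .ok 1).reg .n) 0 (validate.run s) := by
    refine Cmd.run_for (fun t => Q t 0) ?_ ?_
    · simp [hQ]
    · rintro t ht s₁ hf₁ hI
      have h₁ : Holds G w n (s₁.set .x t) :=
        (h₀.frame hf₁ (by decide) (by decide) (by decide) (by decide)).set (by decide) _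
      have ht : t < n := h₀.reg_n ▸ ht
      have key := Cmd.run_for (i := .y) (b := .n) (c := .when (((Exp.get .M (.var .x)).and
        (Exp.get .M (.var .y))).and ((edge .x .y).and ((Exp.get .D (.var .x)).and
        ((Exp.get .D (.var .y)).and (((Exp.get .D (.var .x)).eq (Exp.get .D (.var .y))).and
        ((Exp.get .D (.var .x)).eq 1).not).not)))) (.set .ok 0)) (s := s₁.set .x t) (Q t) hI ?_
      · rw [h₁.reg_n] at key
        refine key.trans ⟨fun h u hu v hv hlt => h u hu v hv (by omega),
          fun h u hu v hv hlt => h u hu v hv (by omega)⟩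
      · rintro t₂ ht₂ s₂ hf₂ hI₂
        rw [h₁.reg_n] at ht₂
        set s₃ := s₂.set .y t₂ with hs₃
        have h₃ : Holds G w n s₃ :=
          (h₁.frame hf₂ (by decide) (by decide) (by decide) (by decide)).set (by decide) _
        have eM : s₃.arr .M = s.arr .M := (hf₂.arr .M (by decide)).trans (hf₁.arr .M (by decide))
        have eD : s₃.arr .D = D := (hf₂.arr .D (by decide)).trans (hf₁.arr .D (by decide))
        have ex : s₃.reg .x = t := by
          rw [hs₃, St.set_reg, if_neg (by decide), hf₂.reg .x (by decide)]; simp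
        have ey : s₃.reg .y = t₂ := by simp [hs₃]
        have hc : (((Exp.get .M (.var .x)).and
            (Exp.get .M (.var .y))).and ((edge .x .y).and ((Exp.get .D (.var .x)).and
            ((Exp.get .D (.var .y)).and (((Exp.get .D (.var .x)).eq (Exp.get .D (.var .y))).and
            ((Exp.get .D (.var .x)).eq 1).not).not))) : Exp Var Arr).eval s₃ ≠ 0 ↔ bad t t₂ := by
          have a1 := h₃.edge t ht t₂ ht₂
          simp [hbad, edge, eM, eD, ex, ey, hX, mem_supp, ht, ht₂, a1]
        rw [Cmd.run_when]
        by_cases hc' : bad t t₂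
        · rw [if_pos (hc.2 hc')]
          refine iff_of_false (by simp) fun h => h t ht t₂ ht₂ (by omega) hc'
        · rw [if_neg (fun h => hc' (hc.1 h))]
          refine Iff.trans hI₂ ⟨fun h u hu v hv hlt => ?_, fun h u hu v hv hlt =>
            h u hu v hv (by omega)⟩
          rcases (by omega : (u < t ∨ u = t ∧ v < t₂) ∨ (u = t ∧ v = t₂)) with hlt | ⟨rfl, rfl⟩
          · exact h u hu v hv hlt
          · exact hc'
  rw [h₀.reg_n] at H
  refine Iff.trans H ⟨fun h u hu v hv ha h1 h2 => ?_, fun h u hu v hv _ hb =>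
    hb.2.2.2.2.2 (h u hb.1 v hb.2.1 hb.2.2.1 hb.2.2.2.1 hb.2.2.2.2.1)⟩
  by_contra hne
  have hu' := (mem_supp.1 hu).1
  exact h u hu' v (mem_supp.1 hv).1 (Or.inl hu') ⟨hu, hv, ha, h1, h2, hne⟩

theorem relax_spec {s : State} {l x : ℕ} (hl : s.reg .l = l) (hl1 : s.reg .l1 = l + 1)
    (hx : s.reg .x = x) (hw : s.arr .wt x = w x) : ∀ b ≤ l, (relax.run s).arr .kn b =
      if w x ≤ b then max (s.arr .kn b) (w x + s.arr .kn (b - w x)) else s.arr .kn b := by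
  set kn := s.arr .kn
  set new : ℕ → ℕ := fun b => if w x ≤ b then max (kn b) (w x + kn (b - w x)) else kn b with hnew
  -- the cells are treated in decreasing order, so that `x` is used only once
  set Inv : ℕ → State → Prop := fun t s' => ∀ b ≤ l, s'.arr .kn b = if l < b + t then new b else kn b
  suffices H : Inv (s.reg .l1) (relax.run s) by
    intro b hb
    rw [hl1] at H
    rw [H b hb, if_pos (by omega)]
  refine Cmd.run_for Inv (fun b hb => by rw [if_neg (by omega)]) ?_
  intro t ht s₁ hf₁ hI
  rw [hl1] at ht
  have el : s₁.reg .l = l := (hf₁.reg .l (by decide)).trans hl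
  have ex : s₁.reg .x = x := (hf₁.reg .x (by decide)).trans hx
  have ew : s₁.arr .wt x = w x := by rw [hf₁.arr .wt (by decide), hw]
  have h1 : s₁.arr .kn (l - t) = kn (l - t) := by
    rw [hI _ (by omega), if_neg (by omega)]
  have h2 : s₁.arr .kn (l - t - w x) = kn (l - t - w x) := by
    rw [hI _ (by omega), if_neg (by omega)]
  have hfin : ∀ s' : State, (∀ b ≠ l - t, s'.arr .kn b = s₁.arr .kn b) →
      s'.arr .kn (l - t) = new (l - t) → Inv (t + 1) s' := by
    intro s' k1 k2 b hb
    by_cases hbt : b = l - t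
    · rw [hbt, k2, if_pos (by omega)]
    · rw [k1 b hbt, hI b hb]
      have : l < b + t ↔ l < b + (t + 1) := by omega
      simp only [this]
  simp only [Cmd.run_seq, Cmd.run_set, Cmd.run_when]
  by_cases c1 : w x ≤ l - t
  · rw [if_pos (by simp [el, ex, ew, c1])]
    by_cases c2 : kn (l - t) < w x + kn (l - t - w x)
    · rw [if_pos (by simp [el, ex, ew, h1, h2]; omega)]
      refine hfin _ (fun b hb => ?_) ?_
      · simp [el, hb]
      · simp [el, ex, ew, h2, hnew, c1]; omega
    · rw [if_neg (by simp [el, ex, ew, h1, h2]; omega)]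
      refine hfin _ (fun b hb => rfl) ?_
      simp [h1, hnew, c1]; omega
  · rw [if_neg (by simp [el, ex, ew, c1])]
    refine hfin _ (fun b hb => rfl) ?_
    simp [h1, hnew, c1]

theorem knapsack_spec {s : State} (h : Holds G w n s) {l : ℕ} (hl : s.reg .l = l)
    (hl1 : s.reg .l1 = l + 1) (hrep : ∀ x < n, s.arr .rep x < n) :
    IsKnap w l (pool n (s.arr .rep) (supp n (s.arr .M)) (s.arr .D) (s.reg .j + 2))
      ((knapsack.run s).arr .kn l) := by
  set rep := s.arr .rep
  set X := supp n (s.arr .M)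
  set D := s.arr .D
  set j := s.reg .j
  rw [knapsack, Cmd.run_seq]
  set c₁ : Com := .for_ .s .l1 (.put .kn (.var .s) 0) with hc₁
  have hf₁ := Cmd.frame_run c₁ s
  have hz : ∀ b ≤ l, (c₁.run s).arr .kn b = 0 := by
    set Inv : ℕ → State → Prop := fun t s' => ∀ b < t, s'.arr .kn b = 0
    have H : Inv (s.reg .l1) (c₁.run s) := by
      refine Cmd.run_for Inv (by intro b hb; omega) ?_
      intro t ht s' hf hI b hb
      rcases Nat.lt_succ_iff_lt_or_eq.1 hb with hb | rfl
      · simpa [hb.ne] using hI b hb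
      · simp
    rw [hl1] at H
    exact fun b hb => H b (by omega)
  set s₁ := c₁.run s
  have h₁ : Holds G w n s₁ := h.frame hf₁ (by decide) (by decide) (by decide) (by decide)
  set P := pool n rep X D (j + 2)
  set Inv : ℕ → State → Prop := fun t s' =>
    ∀ b ≤ l, IsKnap w b (P.filter (· < t)) (s'.arr .kn b)
  have H : Inv (s₁.reg .n) ((Cmd.for_ .x .n (.when ((Exp.get .M (.get .rep (.var .x))).and
      ((Exp.get .D (.get .rep (.var .x))).eq (.var .j + 2))) relax)).run s₁) := by
    refine Cmd.run_for Inv ?_ ?_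
    · intro b hb
      rw [hz b hb]
      simpa using isKnap_empty w b
    · intro t ht s₂ hf₂ hI
      rw [h₁.reg_n] at ht
      have er : s₂.arr .rep = rep := (hf₂.arr .rep (by decide)).trans (hf₁.arr .rep (by decide))
      have eM : s₂.arr .M = s.arr .M := (hf₂.arr .M (by decide)).trans (hf₁.arr .M (by decide))
      have eD : s₂.arr .D = D := (hf₂.arr .D (by decide)).trans (hf₁.arr .D (by decide))
      have ej : s₂.reg .j = j := (hf₂.reg .j (by decide)).trans (hf₁.reg .j (by decide))
      have el : s₂.reg .l = l := ((hf₂.reg .l (by decide)).trans (hf₁.reg .l (by decide))).trans hl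
      have el1 : s₂.reg .l1 = l + 1 :=
        ((hf₂.reg .l1 (by decide)).trans (hf₁.reg .l1 (by decide))).trans hl1
      have h₂ := h₁.frame hf₂ (by decide) (by decide) (by decide) (by decide)
      have hc : ((Exp.get .M (.get .rep (.var .x))).and
          ((Exp.get .D (.get .rep (.var .x))).eq (.var .j + 2)) : Exp Var Arr).eval
          (s₂.set .x t) ≠ 0 ↔ t ∈ P := by
        simp [er, eM, eD, ej, P, X, mem_pool, mem_supp, ht, hrep t ht]
      rw [Cmd.run_when]
      by_cases hc' : t ∈ P
      · rw [if_pos (hc.2 hc')]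
        have hP : P.filter (· < t + 1) = insert t (P.filter (· < t)) := by
          ext a
          simp only [Finset.mem_filter, Finset.mem_insert]
          constructor
          · rintro ⟨h1, h2⟩
            rcases Nat.lt_succ_iff_lt_or_eq.1 h2 with h2 | h2
            · exact Or.inr ⟨h1, h2⟩
            · exact Or.inl h2
          · rintro (rfl | ⟨h1, h2⟩)
            · exact ⟨hc', by omega⟩
            · exact ⟨h1, by omega⟩
        intro b hb
        rw [hP, relax_spec (s := s₂.set .x t) (l := l) (x := t) (w := w) (by simp [el]) (by simp [el1]) (by simp)
          (h₂.wt t ht) b hb]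
        exact IsKnap.insert (by simp) (hI b hb) fun _ => hI _ (by omega)
      · rw [if_neg (fun h => hc' (hc.1 h))]
        have hP : P.filter (· < t + 1) = P.filter (· < t) := by
          refine Finset.filter_congr fun a ha => ?_
          have : a ≠ t := fun h => hc' (h ▸ ha)
          omega
        intro b hb
        rw [hP]
        exact hI b hb
  rw [h₁.reg_n] at H
  have hP : P.filter (· < n) = P := Finset.filter_true_of_mem fun a ha => (mem_pool.1 ha).1
  have := H l le_rfl
  rwa [hP] at this

theorem value_spec {s : State} (h : Holds G w n s) {l : ℕ} (hl : s.reg .l = l)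
    (hl1 : s.reg .l1 = l + 1) (hrep : ∀ x < n, s.arr .rep x < n) :
    ∃ kn : ℕ → ℕ, (∀ j < s.reg .best, IsKnap w l
      (pool n (s.arr .rep) (supp n (s.arr .M)) (s.arr .D) (j + 2)) (kn j)) ∧
      (value.run s).reg .val = ∑ v ∈ supp n (s.arr .M) with s.arr .D v = 1, s.arr .g v +
        ∑ j ∈ Finset.range (s.reg .best), kn j := by
  set rep := s.arr .rep
  set X := supp n (s.arr .M) with hX
  set D := s.arr .D
  set g := s.arr .g
  set m := s.reg .best
  have h₀ : Holds G w n (s.set .val 0) := h.set (by decide) _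
  set c₁ : Com := .for_ .x .n (.when ((Exp.get .M (.var .x)).and ((Exp.get .D (.var .x)).eq 1))
    (.set .val (.var .val + .get .g (.var .x)))) with hc₁
  have hf₁ := Cmd.frame_run c₁ (s.set .val 0)
  have hval : (c₁.run (s.set .val 0)).reg .val = ∑ v ∈ X with D v = 1, g v := by
    set Inv : ℕ → State → Prop := fun t s' =>
      s'.reg .val = ∑ v ∈ Finset.range t, if s.arr .M v ≠ 0 ∧ D v = 1 then g v else 0
    have H : Inv ((s.set .val 0).reg .n) (c₁.run (s.set .val 0)) := by
      refine Cmd.run_for Inv (by simp [Inv]) ?_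
      intro t ht s' hf hI
      have eM : s'.arr .M = s.arr .M := hf.arr .M (by decide)
      have eD : s'.arr .D = D := hf.arr .D (by decide)
      have eg : s'.arr .g = g := hf.arr .g (by decide)
      have hI : s'.reg .val = _ := hI
      simp only [Inv, Cmd.run_when, Finset.sum_range_succ, ← hI]
      by_cases hc : s.arr .M t ≠ 0 ∧ D t = 1
      · rw [if_pos (by simpa [eM, eD] using hc), if_pos hc]; simp [eg]
      · rw [if_neg (by simpa [eM, eD] using hc), if_neg hc]; simp
    rw [h₀.reg_n] at H
    refine Eq.trans H ?_
    rw [← Finset.sum_filter]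
    refine Finset.sum_congr ?_ fun _ _ => rfl
    ext a
    simp [hX, mem_supp, and_assoc]
  have hr : value.run s = (Cmd.for_ .j .best (knapsack.seq (.set .val (.var .val +
    .get .kn (.var .l))))).run (c₁.run (s.set .val 0)) := rfl
  rw [hr]
  set s₁ := c₁.run (s.set .val 0)
  have h₁ : Holds G w n s₁ := h₀.frame hf₁ (by decide) (by decide) (by decide) (by decide)
  set Inv : ℕ → State → Prop := fun t s' => ∃ kn : ℕ → ℕ,
    (∀ j < t, IsKnap w l (pool n rep X D (j + 2)) (kn j)) ∧
    s'.reg .val = ∑ v ∈ X with D v = 1, g v + ∑ j ∈ Finset.range t, kn j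
  have eb : s₁.reg .best = m := hf₁.reg .best (by decide)
  rw [← eb]
  refine Cmd.run_for Inv ⟨id, by simp, by simp [hval]⟩ ?_
  rintro t ht s₂ hf₂ ⟨kn, k1, k2⟩
  set s₃ := s₂.set .j t with hs₃
  have h₃ : Holds G w n s₃ :=
    (h₁.frame hf₂ (by decide) (by decide) (by decide) (by decide)).set (by decide) _
  have er : s₃.arr .rep = rep := (hf₂.arr .rep (by decide)).trans (hf₁.arr .rep (by decide))
  have eM : s₃.arr .M = s.arr .M := (hf₂.arr .M (by decide)).trans (hf₁.arr .M (by decide))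
  have eD : s₃.arr .D = D := (hf₂.arr .D (by decide)).trans (hf₁.arr .D (by decide))
  have el : s₃.reg .l = l := ((hf₂.reg .l (by decide)).trans (hf₁.reg .l (by decide))).trans hl
  have el1 : s₃.reg .l1 = l + 1 :=
    ((hf₂.reg .l1 (by decide)).trans (hf₁.reg .l1 (by decide))).trans hl1
  have ej : s₃.reg .j = t := by simp [hs₃]
  have key := knapsack_spec h₃ el el1 (by rw [er]; exact hrep)
  rw [er, eM, eD, ej] at key
  have hf₄ := Cmd.frame_run knapsack s₃
  refine ⟨Function.update kn t ((knapsack.run s₃).arr .kn l), fun j hj => ?_, ?_⟩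
  · rcases Nat.lt_succ_iff_lt_or_eq.1 hj with hj | rfl
    · rw [Function.update_of_ne hj.ne]; exact k1 j hj
    · rw [Function.update_self]; exact key
  · have e1 : (knapsack.run s₃).reg .val = s₂.reg .val := hf₄.reg .val (by decide)
    have e2 : (knapsack.run s₃).reg .l = l := (hf₄.reg .l (by decide)).trans el
    rw [Finset.sum_range_succ, Function.update_self, Finset.sum_congr rfl fun j hj =>
      Function.update_of_ne (Finset.mem_range.1 hj).ne _ _]
    simp [e1, e2, k2]
    ring

end WVI

/-! ### Correctness of the contraction of a module -/

theorem validLabels_congr {G : SimpleGraph ℕ} {X : Finset ℕ} {D D' : ℕ → ℕ}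
    (h : ∀ v ∈ X, D v = D' v) : ValidLabels G X D ↔ ValidLabels G X D' := by
  refine forall₂_congr fun u hu => forall₂_congr fun v hv => ?_
  rw [h u hu, h v hv]

theorem pool_congr {n : ℕ} {rep : ℕ → ℕ} {X : Finset ℕ} {D D' : ℕ → ℕ}
    (h : ∀ v ∈ X, D v = D' v) (d : ℕ) : pool n rep X D d = pool n rep X D' d := by
  rw [pool, pool, Finset.filter_congr fun v hv => by rw [h v hv]]

namespace WVI

open Imp

variable {G : SimpleGraph ℕ} {w : ℕ → ℕ} {n : ℕ}

/-- A valid labelling raises `opt` to the weight that it allows to keep, an invalid one leaves it. -/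
theorem try_spec {s : State} (h : Holds G w n s) {l : ℕ} (hl : s.reg .l = l)
    (hl1 : s.reg .l1 = l + 1) (hrep : ∀ x < n, s.arr .rep x < n) :
    ∃ D : ℕ → ℕ, (∀ v ∈ supp n (s.arr .M), D v = label (s.reg .best) (s.arr .M) (s.reg .z) v) ∧
    ∃ kn : ℕ → ℕ, (∀ j < s.reg .best,
      IsKnap w l (pool n (s.arr .rep) (supp n (s.arr .M)) D (j + 2)) (kn j)) ∧
    ∃ val, val = ∑ v ∈ supp n (s.arr .M) with D v = 1, s.arr .g v +
        ∑ j ∈ Finset.range (s.reg .best), kn j ∧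
      ((ValidLabels G (supp n (s.arr .M)) D ∧ (try_.run s).reg .opt = max (s.reg .opt) val) ∨
        (¬ValidLabels G (supp n (s.arr .M)) D ∧ (try_.run s).reg .opt = s.reg .opt)) := by
  have hd := decode_spec (s := s) rfl
  have hf₁ := Cmd.frame_run decode s
  set s₁ := decode.run s with hs₁
  have h₁ : Holds G w n s₁ := h.frame hf₁ (by decide) (by decide) (by decide) (by decide)
  have hv := validate_spec h₁
  have hf₂ := Cmd.frame_run validate s₁
  set s₂ := validate.run s₁ with hs₂
  have h₂ : Holds G w n s₂ := h₁.frame hf₂ (by decide) (by decide) (by decide) (by decide)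
  have er : s₂.arr .rep = s.arr .rep := (hf₂.arr .rep (by decide)).trans (hf₁.arr .rep (by decide))
  have eM₁ : s₁.arr .M = s.arr .M := hf₁.arr .M (by decide)
  have eM : s₂.arr .M = s.arr .M := (hf₂.arr .M (by decide)).trans eM₁
  have eg : s₂.arr .g = s.arr .g := (hf₂.arr .g (by decide)).trans (hf₁.arr .g (by decide))
  have eD : s₂.arr .D = s₁.arr .D := hf₂.arr .D (by decide)
  have eb : s₂.reg .best = s.reg .best :=
    (hf₂.reg .best (by decide)).trans (hf₁.reg .best (by decide))
  have el : s₂.reg .l = l := ((hf₂.reg .l (by decide)).trans (hf₁.reg .l (by decide))).trans hl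
  have el1 : s₂.reg .l1 = l + 1 :=
    ((hf₂.reg .l1 (by decide)).trans (hf₁.reg .l1 (by decide))).trans hl1
  obtain ⟨kn, k1, k2⟩ := value_spec h₂ el el1 (by rw [er]; exact hrep)
  have hf₃ := Cmd.frame_run value s₂
  set s₃ := value.run s₂ with hs₃
  rw [er, eM, eD, eb] at k1
  rw [eM, eD, eb, eg] at k2
  rw [eM₁] at hv
  have eok : s₃.reg .ok = s₂.reg .ok := hf₃.reg .ok (by decide)
  have eo : s₃.reg .opt = s.reg .opt := (hf₃.reg .opt (by decide)).trans
    ((hf₂.reg .opt (by decide)).trans (hf₁.reg .opt (by decide)))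
  refine ⟨s₁.arr .D, fun v hv => ?_, kn, k1, _, k2, ?_⟩
  · have := mem_supp.1 hv
    exact hd v (by rw [h.reg_n]; exact this.1) this.2
  · have hr : try_.run s = (Cmd.when (Exp.and (.var .ok) (Exp.lt (.var .opt) (.var .val)))
      (.set .opt (.var .val))).run s₃ := rfl
    rw [hr, Cmd.run_when]
    have hc : (Exp.and (.var .ok) (Exp.lt (.var .opt) (.var .val)) : Exp Var Arr).eval s₃ ≠ 0 ↔
        s₂.reg .ok ≠ 0 ∧ s.reg .opt < s₃.reg .val := by simp [eok, eo]
    by_cases hV : ValidLabels G (supp n (s.arr .M)) (s₁.arr .D)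
    · refine Or.inl ⟨hV, ?_⟩
      have hok := hv.2 hV
      by_cases hlt : s.reg .opt < s₃.reg .val
      · rw [if_pos (hc.2 ⟨hok, hlt⟩), max_eq_right hlt.le]; simp
      · rw [if_neg fun h => hlt (hc.1 h).2, max_eq_left (by omega), eo]
    · refine Or.inr ⟨hV, ?_⟩
      rw [if_neg fun h => hV (hv.1 (hc.1 h).1), eo]

/-- Every labelling with labels below `m + 2` is among those tried, because `m + 2 ≤ 2 ^ m` for a
module with `m ≥ 2` vertices. -/
theorem enumerate_spec {s : State} (h : Holds G w n s) {l : ℕ} (hl : s.reg .l = l)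
    (hl1 : s.reg .l1 = l + 1) (H : Contraction G w l n (s.arr .rep) (s.arr .g))
    (hF : Found G n (s.arr .rep) s) (hK : s.reg .K = 2 ^ (s.reg .best * s.reg .best)) :
    IsOpt G w l (cls n (s.arr .rep) (supp n (s.arr .M))) ((enumerate.run s).reg .opt) := by
  set rep := s.arr .rep with hrep
  set g := s.arr .g with hg
  set M := s.arr .M with hM
  set X := supp n M with hX
  set m := s.reg .best with hm
  have hXA := hF.isModule.1
  set Inv : ℕ → State → Prop := fun t s' =>
    (∃ T ⊆ cls n rep X, Feasible G w l T ∧ ∑ x ∈ T, w x = s'.reg .opt) ∧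
    ∀ z < t, ∀ D : ℕ → ℕ, (∀ v ∈ X, D v = label m M z v) → ValidLabels G X D →
      ∃ kn : ℕ → ℕ, (∀ j < m, IsKnap w l (pool n rep X D (j + 2)) (kn j)) ∧
        ∑ v ∈ X with D v = 1, g v + ∑ j ∈ Finset.range m, kn j ≤ s'.reg .opt with hInv
  have key : Inv (s.reg .K) (enumerate.run s) := by
    refine Cmd.run_for (s := s.set .opt 0) Inv ⟨⟨∅, by simp, ⟨fun _ => 0, by simp, fun C hC _ => by
      simp [Finset.subset_empty.1 hC]⟩, by simp⟩, by simp⟩ ?_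
    rintro t ht s₁ hf₁ ⟨⟨T, hT, hTf, hTw⟩, hI⟩
    have h₁ : Holds G w n (s₁.set .z t) := ((h.set (by decide) _).frame hf₁ (by decide) (by decide)
      (by decide) (by decide)).set (by decide) _
    have er : s₁.arr .rep = rep := hf₁.arr .rep (by decide)
    have eg : s₁.arr .g = g := hf₁.arr .g (by decide)
    have eM : s₁.arr .M = M := hf₁.arr .M (by decide)
    have eb : s₁.reg .best = m := hf₁.reg .best (by decide)
    have el : s₁.reg .l = l := (hf₁.reg .l (by decide)).trans hl
    have el1 : s₁.reg .l1 = l + 1 := (hf₁.reg .l1 (by decide)).trans hl1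
    obtain ⟨D, hD, kn, hkn, val, hval, ho⟩ := try_spec h₁ (l := l) (by simp [el]) (by simp [el1])
      (by simp only [St.set_arr, er]; exact H.rep_lt)
    simp only [St.set_arr, St.set_reg, er, eg, eM, eb, reduceCtorEq, if_true, if_false]
      at hD hkn hval ho
    have hle : s₁.reg .opt ≤ (try_.run (s₁.set .z t)).reg .opt := by
      rcases ho with ⟨-, ho⟩ | ⟨-, ho⟩ <;> rw [ho]
      exact le_max_left _ _
    refine ⟨?_, fun z hz D' hD' hV' => ?_⟩
    · rcases ho with ⟨hV, ho⟩ | ⟨-, ho⟩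
      · rw [ho]
        rcases le_total (s₁.reg .opt) val with hov | hov
        · rw [max_eq_right hov, hval]
          exact H.exists_feasible hXA hV m hkn
        · rw [max_eq_left hov]; exact ⟨T, hT, hTf, hTw⟩
      · rw [ho]; exact ⟨T, hT, hTf, hTw⟩
    · rcases Nat.lt_succ_iff_lt_or_eq.1 hz with hz | rfl
      · obtain ⟨kn', h1, h2⟩ := hI z hz D' hD' hV'
        exact ⟨kn', h1, h2.trans hle⟩
      · have hDD : ∀ v ∈ X, D v = D' v := fun v hv => (hD v hv).trans (hD' v hv).symm
        have ho := (ho.resolve_right fun h => h.1 ((validLabels_congr hDD).2 hV')).2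
        refine ⟨kn, fun j hj => pool_congr hDD _ ▸ hkn j hj, ?_⟩
        have hfilt : X.filter (D' · = 1) = X.filter (D · = 1) :=
          Finset.filter_congr fun v hv => by rw [hDD v hv]
        rw [hfilt, ← hval, ho]
        exact le_max_right _ _
  refine ⟨key.1, fun T hT hTf => ?_⟩
  obtain ⟨D, hD, hV, hle⟩ := H.exists_labels hXA hT hTf
  have hc : X.card = m := hF.card
  have h2 := hF.two_le
  have hm2 : ∀ k, 2 ≤ k → k + 2 ≤ 2 ^ k := by
    intro k hk
    induction k, hk using Nat.le_induction with
    | base => norm_num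
    | succ k hk ih => rw [pow_succ]; omega
  obtain ⟨z, hz, hzD⟩ := exists_label_eq m M D
    (fun v => (hD v).trans_le (by rw [hc]; exact hm2 m h2)) n
  have hcard : (supp n M).card = m := hc
  rw [hcard, ← hK] at hz
  obtain ⟨kn, hkn, hle'⟩ := key.2 z hz D
    (fun v hv => (hzD v (mem_supp.1 hv).1 (mem_supp.1 hv).2).symm) hV
  rw [hc] at hle
  exact (hle kn hkn).trans hle'

theorem merge_spec {s : State} (h : Holds G w n s) (hrep : ∀ x < n, s.arr .rep x < n) :
    (∀ x < n, (merge.run s).arr .rep x = if s.arr .rep x ∈ supp n (s.arr .M) then s.reg .root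
      else s.arr .rep x) ∧
    ∀ x, (merge.run s).arr .g x = if x = s.reg .root then s.reg .opt else s.arr .g x := by
  set s₁ := s.put .g (s.reg .root) (s.reg .opt) with hs₁
  have h₁ : Holds G w n s₁ :=
    ⟨h.reg_n, by simpa [s₁] using h.edge, by simpa [s₁] using h.wt⟩
  have er : s₁.arr .rep = s.arr .rep := by simp [s₁, St.put_arr]
  have eM : s₁.arr .M = s.arr .M := by simp [s₁, St.put_arr]
  have hr : merge.run s = (Cmd.for_ .x .n (.when (.get .M (.get .rep (.var .x)))
    (.put .rep (.var .x) (.var .root)))).run s₁ := rfl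
  rw [hr]
  refine ⟨?_, fun x => ?_⟩
  · set Inv : ℕ → State → Prop := fun t s' => ∀ x < n, s'.arr .rep x =
      if x < t ∧ s.arr .rep x ∈ supp n (s.arr .M) then s.reg .root else s.arr .rep x with hInv
    suffices H : Inv (s₁.reg .n) ((Cmd.for_ .x .n (.when (.get .M (.get .rep (.var .x)))
        (.put .rep (.var .x) (.var .root)))).run s₁) by
      intro x hx
      rw [H x hx, h₁.reg_n]
      simp [hx]
    refine Cmd.run_for Inv (fun x hx => by simp [er]) ?_
    intro t ht s₂ hf₂ hI x hx
    rw [h₁.reg_n] at ht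
    have eM : s₂.arr .M = s.arr .M := (hf₂.arr .M (by decide)).trans eM
    have eo : s₂.reg .root = s.reg .root := hf₂.reg .root (by decide)
    have et : s₂.arr .rep t = s.arr .rep t := by rw [hI t ht]; simp
    have hc : ((Exp.get .M (.get .rep (.var .x))) : Exp Var Arr).eval (s₂.set .x t) ≠ 0 ↔
        s.arr .rep t ∈ supp n (s.arr .M) := by
      simp [eM, et, mem_supp, hrep t ht]
    rw [Cmd.run_when]
    by_cases hxt : x = t
    · subst hxt
      by_cases hc' : s.arr .rep x ∈ supp n (s.arr .M)
      · rw [if_pos (hc.2 hc'), if_pos ⟨by omega, hc'⟩]; simp [eo]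
      · rw [if_neg (fun h => hc' (hc.1 h)), if_neg (fun h => hc' h.2)]; exact et
    · have e : x < t + 1 ↔ x < t := by omega
      rw [if_congr (and_congr_left' e) rfl rfl, ← hI x hx]
      split
      · simp [hxt]
      · rfl
  · rw [(Cmd.frame_run _ s₁).arr .g (by decide), hs₁, St.put_arr_apply]
    simp

/-- The partition held by the state is coarsened, unless it has a single class. -/
theorem step_spec {s : State} (h : Holds G w n s) {l : ℕ} (hl : s.reg .l = l)
    (hl1 : s.reg .l1 = l + 1) (H : Contraction G w l n (s.arr .rep) (s.arr .g)) :
    Contraction G w l n ((step.run s).arr .rep) ((step.run s).arr .g) ∧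
    ((alive n ((step.run s).arr .rep)).card ≤ 1 ∨
      (alive n ((step.run s).arr .rep)).card < (alive n (s.arr .rep)).card) := by
  have hfind := find_spec h
  have hf₁ := Cmd.frame_run find s
  have hr : step.run s = (Cmd.when (Exp.le (.var .best) (.var .n))
    (power.seq (enumerate.seq merge))).run (find.run s) := rfl
  rw [hr, Cmd.run_when]
  set s₁ := find.run s
  have h₁ : Holds G w n s₁ := h.frame hf₁ (by decide) (by decide) (by decide) (by decide)
  have er₁ : s₁.arr .rep = s.arr .rep := hf₁.arr .rep (by decide)
  have eg₁ : s₁.arr .g = s.arr .g := hf₁.arr .g (by decide)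
  have hc : (Exp.le (.var .best) (.var .n) : Exp Var Arr).eval s₁ ≠ 0 ↔ s₁.reg .best ≤ n := by
    simp [h₁.reg_n]
  rcases hfind with ⟨hb, hle⟩ | ⟨hF, -⟩
  · rw [if_neg (fun h => by have := hc.1 h; omega), er₁, eg₁]
    exact ⟨H, Or.inl hle⟩
  · have hbn : s₁.reg .best ≤ n := by
      rw [← hF.card]
      exact (Finset.card_le_card (Finset.filter_subset _ _)).trans (Finset.card_range n).le
    rw [if_pos (hc.2 hbn), Cmd.run_seq, Cmd.run_seq]
    have hK := power_spec s₁
    have hf₂ := Cmd.frame_run power s₁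
    set s₂ := power.run s₁
    have h₂ : Holds G w n s₂ := h₁.frame hf₂ (by decide) (by decide) (by decide) (by decide)
    have er₂ : s₂.arr .rep = s.arr .rep := (hf₂.arr .rep (by decide)).trans er₁
    have eg₂ : s₂.arr .g = s.arr .g := (hf₂.arr .g (by decide)).trans eg₁
    have eM₂ : s₂.arr .M = s₁.arr .M := hf₂.arr .M (by decide)
    have eb₂ : s₂.reg .best = s₁.reg .best := hf₂.reg .best (by decide)
    have eo₂ : s₂.reg .root = s₁.reg .root := hf₂.reg .root (by decide)
    have hF₂ : Found G n (s₂.arr .rep) s₂ := by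
      rw [er₂]
      exact ⟨by rw [eM₂]; exact hF.isModule, by rw [eM₂, eo₂]; exact hF.root,
        by rw [eM₂, eb₂]; exact hF.card, by rw [eb₂]; exact hF.two_le⟩
    have hopt := enumerate_spec h₂ (l := l)
      (((hf₂.reg .l (by decide)).trans (hf₁.reg .l (by decide))).trans hl)
      (((hf₂.reg .l1 (by decide)).trans (hf₁.reg .l1 (by decide))).trans hl1)
      (by rw [er₂, eg₂]; exact H) hF₂ (by rw [hK, eb₂])
    have hf₃ := Cmd.frame_run enumerate s₂
    set s₃ := enumerate.run s₂
    have h₃ : Holds G w n s₃ := h₂.frame hf₃ (by decide) (by decide) (by decide) (by decide)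
    have er₃ : s₃.arr .rep = s.arr .rep := (hf₃.arr .rep (by decide)).trans er₂
    have eg₃ : s₃.arr .g = s.arr .g := (hf₃.arr .g (by decide)).trans eg₂
    have eM₃ : s₃.arr .M = s₁.arr .M := (hf₃.arr .M (by decide)).trans eM₂
    have eo₃ : s₃.reg .root = s₁.reg .root := (hf₃.reg .root (by decide)).trans eo₂
    obtain ⟨m1, m2⟩ := merge_spec h₃ (by rw [er₃]; exact H.rep_lt)
    rw [er₂, eM₂] at hopt
    rw [er₃, eM₃, eo₃] at m1
    rw [eo₃, eg₃] at m2
    obtain ⟨c1, c2⟩ := H.merge hF.isModule hF.root hopt m1 fun x _ => m2 x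
    refine ⟨c1, Or.inr ?_⟩
    have := hF.two_le
    have := hF.card
    omega

theorem init_spec {s : State} (h : Holds G w n s) :
    (init.run s).reg .l1 = s.reg .l + 1 ∧
      Contraction G w (s.reg .l) n ((init.run s).arr .rep) ((init.run s).arr .g) := by
  set s₁ := s.set .l1 (s.reg .l + 1) with hs₁
  have h₁ : Holds G w n s₁ := h.set (by decide) _
  set c : Com := .for_ .v .n (.seq (.put .rep (.var .v) (.var .v))
    (.ite (Exp.le (.get .wt (.var .v)) (.var .l)) (.put .g (.var .v) (.get .wt (.var .v)))
      (.put .g (.var .v) 0))) with hc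
  have hr : init.run s = c.run s₁ := rfl
  rw [hr]
  refine ⟨((Cmd.frame_run c s₁).reg .l1 (by decide)).trans (by simp [s₁]), ?_⟩
  set Inv : ℕ → State → Prop := fun t s' => ∀ v < t, s'.arr .rep v = v ∧
    s'.arr .g v = if w v ≤ s.reg .l then w v else 0
  have H : Inv (s₁.reg .n) (c.run s₁) := by
    refine Cmd.run_for Inv (fun v hv => by omega) ?_
    intro t ht s₂ hf₂ hI v hv
    have el : s₂.reg .l = s.reg .l := hf₂.reg .l (by decide)
    have ew : s₂.arr .wt t = w t := by
      rw [hf₂.arr .wt (by decide)]; exact h.wt t (h₁.reg_n ▸ ht)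
    rw [Cmd.run_seq, Cmd.run_ite]
    rcases Nat.lt_succ_iff_lt_or_eq.1 hv with hv | rfl
    · have := hI v hv
      split <;> simpa [hv.ne] using this
    · by_cases hw : w v ≤ s.reg .l
      · rw [if_pos (by simp [el, ew, hw])]; simp [ew, hw]
      · rw [if_neg (by simp [el, ew, hw])]; simp [hw]
  rw [h₁.reg_n] at H
  exact .init _ _ _ _ (fun v hv => (H v hv).1) fun v hv => (H v hv).2

/-- When all modules are contracted, a single vertex represents the whole graph. -/
theorem Contraction.isOpt {G : SimpleGraph ℕ} {w : ℕ → ℕ} {l n : ℕ} {rep g : ℕ → ℕ}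
    (H : Contraction G w l n rep g) (hn : 0 < n) (h : (alive n rep).card ≤ 1) :
    IsOpt G w l (Finset.range n) (g (rep 0)) := by
  have ha : ∀ x < n, rep x ∈ alive n rep := fun x hx =>
    mem_alive.2 ⟨H.rep_lt x hx, H.idem x hx⟩
  have : cls n rep {rep 0} = Finset.range n := by
    ext x
    rw [mem_cls, Finset.mem_singleton, Finset.mem_range]
    exact ⟨fun h => h.1, fun hx => ⟨hx, Finset.card_le_one.1 h _ (ha x hx) _ (ha 0 hn)⟩⟩
  rw [← this]
  exact H.opt _ (ha 0 hn)

theorem round_spec {s : State} (h : Holds G w n s) (hn : 0 < n) :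
    ∃ v, IsOpt G w (s.reg .l) (Finset.range n) v ∧ (round.run s).reg .ans =
      if s.reg .l + s.reg .W ≤ s.reg .kk + v then 1 else s.reg .ans := by
  set l := s.reg .l with hl
  obtain ⟨i1, i2⟩ := init_spec h
  have hf₁ := Cmd.frame_run init s
  have hr : round.run s = (Cmd.when (Exp.le (.var .l + .var .W) (.var .kk + .get .g (.get .rep 0)))
    (.set .ans 1)).run ((Cmd.for_ .k .n step).run (init.run s)) := rfl
  rw [hr, Cmd.run_when]
  set s₁ := init.run s
  have h₁ : Holds G w n s₁ := h.frame hf₁ (by decide) (by decide) (by decide) (by decide)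
  have el₁ : s₁.reg .l = l := hf₁.reg .l (by decide)
  set Inv : ℕ → State → Prop := fun t s' => Contraction G w l n (s'.arr .rep) (s'.arr .g) ∧
    ((alive n (s'.arr .rep)).card ≤ 1 ∨ (alive n (s'.arr .rep)).card + t ≤ n)
  have H : Inv (s₁.reg .n) ((Cmd.for_ .k .n step).run s₁) := by
    refine Cmd.run_for Inv ⟨i2, Or.inr ?_⟩ ?_
    · exact (Finset.card_le_card (Finset.filter_subset _ _)).trans (Finset.card_range n).le
    · rintro t ht s₂ hf₂ ⟨hC, hI⟩
      have h₂ : Holds G w n (s₂.set .k t) :=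
        (h₁.frame hf₂ (by decide) (by decide) (by decide) (by decide)).set (by decide) _
      have el : s₂.reg .l = l := (hf₂.reg .l (by decide)).trans el₁
      have el1 : s₂.reg .l1 = l + 1 := (hf₂.reg .l1 (by decide)).trans i1
      obtain ⟨k1, k2⟩ := step_spec h₂ (l := l) (by simp [el]) (by simp [el1]) hC
      refine ⟨k1, k2.imp_right fun k2 => ?_⟩
      rw [St.set_arr] at k2
      have := h₁.reg_n
      omega
  rw [h₁.reg_n] at H
  have hf₂ := Cmd.frame_run (Cmd.for_ .k .n step) s₁
  set s₂ := (Cmd.for_ .k .n step).run s₁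
  have h1 : (alive n (s₂.arr .rep)).card ≤ 1 := by
    rcases H.2 with h | h <;> omega
  refine ⟨_, Contraction.isOpt H.1 hn h1, ?_⟩
  have el : s₂.reg .l = l := (hf₂.reg .l (by decide)).trans el₁
  have eW : s₂.reg .W = s.reg .W := (hf₂.reg .W (by decide)).trans (hf₁.reg .W (by decide))
  have ek : s₂.reg .kk = s.reg .kk := (hf₂.reg .kk (by decide)).trans (hf₁.reg .kk (by decide))
  have ea : s₂.reg .ans = s.reg .ans := (hf₂.reg .ans (by decide)).trans (hf₁.reg .ans (by decide))
  have hc : (Exp.le (.var .l + .var .W) (.var .kk + .get .g (.get .rep 0)) : Exp Var Arr).eval s₂ ≠ 0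
      ↔ l + s.reg .W ≤ s.reg .kk + s₂.arr .g (s₂.arr .rep 0) := by
    simp [el, eW, ek]
  by_cases hc' : l + s.reg .W ≤ s.reg .kk + s₂.arr .g (s₂.arr .rep 0)
  · rw [if_pos (hc.2 hc'), if_pos hc']; simp
  · rw [if_neg (fun h => hc' (hc.1 h)), if_neg hc', ea]

/-! ### Running time -/

/-- A bound on the constant factor of the running time of `step`. -/
def stepConst : ℕ := find.size + power.size + try_.size + merge.size + 30

/-- A bound on the constant factor of the running time of `round`. -/
def roundConst : ℕ := init.size + stepConst + 30

theorem cost_le_of_depth {c : Com} (hc : c.Stable) {s : State} {B d F : ℕ} (hB : 1 ≤ B)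
    (hF : 1 ≤ F) (hd : c.depth ≤ d) (hs : ∀ b ∈ c.bounds, s.reg b ≤ B) :
    c.cost s ≤ c.size * (B ^ d * F) := by
  refine (Cmd.cost_le hc hB hs).trans (Nat.mul_le_mul_left _ ?_)
  calc B ^ c.depth ≤ B ^ d := Nat.pow_le_pow_right hB hd
    _ ≤ _ := Nat.le_mul_of_pos_right _ hF

/-- The modules found have at most `k` vertices, so `2 ^ (k * k)` bounds the number of labellings
tried. -/
theorem step_cost {s : State} (h : Holds G w n s) {k B : ℕ} (hB : n + 1 ≤ B)
    (hl : s.reg .l1 ≤ B) (hk : ∀ A ⊆ Finset.range n, 2 ≤ A.card →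
      ∃ X, IsModule G A X ∧ 2 ≤ X.card ∧ X.card ≤ k) :
    step.cost s ≤ stepConst * (B ^ 5 * 2 ^ (k * k)) := by
  set P := B ^ 5 * 2 ^ (k * k) with hP
  have hB1 : 1 ≤ B := by omega
  have hF1 : 1 ≤ 2 ^ (k * k) := Nat.one_le_two_pow
  have hP1 : 1 ≤ P := Nat.mul_pos (Nat.pow_pos hB1) hF1
  have hfind := find_spec h
  have hf₁ := Cmd.frame_run find s
  have c₁ : find.cost s ≤ find.size * P := cost_le_of_depth (by decide) hB1 hF1 (by decide) (by
    intro b hb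
    have : b = .n := by revert b; decide
    subst this
    rw [h.reg_n]; omega)
  have hr : step.cost s = find.cost s + ((Exp.le (.var .best) (.var .n) : Exp Var Arr).cost +
    ((if (Exp.le (.var .best) (.var .n) : Exp Var Arr).eval (find.run s) ≠ 0 then
      (power.cost (find.run s) + (enumerate.cost (power.run (find.run s)) +
        merge.cost (enumerate.run (power.run (find.run s))))) else 1) + 1)) := rfl
  have he : (Exp.le (.var .best) (.var .n) : Exp Var Arr).cost = 5 := rfl
  rw [hr, he]
  set s₁ := find.run s
  have h₁ : Holds G w n s₁ := h.frame hf₁ (by decide) (by decide) (by decide) (by decide)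
  have hc : (Exp.le (.var .best) (.var .n) : Exp Var Arr).eval s₁ ≠ 0 ↔ s₁.reg .best ≤ n := by
    simp [h₁.reg_n]
  rcases hfind with ⟨hb, hle⟩ | ⟨hF, hmin⟩
  · rw [if_neg (fun h => by have := hc.1 h; omega), stepConst]
    have : 30 * 1 ≤ 30 * P := Nat.mul_le_mul_left _ hP1
    nlinarith
  · have hbn : s₁.reg .best ≤ n := by
      rw [← hF.card]
      exact (Finset.card_le_card (Finset.filter_subset _ _)).trans (Finset.card_range n).le
    have hbk : s₁.reg .best ≤ k := by
      obtain ⟨X, h1, h2, h3⟩ := hk _ (Finset.filter_subset _ _ : alive n (s.arr .rep) ⊆ _) (by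
        show 2 ≤ (alive n (s.arr .rep)).card
        have := Finset.card_le_card hF.isModule.1
        have := hF.card
        have := hF.two_le
        omega)
      exact (hmin X h1 h2).trans h3
    rw [if_pos (hc.2 hbn)]
    have hK := power_spec s₁
    have hf₂ := Cmd.frame_run power s₁
    have c₂ : power.cost s₁ ≤ power.size * P := cost_le_of_depth (by decide) hB1 hF1 (by decide) (by
      intro b hb
      have : b = .best := by revert b; decide
      subst this
      omega)
    set s₂ := power.run s₁
    have h₂ : Holds G w n s₂ := h₁.frame hf₂ (by decide) (by decide) (by decide) (by decide)
    have eb₂ : s₂.reg .best = s₁.reg .best := hf₂.reg .best (by decide)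
    have el₂ : s₂.reg .l1 = s.reg .l1 :=
      (hf₂.reg .l1 (by decide)).trans (hf₁.reg .l1 (by decide))
    have hf₃ := Cmd.frame_run enumerate s₂
    have c₃ : enumerate.cost s₂ ≤ (try_.size + 20) * P := by
      have hr : enumerate.cost s₂ = 2 + (Cmd.for_ .z .K try_).cost (s₂.set .opt 0) := rfl
      have hstep := Cmd.cost_for_le (i := .z) (b := .K) (c := try_) (s := s₂.set .opt 0)
        (fun _ _ => True) (try_.size * (B ^ 5 * 1)) trivial fun t ht s' hf' _ => ⟨trivial,
          cost_le_of_depth (by decide) hB1 le_rfl (by decide) (by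
            intro b hb
            have e1 : s'.reg .n = n := (hf'.reg .n (by decide)).trans h₂.reg_n
            have e2 : s'.reg .best = s₁.reg .best := (hf'.reg .best (by decide)).trans eb₂
            have e3 : s'.reg .l1 = s.reg .l1 := (hf'.reg .l1 (by decide)).trans el₂
            have : b = .n ∨ b = .best ∨ b = .l1 := by revert b; decide
            rcases this with rfl | rfl | rfl
            · simp [e1]; omega
            · simp [e2]; omega
            · simp [e3]; omega)⟩
      have e : (s₂.set .opt 0).reg .K = 2 ^ (s₁.reg .best * s₁.reg .best) := hK
      rw [e] at hstep
      rw [hr]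
      have hle : 2 ^ (s₁.reg .best * s₁.reg .best) ≤ 2 ^ (k * k) :=
        Nat.pow_le_pow_right (by omega) (Nat.mul_le_mul hbk hbk)
      calc _ ≤ 2 + (3 + 2 ^ (s₁.reg .best * s₁.reg .best) * (try_.size * (B ^ 5 * 1) + 5)) := by
            omega
        _ ≤ 2 + (3 + 2 ^ (k * k) * (try_.size * (B ^ 5 * 1) + 5)) := by gcongr
        _ = try_.size * P + 5 * 1 + 5 * (1 * 2 ^ (k * k)) := by rw [hP]; ring
        _ ≤ try_.size * P + 5 * P + 5 * P := by
            gcongr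
            exact Nat.mul_le_mul_right _ (Nat.one_le_pow _ _ hB1)
        _ ≤ _ := by rw [add_mul]; omega
    set s₃ := enumerate.run s₂
    have h₃ : Holds G w n s₃ := h₂.frame hf₃ (by decide) (by decide) (by decide) (by decide)
    have c₄ : merge.cost s₃ ≤ merge.size * P := cost_le_of_depth (by decide) hB1 hF1 (by decide) (by
      intro b hb
      have : b = .n := by revert b; decide
      subst this
      rw [h₃.reg_n]; omega)
    have h10 : 10 * 1 ≤ 10 * P := Nat.mul_le_mul_left _ hP1
    calc _ ≤ find.size * P + (5 + (power.size * P + ((try_.size + 20) * P + merge.size * P) + 1)) :=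
          by omega
      _ ≤ find.size * P + power.size * P + (try_.size + 20) * P + merge.size * P + 10 * P := by omega
      _ = _ := by rw [stepConst]; ring

theorem round_cost {s : State} (h : Holds G w n s) {k B : ℕ} (hB : n + 1 ≤ B)
    (hl : s.reg .l + 1 ≤ B) (hk : ∀ A ⊆ Finset.range n, 2 ≤ A.card →
      ∃ X, IsModule G A X ∧ 2 ≤ X.card ∧ X.card ≤ k) :
    round.cost s ≤ roundConst * (B ^ 6 * 2 ^ (k * k)) := by
  set P := B ^ 6 * 2 ^ (k * k) with hP
  have hB1 : 1 ≤ B := by omega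
  have hF1 : 1 ≤ 2 ^ (k * k) := Nat.one_le_two_pow
  have hP1 : 1 ≤ P := Nat.mul_pos (Nat.pow_pos hB1) hF1
  have hBP : B ≤ P := (Nat.le_self_pow (by omega) B).trans (Nat.le_mul_of_pos_right _ hF1)
  obtain ⟨i1, -⟩ := init_spec h
  have hf₁ := Cmd.frame_run init s
  have c₁ : init.cost s ≤ init.size * P := cost_le_of_depth (by decide) hB1 hF1 (by decide) (by
    intro b hb
    have : b = .n := by revert b; decide
    subst this
    rw [h.reg_n]; omega)
  set s₁ := init.run s
  have h₁ : Holds G w n s₁ := h.frame hf₁ (by decide) (by decide) (by decide) (by decide)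
  have c₂ := Cmd.cost_for_le (i := .k) (b := .n) (c := step) (s := s₁) (fun _ _ => True)
    (stepConst * (B ^ 5 * 2 ^ (k * k))) trivial fun t ht s' hf' _ => ⟨trivial, by
      refine step_cost (G := G) (w := w) (n := n)
        ((h₁.frame hf' (by decide) (by decide) (by decide) (by decide)).set (by decide) _) hB ?_ hk
      have : s'.reg .l1 = s.reg .l + 1 := (hf'.reg .l1 (by decide)).trans i1
      simp [this, hl]⟩
  rw [h₁.reg_n] at c₂
  have hr : ∀ s₂, (Cmd.when (Exp.le (.var .l + .var .W) (.var .kk + .get .g (.get .rep 0)))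
      (.set .ans 1) : Com).cost s₂ ≤ 20 := by
    intro s₂
    show 11 + ((if (Exp.le (.var .l + .var .W) (.var .kk + .get .g (.get .rep 0)) :
      Exp Var Arr).eval s₂ ≠ 0 then 2 else 1) + 1) ≤ 20
    split <;> omega
  have hr' : round.cost s = init.cost s + ((Cmd.for_ .k .n step).cost s₁ +
    (Cmd.when (Exp.le (.var .l + .var .W) (.var .kk + .get .g (.get .rep 0)))
      (.set .ans 1) : Com).cost ((Cmd.for_ .k .n step).run s₁)) := rfl
  rw [hr']
  have := hr ((Cmd.for_ .k .n step).run s₁)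
  calc _ ≤ init.size * P + (3 + n * (stepConst * (B ^ 5 * 2 ^ (k * k)) + 5) + 20) := by omega
    _ ≤ init.size * P + (3 + B * (stepConst * (B ^ 5 * 2 ^ (k * k)) + 5) + 20) := by
        gcongr; omega
    _ = init.size * P + stepConst * P + 23 * 1 + 5 * B := by rw [hP]; ring
    _ ≤ init.size * P + stepConst * P + 23 * P + 5 * P := by gcongr
    _ ≤ _ := by rw [roundConst, add_mul, add_mul]; omega

end WVI

/-! ### The encoding of instances -/

/-- The cells of the array `f` from position `p` on hold the symbols of `l`. -/
def Reads (f : ℕ → ℕ) (p : ℕ) (l : List Bool) : Prop :=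
  ∀ i < l.length, f (p + i) = (l.getD i false).toNat

theorem Reads.append {f : ℕ → ℕ} {p : ℕ} {l l' : List Bool} (h : Reads f p (l ++ l')) :
    Reads f p l ∧ Reads f (p + l.length) l' := by
  refine ⟨fun i hi => ?_, fun i hi => ?_⟩
  · rw [h i (by simp; omega), List.getD_append _ _ _ _ hi]
  · rw [add_assoc, h _ (by simp; omega), List.getD_append_right _ _ _ _ (by omega)]
    simp

theorem Reads.flatMap {α : Type*} {f : ℕ → ℕ} {g : α → List Bool} {len : ℕ → ℕ} (L : List α) :
    ∀ {p : ℕ}, Reads f p (L.flatMap g) → (∀ (i : ℕ) (hi : i < L.length), (g L[i]).length = len i) →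
      ∀ (i : ℕ) (hi : i < L.length), Reads f (p + ∑ u ∈ Finset.range i, len u) (g L[i]) := by
  induction L generalizing len with
  | nil => intro p _ _ i hi; simp at hi
  | cons a L ih =>
    intro p h hl i hi
    rw [List.flatMap_cons] at h
    obtain ⟨h1, h2⟩ := h.append
    have h0 : (g a).length = len 0 := hl 0 (by simp)
    cases i with
    | zero => simpa using h1
    | succ i =>
      rw [h0] at h2
      have := ih (len := fun i => len (i + 1)) h2 (fun i hi => hl (i + 1) (by simpa using hi)) i
        (by simpa using hi)
      rw [Finset.sum_range_succ', add_comm (∑ u ∈ _, _), ← add_assoc]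
      exact this

theorem Reads.unaryCode {f : ℕ → ℕ} {p m : ℕ} (h : Reads f p (unaryCode m)) :
    (∀ i < m, f (p + i) ≠ 0) ∧ f (p + m) = 0 := by
  obtain ⟨h1, h2⟩ := Reads.append h
  refine ⟨fun i hi => ?_, ?_⟩
  · rw [h1 i (by simpa using hi)]
    simp [List.getD_eq_getElem?_getD, hi]
  · simpa using h2 0 (by simp)

theorem length_flatMap_finRange {n : ℕ} (g : Fin n → List Bool) (len : ℕ → ℕ)
    (h : ∀ v : Fin n, (g v).length = len v) :
    ((List.finRange n).flatMap g).length = ∑ v ∈ Finset.range n, len v := by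
  rw [List.length_flatMap, Finset.sum_range, ← List.sum_ofFn, List.ofFn_eq_map]
  simp [h]

theorem sum_testBit (m M : ℕ) : ∑ i ∈ Finset.range M, (m.testBit i).toNat * 2 ^ i = m % 2 ^ M := by
  induction M with
  | zero => simp [Nat.mod_one]
  | succ M ih => rw [Finset.sum_range_succ, ih, Nat.mod_pow_succ, Nat.toNat_testBit, mul_comm]

theorem sum_bits {m M : ℕ} (h : m.bits.length ≤ M) :
    ∑ i ∈ Finset.range M, (m.bits.getD i false).toNat * 2 ^ i = m := by
  have h1 : ∀ i, m.bits.getD i false = m.testBit i := by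
    intro i; rw [Nat.testBit_eq_inth]; rfl
  simp only [h1, sum_testBit]
  refine Nat.mod_eq_of_lt ((Nat.lt_size_self m).trans_le (Nat.pow_le_pow_right (by omega) ?_))
  rwa [← Nat.size_eq_bits_len]

/-- The graph of an instance, on the natural numbers. -/
abbrev WVIInstance.graph (I : WVIInstance) : SimpleGraph ℕ := I.G.map Fin.valEmbedding

theorem WVIInstance.graph_adj (I : WVIInstance) {u v : ℕ} (hu : u < I.n) (hv : v < I.n) :
    I.graph.Adj u v ↔ I.G.Adj ⟨u, hu⟩ ⟨v, hv⟩ :=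
  SimpleGraph.map_adj_apply (f := Fin.valEmbedding) (a := ⟨u, hu⟩) (b := ⟨v, hv⟩)

open Classical in
/-- Where to find the parts of an instance in its encoding. -/
structure Layout (I : WVIInstance) (N : ℕ) (f : ℕ → ℕ) (e : ℕ) : Prop where
  n_unary : Reads f 0 (unaryCode I.n)
  adj : ∀ u < I.n, ∀ v < I.n, f (I.n + 1 + u * I.n + v) = if I.graph.Adj u v then 1 else 0
  wt : ∀ v < I.n, Reads f (I.n + 1 + I.n * I.n +
    ∑ u ∈ Finset.range v, (extendWeight I.w u + 1)) (unaryCode (extendWeight I.w v))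
  e_eq : e = I.n + 1 + I.n * I.n + ∑ u ∈ Finset.range I.n, (extendWeight I.w u + 1)
  sign : f e = if I.k < 0 then 1 else 0
  bits : ∀ i, f (e + 1 + i) = (I.k.natAbs.bits.getD i false).toNat
  length : N = e + 1 + I.k.natAbs.bits.length

theorem layout (I : WVIInstance) :
    ∃ e, Layout I I.encodeUnary.length (fun i => (I.encodeUnary.getD i false).toNat) e := by
  classical
  set f : ℕ → ℕ := fun i => (I.encodeUnary.getD i false).toNat with hf
  have h : Reads f 0 I.encodeUnary := fun i _ => by simp [hf]
  have hu : ∀ m, (unaryCode m).length = m + 1 := fun m => by simp [unaryCode]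
  set rows := (List.finRange I.n).flatMap fun u => (List.finRange I.n).map fun v =>
    decide (I.G.Adj u v) with hrows
  set wts := (List.finRange I.n).flatMap fun v => unaryCode (I.w v) with hwts
  have hext : ∀ v : Fin I.n, extendWeight I.w v = I.w v := fun v => by simp [extendWeight]
  have hlr : rows.length = I.n * I.n := by
    rw [length_flatMap_finRange _ (fun _ => I.n) (by simp)]; simp
  have hlw : wts.length = ∑ u ∈ Finset.range I.n, (extendWeight I.w u + 1) :=
    length_flatMap_finRange _ _ fun v => by rw [hu, hext]
  have henc : I.encodeUnary = unaryCode I.n ++ rows ++ wts ++ [decide (I.k < 0)] ++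
      I.k.natAbs.bits := by
    simp only [WVIInstance.encodeUnary, hrows, hwts]
  set e := I.n + 1 + I.n * I.n + ∑ u ∈ Finset.range I.n, (extendWeight I.w u + 1) with he
  have hlen : (unaryCode I.n ++ rows ++ wts ++ [decide (I.k < 0)]).length = e + 1 := by
    simp only [List.length_append, hu, hlr, hlw, List.length_singleton, he]
  have h' := h
  rw [henc] at h'
  obtain ⟨h', -⟩ := h'.append
  obtain ⟨h', h4⟩ := h'.append
  obtain ⟨h', h3⟩ := h'.append
  obtain ⟨h1, h2⟩ := h'.append
  simp only [List.length_append, hu, hlr, hlw, zero_add] at h2 h3 h4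
  refine ⟨e, h1, fun u hun v hvn => ?_, fun v hvn => ?_, rfl, ?_, fun i => ?_, ?_⟩
  · have := h2.flatMap (len := fun _ => I.n) (List.finRange I.n) (by simp) u (by simpa using hun) v
      (by simpa using hvn)
    simp only [Finset.sum_const, Finset.card_range, smul_eq_mul] at this
    rw [this]
    have hiff := I.graph_adj hun hvn
    by_cases hA : I.graph.Adj u v
    · rw [if_pos hA]; simp [List.getD_eq_getElem?_getD, hvn, hiff.1 hA]
    · rw [if_neg hA]; simpa [List.getD_eq_getElem?_getD, hvn] using fun h => hA (hiff.2 h)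
  · have := h3.flatMap (len := fun u => extendWeight I.w u + 1) (List.finRange I.n)
      (fun i hi => by rw [hu]; simp [← hext]) v (by simpa using hvn)
    have e1 : extendWeight I.w v = I.w ⟨v, hvn⟩ := hext ⟨v, hvn⟩
    rw [e1]
    simpa using this
  · have := h4 0 (by simp)
    simp only [add_zero] at this
    rw [he, this]
    simp [Bool.toNat, Bool.cond_decide]
  · simp only [hf]
    rw [henc, List.getD_append_right _ _ _ _ (by omega), hlen]
    simp
  · rw [henc, List.length_append, hlen]

namespace WVI

open Imp

/-! ### Reading the input -/

theorem scan_spec {s : State} {m : ℕ} (hm : m < s.reg .len)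
    (h : Reads (s.arr .inp) (s.reg .p) (unaryCode m)) :
    (scan.run s).reg .c = m ∧ (scan.run s).reg .p = s.reg .p + m + 1 := by
  obtain ⟨h1, h0⟩ := h.unaryCode
  set p := s.reg .p with hp
  set f := s.arr .inp with hf
  set Inv : ℕ → State → Prop := fun t s' =>
    (t ≤ m → s'.reg .go = 1 ∧ s'.reg .c = t ∧ s'.reg .p = p + t) ∧
    (m < t → s'.reg .go = 0 ∧ s'.reg .c = m ∧ s'.reg .p = p + m + 1)
  suffices H : Inv (s.reg .len) (scan.run s) from ⟨(H.2 hm).2.1, (H.2 hm).2.2⟩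
  show Inv (((s.set .c 0).set .go 1).reg .len) _
  refine Cmd.run_for Inv ⟨fun _ => by simp [p], fun h => by omega⟩ ?_
  rintro t ht s' hf' ⟨i1, i2⟩
  have ei : s'.arr .inp = f := hf'.arr .inp (by decide)
  simp only [Cmd.run_when]
  rcases lt_trichotomy t m with hlt | rfl | hlt
  · obtain ⟨a1, a2, a3⟩ := i1 hlt.le
    rw [if_pos (by simp [a1]), Cmd.run_seq, Cmd.run_ite, if_pos (by simp [ei, a3, h1 t hlt])]
    exact ⟨fun _ => by simp [a1, a2, a3, add_assoc], fun h => by omega⟩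
  · obtain ⟨a1, a2, a3⟩ := i1 le_rfl
    rw [if_pos (by simp [a1]), Cmd.run_seq, Cmd.run_ite, if_neg (by simp [ei, a3, h0])]
    exact ⟨fun h => by omega, fun _ => by simp [a2, a3]⟩
  · obtain ⟨a1, a2, a3⟩ := i2 hlt
    rw [if_neg (by simp [a1])]
    exact ⟨fun h => by omega, fun _ => by simp [a1, a2, a3]⟩

variable {I : WVIInstance} {N e : ℕ}

theorem parse_spec {s : State} (h : Layout I N (s.arr .inp) e) (hN : s.reg .len = N)
    (hn : s.reg .n = I.n) (hp : s.reg .p = I.n + 1) :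
    Holds I.graph (extendWeight I.w) I.n (parse.run s) ∧
    (parse.run s).reg .W = ∑ x ∈ Finset.range I.n, extendWeight I.w x ∧
    ((parse.run s).reg .sign ≠ 0 ↔ I.k < 0) ∧ (parse.run s).reg .kk = I.k.natAbs := by
  classical
  set f := s.arr .inp with hf
  set w := extendWeight I.w with hw
  set n := I.n
  have hlt : ∀ v < n, w v < N := by
    intro v hv
    have := Finset.single_le_sum (f := fun u => w u + 1) (fun _ _ => Nat.zero_le _)
      (Finset.mem_range.2 hv)
    have h1 : e = n + 1 + n * n + ∑ u ∈ Finset.range n, (w u + 1) := h.e_eq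
    have h2 := h.length
    omega
  -- the positions of the rows
  set c₁ : Com := .for_ .u .n ((Cmd.put .R (.var .u) (.var .p)).seq
    (.set .p (.var .p + .var .n))) with hc₁
  have hf₁ := Cmd.frame_run c₁ s
  have r₁ : (c₁.run s).reg .p = n + 1 + n * n ∧ ∀ u < n, (c₁.run s).arr .R u = n + 1 + u * n := by
    set Inv : ℕ → State → Prop := fun t s' => s'.reg .p = n + 1 + t * n ∧
      ∀ u < t, s'.arr .R u = n + 1 + u * n
    suffices H : Inv (s.reg .n) (c₁.run s) by rw [hn] at H; exact H
    refine Cmd.run_for Inv ⟨by simp [hp], fun u hu => by omega⟩ ?_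
    rintro t ht s' hf' ⟨i1, i2⟩
    have en : s'.reg .n = n := (hf'.reg .n (by decide)).trans hn
    refine ⟨by simp [i1, en]; ring, fun u hu => ?_⟩
    rcases Nat.lt_succ_iff_lt_or_eq.1 hu with hu | rfl
    · simpa [hu.ne] using i2 u hu
    · simp [i1]
  set s₁ := c₁.run s
  -- the weights
  set c₂ : Com := .for_ .v .n (scan.seq ((Cmd.put .wt (.var .v) (.var .c)).seq
    (.set .W (.var .W + .var .c)))) with hc₂
  have hf₂ := Cmd.frame_run c₂ (s₁.set .W 0)
  have r₂ : (c₂.run (s₁.set .W 0)).reg .p = e ∧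
      (c₂.run (s₁.set .W 0)).reg .W = ∑ x ∈ Finset.range n, w x ∧
      ∀ v < n, (c₂.run (s₁.set .W 0)).arr .wt v = w v := by
    set Inv : ℕ → State → Prop := fun t s' =>
      s'.reg .p = n + 1 + n * n + ∑ x ∈ Finset.range t, (w x + 1) ∧
      s'.reg .W = ∑ x ∈ Finset.range t, w x ∧ ∀ v < t, s'.arr .wt v = w v
    have en : (s₁.set .W 0).reg .n = n := (hf₁.reg .n (by decide)).trans hn
    rw [h.e_eq]
    suffices H : Inv ((s₁.set .W 0).reg .n) (c₂.run (s₁.set .W 0)) by rw [en] at H; exact H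
    refine Cmd.run_for Inv ⟨by simp [r₁.1], by simp, fun v hv => by omega⟩ ?_
    rintro t ht s' hf' ⟨i1, i2, i3⟩
    rw [en] at ht
    have ei : s'.arr .inp = f := (hf'.arr .inp (by decide)).trans (hf₁.arr .inp (by decide))
    have el : s'.reg .len = N :=
      ((hf'.reg .len (by decide)).trans (hf₁.reg .len (by decide))).trans hN
    obtain ⟨k1, k2⟩ := scan_spec (s := s'.set .v t) (m := w t) (by simpa [el] using hlt t ht)
      (by simpa [ei, i1] using h.wt t ht)
    have hf₃ := Cmd.frame_run scan (s'.set .v t)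
    rw [Cmd.run_seq]
    set s₃ := scan.run (s'.set .v t)
    have ev : s₃.reg .v = t := (hf₃.reg .v (by decide)).trans (by simp)
    have eW : s₃.reg .W = s'.reg .W := hf₃.reg .W (by decide)
    have ew : s₃.arr .wt = s'.arr .wt := hf₃.arr .wt (by decide)
    simp only [St.set_reg, reduceCtorEq, if_false, i1] at k2
    refine ⟨?_, ?_, fun v hv => ?_⟩
    · simp [k2, Finset.sum_range_succ, add_assoc]
    · simp [k1, eW, i2, Finset.sum_range_succ]
    · rcases Nat.lt_succ_iff_lt_or_eq.1 hv with hv | rfl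
      · simpa [ev, hv.ne, ew] using i3 v hv
      · simp [ev, k1]
  set s₂ := c₂.run (s₁.set .W 0)
  have ei₂ : s₂.arr .inp = f := (hf₂.arr .inp (by decide)).trans (hf₁.arr .inp (by decide))
  -- the sign and the absolute value of the bound
  set s₃ := (((s₂.set .sign (f e)).set .p (e + 1)).set .kk 0).set .pw 1 with hs₃
  set c₄ : Com := .for_ .i .len ((Cmd.when (.get .inp (.var .p)) (.set .kk (.var .kk + .var .pw))).seq
    ((Cmd.set .pw (.var .pw + .var .pw)).seq (.set .p (.var .p + 1)))) with hc₄
  have hr : parse.run s = c₄.run s₃ := by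
    have : parse.run s = c₄.run ((((s₂.set .sign (s₂.arr .inp (s₂.reg .p))).set .p
      (s₂.reg .p + 1)).set .kk 0).set .pw 1) := rfl
    rw [this, ei₂, r₂.1]
  have hf₄ := Cmd.frame_run c₄ s₃
  have hf : ∀ i, f (e + 1 + i) = 1 ∨ f (e + 1 + i) = 0 := by
    intro i
    rw [h.bits i]
    cases I.k.natAbs.bits.getD i false <;> simp
  have r₄ : (c₄.run s₃).reg .kk = ∑ i ∈ Finset.range N, f (e + 1 + i) * 2 ^ i := by
    set Inv : ℕ → State → Prop := fun t s' => s'.reg .p = e + 1 + t ∧ s'.reg .pw = 2 ^ t ∧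
      s'.reg .kk = ∑ i ∈ Finset.range t, f (e + 1 + i) * 2 ^ i
    have el : s₃.reg .len = N := by
      simp only [hs₃, St.set_reg, reduceCtorEq, if_false]
      exact ((hf₂.reg .len (by decide)).trans (hf₁.reg .len (by decide))).trans hN
    suffices H : Inv (s₃.reg .len) (c₄.run s₃) by rw [el] at H; exact H.2.2
    refine Cmd.run_for Inv ⟨by simp [hs₃], by simp [hs₃], by simp [hs₃]⟩ ?_
    rintro t ht s' hf' ⟨i1, i2, i3⟩
    have ei : s'.arr .inp = f := (hf'.arr .inp (by decide)).trans ei₂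
    rw [Cmd.run_seq, Cmd.run_when]
    rcases hf t with h1 | h1
    · rw [if_pos (by simp [ei, i1, h1])]
      exact ⟨by simp [i1, add_assoc], by simp [i2, pow_succ, mul_two],
        by simp [i2, i3, Finset.sum_range_succ, h1]⟩
    · rw [if_neg (by simp [ei, i1, h1])]
      exact ⟨by simp [i1, add_assoc], by simp [i2, pow_succ, mul_two],
        by simp [i2, i3, Finset.sum_range_succ, h1]⟩
  rw [hr]
  refine ⟨⟨?_, fun u hu v hv => ?_, fun v hv => ?_⟩, ?_, ?_, ?_⟩
  · rw [hf₄.reg .n (by decide)]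
    simp only [hs₃, St.set_reg, reduceCtorEq, if_false]
    exact ((hf₂.reg .n (by decide)).trans (hf₁.reg .n (by decide))).trans hn
  · have e1 : (c₄.run s₃).arr .inp = f := (hf₄.arr .inp (by decide)).trans ei₂
    have e2 : (c₄.run s₃).arr .R = s₁.arr .R :=
      (hf₄.arr .R (by decide)).trans (hf₂.arr .R (by decide))
    rw [e1, e2, r₁.2 u hu]
    convert h.adj u hu v hv
  · rw [hf₄.arr .wt (by decide)]
    exact r₂.2.2 v hv
  · rw [hf₄.reg .W (by decide)]
    simpa [hs₃] using r₂.2.1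
  · rw [hf₄.reg .sign (by decide)]
    simp [hs₃, h.sign]
  · rw [r₄]
    simp only [h.bits]
    exact sum_bits (by have := h.length; omega)

end WVI

namespace WVI

open Imp

/-! ### Deciding the problem -/

/-- The state at the start on the input `x`. -/
def start (x : List Bool) : State where
  reg a := if a = .len then x.length else 0
  arr a i := if a = .inp then (x.getD i false).toNat else 0

/-- The part of `main` that decides whether there is a good bound on the weight of components. -/
theorem rounds_spec {I : WVIInstance} {s : State} (h : Holds I.graph (extendWeight I.w) I.n s)
    (hW : s.reg .W = ∑ x ∈ Finset.range I.n, extendWeight I.w x) (hw : s.reg .w1 = s.reg .W + 1)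
    (ha : s.reg .ans = 0) :
    let s' := (Cmd.for_ .l .w1 round).run s
    (weightedVertexIntegrity I.G I.w ≤ s.reg .kk ∧ s'.reg .ans = 1) ∨
      (¬weightedVertexIntegrity I.G I.w ≤ s.reg .kk ∧ s'.reg .ans = 0) := by
  intro s'
  rw [weightedVertexIntegrity_le_iff, ← hW]
  set n := I.n
  set w := extendWeight I.w
  set W := s.reg .W
  set Good : ℕ → Prop := fun l => ∃ T ⊆ Finset.range n, Feasible I.graph w l T ∧
    l + W ≤ s.reg .kk + ∑ x ∈ T, w x with hGood
  set Inv : ℕ → State → Prop := fun t s' =>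
    ((∃ l < t, Good l) ∧ s'.reg .ans = 1) ∨ ((¬∃ l < t, Good l) ∧ s'.reg .ans = 0)
  have H : Inv (s.reg .w1) s' := by
    refine Cmd.run_for Inv (Or.inr ⟨by simp, ha⟩) ?_
    intro t ht s₁ hf₁ hI
    have h₁ : Holds I.graph w n (s₁.set .l t) :=
      (h.frame hf₁ (by decide) (by decide) (by decide) (by decide)).set (by decide) _
    have eW : s₁.reg .W = W := hf₁.reg .W (by decide)
    have ek : s₁.reg .kk = s.reg .kk := hf₁.reg .kk (by decide)
    obtain ⟨v, hv, hans⟩ := round_spec h₁ I.n_pos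
    simp only [St.set_reg, reduceCtorEq, if_true, if_false, eW, ek] at hv hans
    have hiff : t + W ≤ s.reg .kk + v ↔ Good t := by
      constructor
      · intro hle
        obtain ⟨T, hT, hTf, hTw⟩ := hv.1
        exact ⟨T, hT, hTf, by rwa [hTw]⟩
      · rintro ⟨T, hT, hTf, hle⟩
        exact hle.trans (Nat.add_le_add_left (hv.2 T hT hTf) _)
    have hex : (∃ l < t + 1, Good l) ↔ (∃ l < t, Good l) ∨ Good t := by
      constructor
      · rintro ⟨l, hl, hg⟩
        rcases Nat.lt_succ_iff_lt_or_eq.1 hl with hl | rfl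
        · exact Or.inl ⟨l, hl, hg⟩
        · exact Or.inr hg
      · rintro (⟨l, hl, hg⟩ | hg)
        · exact ⟨l, by omega, hg⟩
        · exact ⟨t, by omega, hg⟩
    by_cases hg : Good t
    · rw [if_pos (hiff.2 hg)] at hans
      exact Or.inl ⟨hex.2 (Or.inr hg), hans⟩
    · rw [if_neg fun h => hg (hiff.1 h)] at hans
      refine hI.imp (fun h => ⟨hex.2 (Or.inl h.1), hans.trans h.2⟩)
        fun h => ⟨fun h' => (hex.1 h').elim h.1 hg, hans.trans h.2⟩
  rw [hw] at H
  have e : (∃ l < W + 1, Good l) ↔ ∃ l ≤ W, Good l := by simp only [Nat.lt_succ_iff]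
  simpa only [Inv, e] using H

/-- A bound on the constant factor of the running time of `main`. -/
def mainConst : ℕ := header.size + parse.size + roundConst + 30

theorem main_spec (I : WVIInstance) :
    ((weightedVertexIntegrity I.G I.w : ℤ) ≤ I.k → (main.run (start I.encodeUnary)).reg .len = 1) ∧
    (¬(weightedVertexIntegrity I.G I.w : ℤ) ≤ I.k →
      (main.run (start I.encodeUnary)).reg .len = 0) ∧
    main.cost (start I.encodeUnary) ≤ mainConst *
      (I.encodeUnary.length ^ 7 * 2 ^ (modularWidth I.G * modularWidth I.G)) := by
  obtain ⟨e, hL⟩ := layout I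
  set N := I.encodeUnary.length
  set n := I.n
  set w := extendWeight I.w
  set F := 2 ^ (modularWidth I.G * modularWidth I.G)
  set s := start I.encodeUnary with hs
  have einp : s.arr .inp = fun i => (I.encodeUnary.getD i false).toNat := by
    ext i; simp [hs, start]
  have elen : s.reg .len = N := by simp [hs, start, N]
  rw [← einp] at hL
  have hsum : ∑ x ∈ Finset.range n, (w x + 1) = ∑ x ∈ Finset.range n, w x + n := by
    rw [Finset.sum_add_distrib]; simp
  have hNe : N = n + 1 + n * n + (∑ x ∈ Finset.range n, w x + n) + 1 + I.k.natAbs.bits.length := by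
    rw [← hsum]
    have h1 : e = n + 1 + n * n + ∑ x ∈ Finset.range n, (w x + 1) := hL.e_eq
    rw [← h1]; exact hL.length
  -- the number of vertices
  obtain ⟨c1, c2⟩ := scan_spec (s := s.set .p 0) (m := n)
    (by simp only [St.set_reg, reduceCtorEq, if_false, elen]; omega) (by simpa using hL.n_unary)
  have hf₀ := Cmd.frame_run header s
  have en₀ : (header.run s).reg .n = n := by
    have : (header.run s).reg .n = (scan.run (s.set .p 0)).reg .c := rfl
    rw [this, c1]
  have ep₀ : (header.run s).reg .p = n + 1 := by
    have : (header.run s).reg .p = (scan.run (s.set .p 0)).reg .p := rfl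
    rw [this, c2]; simp
  have hB1 : 1 ≤ N := by omega
  have hF1 : 1 ≤ F := Nat.one_le_two_pow
  have t₀ : header.cost s ≤ header.size * (N ^ 7 * F) :=
    cost_le_of_depth (by decide) hB1 hF1 (by decide) (by
      intro b hb
      have : b = .len := by revert b; decide
      subst this
      rw [elen])
  set s₀ := header.run s
  have elen₀ : s₀.reg .len = N := (hf₀.reg .len (by decide)).trans elen
  -- the rest of the input
  have hL₀ : Layout I N (s₀.arr .inp) e := by rw [hf₀.arr .inp (by decide)]; exact hL
  obtain ⟨p1, p2, p3, p4⟩ := parse_spec hL₀ elen₀ en₀ ep₀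
  have hf₁ := Cmd.frame_run parse s₀
  have t₁ : parse.cost s₀ ≤ parse.size * (N ^ 7 * F) :=
    cost_le_of_depth (by decide) hB1 hF1 (by decide) (by
      intro b hb
      have : b = .len ∨ b = .n := by revert b; decide
      rcases this with rfl | rfl
      · rw [elen₀]
      · rw [en₀]; omega)
  set s₁ := parse.run s₀
  set s₂ := (s₁.set .ans 0).set .w1 (s₁.reg .W + 1) with hs₂
  have h₂ : Holds I.graph w n s₂ := (p1.set (by decide) _).set (by decide) _
  have eW₂ : s₂.reg .W = s₁.reg .W := by simp [hs₂]
  have ek₂ : s₂.reg .kk = I.k.natAbs := by simp [hs₂, p4]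
  have ew₂ : s₂.reg .w1 = s₁.reg .W + 1 := by simp [hs₂]
  have hans := rounds_spec h₂ (eW₂.trans p2) (by rw [ew₂, eW₂]) (by simp [hs₂])
  have hf₃ := Cmd.frame_run (Cmd.for_ .l .w1 round) s₂
  have t₂ := Cmd.cost_for_le (i := .l) (b := .w1) (c := round) (s := s₂) (fun _ _ => True)
    (roundConst * (N ^ 6 * F)) trivial fun t ht s' hf' _ => ⟨trivial, by
      refine round_cost (G := I.graph) (w := w) (n := n)
        ((h₂.frame hf' (by decide) (by decide) (by decide) (by decide)).set (by decide) _)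
        (by omega) ?_ fun A hA hA2 => exists_small_module I.G hA hA2
      have ht' : t < ∑ x ∈ Finset.range n, w x + 1 := by rw [ew₂, p2] at ht; exact ht
      simp only [St.set_reg, if_true]
      omega⟩
  have ew₂' : s₂.reg .w1 = ∑ x ∈ Finset.range n, w x + 1 := by rw [ew₂, p2]
  rw [ew₂'] at t₂
  set s₃ := (Cmd.for_ .l .w1 round).run s₂
  have es₃ : s₃.reg .sign ≠ 0 ↔ I.k < 0 := by
    rw [hf₃.reg .sign (by decide), ← p3]; simp [hs₂]
  have hr : (main.run s).reg .len = if s₃.reg .sign ≠ 0 then 0 else s₃.reg .ans := by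
    have : main.run s = (Cmd.set .len (.var .ans)).run
        ((Cmd.when (.var .sign) (.set .ans 0)).run s₃) := rfl
    rw [this, Cmd.run_when]
    split <;> next hsg => simp at hsg; simp [hsg]
  refine ⟨fun h => ?_, fun h => ?_, ?_⟩
  · have hk : ¬I.k < 0 := by have := Int.natCast_nonneg (weightedVertexIntegrity I.G I.w); omega
    rw [hr, if_neg fun h => hk (es₃.1 h)]
    rw [ek₂] at hans
    refine (hans.resolve_right fun h' => h'.1 ?_).2
    omega
  · rw [hr]
    split
    · rfl
    · next hsg =>
      have hk : ¬I.k < 0 := fun h => hsg (es₃.2 h)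
      rw [ek₂] at hans
      refine (hans.resolve_left fun h' => h ?_).2
      omega
  · have hif : (Cmd.when (.var .sign) (.set .ans 0) : Com).cost s₃ ≤ 4 := by
      rw [Cmd.cost_when]
      split
      · exact le_rfl
      · exact (by decide : 3 ≤ 4)
    have hr : main.cost s = header.cost s + (parse.cost s₀ + (2 + (4 +
        ((Cmd.for_ .l .w1 round).cost s₂ + ((Cmd.when (.var .sign) (.set .ans 0) : Com).cost s₃ +
          2))))) := by
      rw [main]
      iterate 6 rw [Cmd.cost_seq]
      rfl
    rw [hr]
    set P := N ^ 7 * F with hP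
    have hNP : N ≤ P := (Nat.le_self_pow (by omega) N).trans (Nat.le_mul_of_pos_right _ hF1)
    have hle : ∑ x ∈ Finset.range n, w x + 1 ≤ N := by omega
    calc _ ≤ header.size * P + (parse.size * P + ((3 + (∑ x ∈ Finset.range n, w x + 1) *
          (roundConst * (N ^ 6 * F) + 5)) + 12)) := by omega
      _ ≤ header.size * P + (parse.size * P + ((3 + N * (roundConst * (N ^ 6 * F) + 5)) + 12)) := by
          gcongr
      _ = header.size * P + parse.size * P + roundConst * P + 5 * N + 15 * 1 := by rw [hP]; ring
      _ ≤ header.size * P + parse.size * P + roundConst * P + 5 * P + 15 * P := by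
          gcongr; omega
      _ ≤ _ := by rw [mainConst, add_mul, add_mul, add_mul]; omega

theorem var_code_injective : Function.Injective Var.ctorIdx := by
  intro a b h
  rw [← Var.ofNat_ctorIdx a, ← Var.ofNat_ctorIdx b, h]

theorem arr_code_injective : Function.Injective Arr.ctorIdx := by
  intro a b h
  rw [← Arr.ofNat_ctorIdx a, ← Arr.ofNat_ctorIdx b, h]

theorem agree_start (x : List Bool) :
    Agree Var.ctorIdx Arr.ctorIdx (start x) (RAMState.start x) := by
  refine ⟨fun a => ?_, fun a => ?_⟩
  · cases a <;> rfl
  · cases a <;> rfl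

end WVI

theorem mainTheorem2 : unaryWVIByModularWidth.IsFPT := by
  refine ⟨WVI.main.compile WVI.Var.ctorIdx WVI.Arr.ctorIdx 0,
    fun k => WVI.mainConst * 2 ^ (k * k), 7, ?_, fun I => ?_⟩
  · have h : Primrec fun k : ℕ => WVI.mainConst * 2 ^ (k * k) := by
      have hpow : Primrec₂ fun a b : ℕ => a ^ b := Primrec₂.unpaired'.1 Nat.Primrec.pow
      exact Primrec.nat_mul.comp (Primrec.const _)
        (hpow.comp (Primrec.const 2) (Primrec.nat_mul.comp Primrec.id Primrec.id))
    exact h.to_comp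
  · obtain ⟨h1, h2, h3⟩ := WVI.main_spec I
    obtain ⟨τ, hx, ha, -⟩ := WVI.main.compile_exec WVI.var_code_injective WVI.arr_code_injective 0
      (WVI.agree_start I.encodeUnary)
    -- `len` is the first variable, so it is kept in register `0`, which holds input length and answer
    have hlen : τ.reg 0 = (WVI.main.run (WVI.start I.encodeUnary)).reg .len := ha.1 .len
    refine ⟨_, h3.trans_eq ?_, τ, hx, fun h => hlen.trans (h1 h), fun h => hlen.trans (h2 h)⟩
    show _ = WVI.mainConst * 2 ^ (modularWidth I.G * modularWidth I.G) * I.encodeUnary.length ^ 7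
    ring
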